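/- **Setting.** Let $X$ be a compact Polish space, $Z$ a locally compact Polish space, and $\mathcal F$ a minimal foliated structure on $X$ (a maximal foliated atlas of leaf dimension $n$, transversely modelled on $Z$; minimal means that every leaf is dense). A regular foliated atlas $\{U_i,\phi_i\}$ of $\mathcal F$ is one such that each $\overline{U_i}$ is compact and contained in the domain of a chart of $\mathcal F$ extending $\phi_i$, the cover $\{U_i\}$ is locally finite, and each plaque of $U_i$ meets at most one plaque of $U_j$. It induces a defining cocycle $\{U_i,p_i,h_{ij}\}$: the distinguished submersions $p_i:U_i\to T_i$ and the homeomorphisms $h_{ij}:p_i(U_i\cap U_j)\to p_j(U_i\cap U_j)$ with $h_{ij}p_i=p_j$ on $U_i\cap U_j$. Let $\mathcal H$ be the pseudogroup on $T=\bigsqcup_iT_i$ generated by the maps $h_{ij}$. For a set $S$ of homeomorphisms between open subsets of $T$, let $\overline S$ be the set of homeomorphisms $g$ between open subsets of $T$ that are in the closure of $\{f\in S\mid \operatorname{dom}f=\operatorname{dom}g\}$ in $C(\operatorname{dom}g,T)$ with the compact-open topology, and let $\overline{\mathcal H}$ be the set of homeomorphisms between open subsets of $T$ that locally belong to $\overline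 S$. Call $S\subset\mathcal H$ *admissible* if it is closed under composition, inversion and restriction to open sets, every element of $\mathcal H$ locally belongs to $S$, $\mathcal H$ is equicontinuous with $S$ (there are an open cover $\{T'_k\}$ of $T$ with metrics $d_k$ on $T'_k$ inducing its topology, which are quasi-locally equal (for some function $\delta_0:(0,\infty)\to(0,\infty)$, every $z\in T'_k\cap T'_l$ has a neighborhood in $T'_k\cap T'_l$ on which $d_k(x,y)<\delta_0(\varepsilon)$ implies $d_l(x,y)<\varepsilon$ for all $\varepsilon>0$), and, for each $\varepsilon>0$, some $\delta>0$ such that $d_k(x,y)<\delta$ implies $d_l(h(x),h(y))<\varepsilon$ for all $h\in S$, all $k,l$, and all $x,y\in T'_k\cap h^{-1}(T'_l)$), and both $S$ and $\overline S$ satisfy the strong quasi-analyticity condition: any of their elements that is the identity on some non-empty open subset of its domain is the identity on its domain. **Construction.** Given a regular foliated atlas, an admissible $S$, an index $i_0$ and a base point $x_0\in U_{i_0}$, let $\widehat T_0$ be the set of germs $\operatorname{germ}(g,x)$ with $g\in\overline{\mathcal H}$, $x\in\operatorname{dom}g$ and $g(x)=p_{i_0}(x_0)$. It is a subspace of the space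 of all germs of maps in $\overline{\mathcal H}$, endowed with the quotient topology by the germ map of $\{(g,x)\mid g\in\overline S,\ x\in\operatorname{dom}g\}$, where $\overline S$ has the compact-open topology of partial maps with open domains. Let $\hat\pi_0:\widehat T_0\to T$, $\operatorname{germ}(g,x)\mapsto x$, and $\widehat h(\operatorname{germ}(g,x))=\operatorname{germ}(gh^{-1},h(x))$ for $h\in\mathcal H$ and $x\in\operatorname{dom} h$. Let $\widehat X_0$ be the quotient of $$\widetilde X_0=\{(x,\gamma,i)\mid x\in U_i,\ \gamma\in\widehat T_0,\ p_i(x)=\hat\pi_0(\gamma)\}\subset\bigsqcup_iU_i\times\hat\pi_0^{-1}(T_i)$$ by the relation $(x,\gamma,i)\sim(y,\delta,j)$ if $x=y$ and $\gamma=\widehat{h_{ji}}(\delta)$, let $\hat\pi_0:\widehat X_0\to X$, $[x,\gamma,i]\mapsto x$, and let $\widehat{\mathcal F}_0$ be the foliated structure on $\widehat X_0$ whose distinguished submersions are the maps $[x,\gamma,i]\mapsto\gamma$ (for fixed $i$); thus its plaques are the fibers of these maps. **Proposition.** Let $(\widehat X_0,\widehat{\mathcal F}_0,\hat\pi_0)$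 and $(\widehat X_0',\widehat{\mathcal F}_0',\hat\pi_0')$ be obtained from the same $(X,\mathcal F)$ by using any two regular foliated atlases of $\mathcal F$ (equal or not), any admissible families $S$ and $S'$ for them, and any two base points of $X$ (equal or not). Then there is a foliated homeomorphism $F:(\widehat X_0,\widehat{\mathcal F}_0)\to(\widehat X'_0,\widehat{\mathcal F}'_0)$ (a homeomorphism that maps leaves onto leaves and carries one foliated structure to the other) such that $\hat\pi_0'F=\hat\pi_0$. In particular, up to such homeomorphisms, $(\widehat X_0,\widehat{\mathcal F}_0)$ and $\hat\pi_0$ are independent of the base point and of the regular defining cocycle. -/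

import Mathlib

open Set Filter Topology

universe u v w

noncomputable section

namespace Molino

/-! ### Local transformations, pseudogroups and pseudo-star-groups

A local transformation of `T` is an `OpenPartialHomeomorph T T`. Two of them are the same local
transformation when they have the same graph (`≈`), so the families below are saturated for `≈`. -/

section Pseudogroups

variable {T : Type u} [TopologicalSpace T]

/-- A pseudogroup of local transformations of `T`. -/
structure IsPseudogroup (H : Set (OpenPartialHomeomorph T T)) : Prop where
  refl_mem : OpenPartialHomeomorph.refl T ∈ H
  trans_mem : ∀ e ∈ H, ∀ f ∈ H, e.trans f ∈ H
  symm_mem : ∀ e ∈ H, e.symm ∈ H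
  restr_mem : ∀ e ∈ H, ∀ O : Set T, IsOpen O → e.restr O ∈ H
  union_mem : ∀ e : OpenPartialHomeomorph T T,
    (∀ x ∈ e.source, ∃ O : Set T, IsOpen O ∧ x ∈ O ∧ e.restr O ∈ H) → e ∈ H
  mem_of_eqOnSource : ∀ e ∈ H, ∀ f : OpenPartialHomeomorph T T, f ≈ e → f ∈ H

/-- The pseudogroup generated by a family of local transformations. -/
def generatedPseudogroup (E : Set (OpenPartialHomeomorph T T)) :
    Set (OpenPartialHomeomorph T T) :=
  ⋂₀ {H | IsPseudogroup H ∧ E ⊆ H}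

/-- A local pseudo-star-group: a family of local transformations that is closed under composition,
inversion and restriction to open subsets of the domains. -/
structure IsLocalPseudoStarGroup (S : Set (OpenPartialHomeomorph T T)) : Prop where
  trans_mem : ∀ e ∈ S, ∀ f ∈ S, e.trans f ∈ S
  symm_mem : ∀ e ∈ S, e.symm ∈ S
  restr_mem : ∀ e ∈ S, ∀ O : Set T, IsOpen O → e.restr O ∈ S
  mem_of_eqOnSource : ∀ e ∈ S, ∀ f : OpenPartialHomeomorph T T, f ≈ e → f ∈ S

/-- A map in `S` that is the identity on some non-empty open subset of its domain is the identity
on its whole domain. -/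
def IsQuasiAnalyticFamily (S : Set (OpenPartialHomeomorph T T)) : Prop :=
  ∀ h ∈ S, (∃ O : Set T, IsOpen O ∧ O.Nonempty ∧ O ⊆ h.source ∧ ∀ x ∈ O, h x = x) →
    ∀ x ∈ h.source, h x = x

/-- The compact-open topology on local transformations (as partial maps with open domain), with
subbasic open sets `{h | K ⊆ dom h, h(K) ⊆ O}` for `K` compact and `O` open. -/
instance compactOpenTopology : TopologicalSpace (OpenPartialHomeomorph T T) :=
  TopologicalSpace.generateFrom
    {N | ∃ K O : Set T, IsCompact K ∧ IsOpen O ∧ N = {h : OpenPartialHomeomorph T T | K ⊆ h.source ∧ MapsTo h K O}}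

/-- `S̄`: the local transformations `g` that are in the closure of `S ∩ C(O, T)` for the
compact-open topology, where `O = dom g`. -/
def starClosure (S : Set (OpenPartialHomeomorph T T)) : Set (OpenPartialHomeomorph T T) :=
  {g | g ∈ closure {f | f ∈ S ∧ f.source = g.source}}

/-- The closure `H̄` of the pseudogroup generated by `S`: the local transformations which, around
every point of their domain, restrict to elements of `S̄`. -/
def closurePseudogroup (S : Set (OpenPartialHomeomorph T T)) :
    Set (OpenPartialHomeomorph T T) :=
  {h | ∀ x ∈ h.source, ∃ O : Set T, IsOpen O ∧ x ∈ O ∧ O ⊆ h.source ∧ h.restr O ∈ starClosure S}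

theorem starClosure_subset_closurePseudogroup (S : Set (OpenPartialHomeomorph T T)) :
    starClosure S ⊆ closurePseudogroup S := by
  intro g hg x hx
  refine ⟨g.source, g.open_source, hx, Subset.rfl, ?_⟩
  rw [OpenPartialHomeomorph.restr_eq_of_source_subset Subset.rfl]
  exact hg

variable (T) in
/-- A cover of the space `T` by quasi-locally equal metric spaces that induces the topology of `T`,
i.e. a representative of a quasi-local metric on `T` compatible with the topology. -/
structure QuasiLocalMetric where
  ι : Type u
  dom : ι → Set T
  metric : ∀ i, MetricSpace (dom i)
  isOpen_dom : ∀ i, IsOpen (dom i)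
  cover : ∀ x, ∃ i, x ∈ dom i
  topology_eq : ∀ i, (metric i).toPseudoMetricSpace.toUniformSpace.toTopologicalSpace =
    (instTopologicalSpaceSubtype : TopologicalSpace (dom i))
  quasiLocallyEqual : ∃ δ : ℝ → ℝ, (∀ ε > 0, 0 < δ ε) ∧
    ∀ i j, ∀ z ∈ dom i ∩ dom j, ∃ O : Set T, IsOpen O ∧ z ∈ O ∧ O ⊆ dom i ∩ dom j ∧
      ∀ ε > 0, ∀ (x y : T) (xi : x ∈ dom i) (yi : y ∈ dom i) (xj : x ∈ dom j) (yj : y ∈ dom j),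
        x ∈ O → y ∈ O → (metric i).dist ⟨x, xi⟩ ⟨y, yi⟩ < δ ε →
          (metric j).dist ⟨x, xj⟩ ⟨y, yj⟩ < ε

/-- The equicontinuity condition for a family `S` of local transformations. -/
def QuasiLocalMetric.IsEquicontinuousFamily (Q : QuasiLocalMetric T)
    (S : Set (OpenPartialHomeomorph T T)) : Prop :=
  ∀ ε > 0, ∃ δ > 0, ∀ h ∈ S, ∀ (i j : Q.ι) (x y : T) (xi : x ∈ Q.dom i) (yi : y ∈ Q.dom i)
    (hxj : h x ∈ Q.dom j) (hyj : h y ∈ Q.dom j), x ∈ h.source → y ∈ h.source →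
      (Q.metric i).dist ⟨x, xi⟩ ⟨y, yi⟩ < δ → (Q.metric j).dist ⟨h x, hxj⟩ ⟨h y, hyj⟩ < ε

/-- The conditions on a local sub-pseudo-star-group `S` of the pseudogroup `H` that is used to
construct the Molino space: `S` generates `H` (every map in `H` locally belongs to `S`), `H` is
equicontinuous and strongly quasi-analytic with `S`, and `H̄` is strongly quasi-analytic
with `S̄`. -/
structure IsAdmissible (H S : Set (OpenPartialHomeomorph T T)) : Prop where
  isLocal : IsLocalPseudoStarGroup S
  subset : S ⊆ H
  generates : ∀ h ∈ H, ∀ x ∈ h.source, ∃ O : Set T, IsOpen O ∧ x ∈ O ∧ h.restr O ∈ S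
  equicontinuous : ∃ Q : QuasiLocalMetric T, Q.IsEquicontinuousFamily S
  quasiAnalytic : IsQuasiAnalyticFamily S
  quasiAnalytic_closure : IsQuasiAnalyticFamily (starClosure S)

/-! ### Germs -/

/-- The germ of `g` at `x`. -/
def germ (g : OpenPartialHomeomorph T T) (x : T) : Σ x : T, Germ (𝓝 x) T :=
  ⟨x, (g : T → T)⟩

/-- `T̂`: the set of germs of maps in `H̄`. -/
def That (S : Set (OpenPartialHomeomorph T T)) : Type u :=
  {γ : Σ x : T, Germ (𝓝 x) T //
    ∃ g ∈ closurePseudogroup S, ∃ x ∈ g.source, γ = germ g x}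

/-- `S̄ * T = {(g, x) | g ∈ S̄, x ∈ dom g}`, as a subspace of `S̄ × T`. -/
abbrev StarPairs (S : Set (OpenPartialHomeomorph T T)) : Type u :=
  {q : OpenPartialHomeomorph T T × T // q.1 ∈ starClosure S ∧ q.2 ∈ q.1.source}

/-- The germ map `S̄ * T → T̂`. -/
def germMap (S : Set (OpenPartialHomeomorph T T)) (q : StarPairs S) : That S :=
  ⟨germ q.1.1 q.1.2, q.1.1, starClosure_subset_closurePseudogroup S q.2.1, q.1.2, q.2.2, rfl⟩

/-- `T̂` carries the quotient topology of the germ map. -/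
instance (S : Set (OpenPartialHomeomorph T T)) : TopologicalSpace (That S) :=
  TopologicalSpace.coinduced (germMap S) inferInstance

/-- `T̂₀`: the subspace of `T̂` of the germs with target `x₀`. -/
abbrev That₀ (S : Set (OpenPartialHomeomorph T T)) (x₀ : T) : Type u :=
  {γ : That S // γ.1.2.value = x₀}

/-- `π̂₀ : T̂₀ → T`, the source of a germ. -/
def That₀.source {S : Set (OpenPartialHomeomorph T T)} {x₀ : T} (γ : That₀ S x₀) : T := γ.1.1.1

/-- The graph of `ĥ : germ(g, x) ↦ germ(g h⁻¹, h(x))`. -/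
def hatGraph {S : Set (OpenPartialHomeomorph T T)} {x₀ : T} (h : OpenPartialHomeomorph T T)
    (γ δ : That₀ S x₀) : Prop :=
  ∃ g ∈ closurePseudogroup S, ∃ x, x ∈ g.source ∧ x ∈ h.source ∧
    γ.1.1 = germ g x ∧ δ.1.1 = germ (h.symm.trans g) (h x)

end Pseudogroups

/-! ### Leaves and foliated homeomorphisms -/

section Leaves

variable {X : Type*} [TopologicalSpace X] {Y : Type*} [TopologicalSpace Y]

/-- `A` is a relatively open subset of `P`. -/
def IsOpenIn (A P : Set X) : Prop := ∃ O, IsOpen O ∧ A = P ∩ O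

/-- The leaf topology of a foliated atlas with set of plaques `Ps`, generated by the relatively open
subsets of the plaques. -/
abbrev leafTopology (Ps : Set (Set X)) : TopologicalSpace X :=
  TopologicalSpace.generateFrom {A | ∃ P ∈ Ps, IsOpenIn A P}

/-- The leaf through `x`: its connected component for the leaf topology. -/
def leaf (Ps : Set (Set X)) (x : X) : Set X :=
  @connectedComponent X (leafTopology Ps) x

/-- The homeomorphism `F` between spaces with foliated atlases with sets of plaques `Ps` and `Qs` is
foliated: it maps leaves onto leaves, and it carries the first foliated structure to the second
one (plaques of the first one are mapped to sets coherent with the plaques of the second one). -/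
structure IsFoliatedHomeomorph (Ps : Set (Set X)) (Qs : Set (Set Y)) (F : X ≃ₜ Y) : Prop where
  image_leaf : ∀ x, F '' leaf Ps x = leaf Qs (F x)
  coherent : ∀ P ∈ Ps, ∀ Q ∈ Qs, IsOpenIn (F '' P ∩ Q) (F '' P) ∧ IsOpenIn (F '' P ∩ Q) Q

end Leaves

/-! ### Foliated spaces -/

section Foliated

variable (n : ℕ) (X : Type u) (Z : Type v) [TopologicalSpace X] [TopologicalSpace Z]

/-- A foliated chart of leaf dimension `n` transversely modelled on `Z`: a homeomorphism of an open
subset of `X` to `B × T`, with `B` an open ball of `ℝⁿ` and `T` open in `Z`. -/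
structure FoliatedChart where
  toHomeo : OpenPartialHomeomorph X (EuclideanSpace ℝ (Fin n) × Z)
  center : EuclideanSpace ℝ (Fin n)
  radius : ℝ
  radius_pos : 0 < radius
  base : Set Z
  isOpen_base : IsOpen base
  target_eq : toHomeo.target = Metric.ball center radius ×ˢ base

variable {n X Z}

namespace FoliatedChart

/-- The distinguished open set of the chart. -/
def source (c : FoliatedChart n X Z) : Set X := c.toHomeo.source

/-- The distinguished submersion `p : U → T`. -/
def proj (c : FoliatedChart n X Z) (x : c.source) : c.base :=
  ⟨(c.toHomeo x.1).2, by
    have h := c.toHomeo.map_source x.2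
    rw [c.target_eq] at h
    exact h.2⟩

/-- The plaque over `y`. -/
def plaque (c : FoliatedChart n X Z) (y : c.base) : Set X :=
  Subtype.val '' (c.proj ⁻¹' {y})

/-- Two charts are coherently foliated: intersections of plaques are open in both plaques. -/
def Coherent (c d : FoliatedChart n X Z) : Prop :=
  ∀ y z, IsOpenIn (c.plaque y ∩ d.plaque z) (c.plaque y) ∧
    IsOpenIn (c.plaque y ∩ d.plaque z) (d.plaque z)

end FoliatedChart

variable (n X Z) in
/-- A foliated structure on `X`: a maximal foliated atlas. -/
structure FoliatedStructure where
  charts : Set (FoliatedChart n X Z)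
  cover : ∀ x, ∃ c ∈ charts, x ∈ c.source
  coherent : ∀ c ∈ charts, ∀ d ∈ charts, c.Coherent d
  maximal : ∀ c : FoliatedChart n X Z, (∀ d ∈ charts, c.Coherent d) → c ∈ charts

namespace FoliatedStructure

/-- The plaques of a foliated structure. -/
def plaques (ℱ : FoliatedStructure n X Z) : Set (Set X) :=
  {P | ∃ c ∈ ℱ.charts, ∃ y, P = c.plaque y}

/-- A foliated space is minimal when all of its leaves are dense. -/
def IsMinimal (ℱ : FoliatedStructure n X Z) : Prop := ∀ x, Dense (leaf ℱ.plaques x)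

end FoliatedStructure

/-- A regular foliated atlas of `ℱ`, indexed by `ι`. -/
structure RegularAtlas (ℱ : FoliatedStructure n X Z) (ι : Type w) where
  chart : ι → FoliatedChart n X Z
  chart_mem : ∀ i, chart i ∈ ℱ.charts
  cover : ∀ x, ∃ i, x ∈ (chart i).source
  isCompact_closure : ∀ i, IsCompact (closure (chart i).source)
  extends_chart : ∀ i, ∃ c ∈ ℱ.charts, closure (chart i).source ⊆ c.source ∧
    EqOn (chart i).toHomeo c.toHomeo (chart i).source
  locallyFinite : LocallyFinite fun i => (chart i).source
  plaque_unique : ∀ i j (y : (chart i).base) (z z' : (chart j).base),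
    ((chart i).plaque y ∩ (chart j).plaque z).Nonempty →
    ((chart i).plaque y ∩ (chart j).plaque z').Nonempty → z = z'

namespace RegularAtlas

variable {ℱ : FoliatedStructure n X Z} {ι : Type w} (𝒰 : RegularAtlas ℱ ι)

/-- The distinguished open set `U_i`. -/
abbrev U (i : ι) : Set X := (𝒰.chart i).source

/-- The complete transversal `T = ⨆ T_i` (disjoint union). -/
abbrev Transversal : Type (max v w) := Σ i, (𝒰.chart i).base

/-- `p_i : U_i → T_i ⊆ T`. -/
def p (i : ι) (x : 𝒰.U i) : 𝒰.Transversal := ⟨i, (𝒰.chart i).proj x⟩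

/-- `T_{ij} = p_i(U_i ∩ U_j)`. -/
def overlap (i j : ι) : Set 𝒰.Transversal :=
  {t | ∃ (x : X) (xi : x ∈ 𝒰.U i) (_ : x ∈ 𝒰.U j), 𝒰.p i ⟨x, xi⟩ = t}

open Classical in
/-- The map `h_{ij} : p_i(x) ↦ p_j(x)` on `T_{ij}` (extended by the identity off `T_{ij}`). -/
def holFun (i j : ι) (t : 𝒰.Transversal) : 𝒰.Transversal :=
  if h : t ∈ 𝒰.overlap i j then 𝒰.p j ⟨h.choose, h.choose_spec.choose_spec.choose⟩ else t

theorem holFun_p {i j : ι} {x : X} (xi : x ∈ 𝒰.U i) (xj : x ∈ 𝒰.U j) :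
    𝒰.holFun i j (𝒰.p i ⟨x, xi⟩) = 𝒰.p j ⟨x, xj⟩ := by
  have h : 𝒰.p i ⟨x, xi⟩ ∈ 𝒰.overlap i j := ⟨x, xi, xj, rfl⟩
  rw [holFun, dif_pos h]
  have e := h.choose_spec.choose_spec.choose_spec
  have e' : (𝒰.chart i).proj ⟨h.choose, h.choose_spec.choose⟩ = (𝒰.chart i).proj ⟨x, xi⟩ :=
    eq_of_heq (Sigma.mk.inj e).2
  have key := 𝒰.plaque_unique i j ((𝒰.chart i).proj ⟨x, xi⟩)
    ((𝒰.chart j).proj ⟨h.choose, h.choose_spec.choose_spec.choose⟩) ((𝒰.chart j).proj ⟨x, xj⟩)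
    ⟨h.choose, ⟨⟨h.choose, h.choose_spec.choose⟩, e', rfl⟩,
      ⟨⟨h.choose, h.choose_spec.choose_spec.choose⟩, rfl, rfl⟩⟩
    ⟨x, ⟨⟨x, xi⟩, rfl, rfl⟩, ⟨⟨x, xj⟩, rfl, rfl⟩⟩
  exact congrArg (Sigma.mk j) key

theorem continuous_p (i : ι) : Continuous (𝒰.p i) := by
  refine continuous_sigmaMk.comp (Continuous.subtype_mk ?_ _)
  exact continuous_snd.comp (continuousOn_iff_continuous_domRestrict.1
    (𝒰.chart i).toHomeo.continuousOn)

/-- Local sections of `p_i` through each point of `U_i`. -/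
theorem exists_section (i : ι) (x : 𝒰.U i) :
    ∃ s : (𝒰.chart i).base → 𝒰.U i, Continuous s ∧ (∀ t, 𝒰.p i (s t) = ⟨i, t⟩) ∧
      s ((𝒰.chart i).proj x) = x := by
  set c := 𝒰.chart i with hc
  have hx : c.toHomeo x.1 ∈ c.toHomeo.target := c.toHomeo.map_source x.2
  have ht : ∀ t : c.base, ((c.toHomeo x.1).1, (t : Z)) ∈ c.toHomeo.target := by
    intro t
    rw [c.target_eq] at hx ⊢
    exact ⟨hx.1, t.2⟩
  refine ⟨fun t => ⟨c.toHomeo.symm ((c.toHomeo x.1).1, (t : Z)), c.toHomeo.map_target (ht t)⟩,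
    ?_, ?_, ?_⟩
  · refine Continuous.subtype_mk ?_ _
    exact c.toHomeo.symm.continuousOn.comp_continuous (by fun_prop) ht
  · intro t
    refine congrArg (Sigma.mk i) (Subtype.ext ?_)
    change (c.toHomeo (c.toHomeo.symm _)).2 = _
    rw [c.toHomeo.right_inv (ht t)]
  · exact Subtype.ext (c.toHomeo.left_inv x.2)

theorem isOpen_overlap (i j : ι) : IsOpen (𝒰.overlap i j) := by
  rw [isOpen_iff_mem_nhds]
  rintro _ ⟨x, xi, xj, rfl⟩
  obtain ⟨s, hs, hps, hsx⟩ := 𝒰.exists_section i ⟨x, xi⟩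
  have hopen : IsOpen {t | ((s t : 𝒰.U i) : X) ∈ 𝒰.U j} :=
    (𝒰.chart j).toHomeo.open_source.preimage (continuous_subtype_val.comp hs)
  refine mem_of_superset ((isOpenMap_sigmaMk (σ := fun k => (𝒰.chart k).base) _ hopen).mem_nhds
    ⟨(𝒰.chart i).proj ⟨x, xi⟩, ?_, rfl⟩) ?_
  · change ((s _ : 𝒰.U i) : X) ∈ 𝒰.U j
    rw [hsx]
    exact xj
  · rintro _ ⟨t, ht, rfl⟩
    exact ⟨s t, (s t).2, ht, hps t⟩

theorem continuousOn_holFun (i j : ι) : ContinuousOn (𝒰.holFun i j) (𝒰.overlap i j) := by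
  rintro _ ⟨x, xi, xj, rfl⟩
  apply ContinuousAt.continuousWithinAt
  obtain ⟨s, hs, hps, hsx⟩ := 𝒰.exists_section i ⟨x, xi⟩
  have hopen : IsOpen {t | ((s t : 𝒰.U i) : X) ∈ 𝒰.U j} :=
    (𝒰.chart j).toHomeo.open_source.preimage (continuous_subtype_val.comp hs)
  have hmem : (𝒰.chart i).proj ⟨x, xi⟩ ∈ {t | ((s t : 𝒰.U i) : X) ∈ 𝒰.U j} := by
    change ((s _ : 𝒰.U i) : X) ∈ 𝒰.U j
    rw [hsx]
    exact xj
  refine ((IsOpenEmbedding.sigmaMk (σ := fun k => (𝒰.chart k).base) (i := i)).continuousAt_iff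
    (x := (𝒰.chart i).proj ⟨x, xi⟩)).1 ?_
  refine ContinuousOn.continuousAt ?_ (hopen.mem_nhds hmem)
  rw [continuousOn_iff_continuous_domRestrict]
  have e : ({t | ((s t : 𝒰.U i) : X) ∈ 𝒰.U j}).domRestrict
      (fun t => 𝒰.holFun i j ⟨i, t⟩) =
      fun t => 𝒰.p j ⟨s t.1, t.2⟩ := by
    funext t
    have := 𝒰.holFun_p (s t.1).2 t.2
    rw [← this, Subtype.coe_eta, hps]
    rfl
  refine Eq.mpr (congrArg Continuous e) ?_
  exact (𝒰.continuous_p j).comp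
    (Continuous.subtype_mk (continuous_subtype_val.comp (hs.comp continuous_subtype_val)) _)

/-- The elementary holonomy transformation `h_{ij} : T_{ij} → T_{ji}`, with `h_{ij} p_i = p_j` on
`U_i ∩ U_j`. -/
def hol (i j : ι) : OpenPartialHomeomorph 𝒰.Transversal 𝒰.Transversal where
  toFun := 𝒰.holFun i j
  invFun := 𝒰.holFun j i
  source := 𝒰.overlap i j
  target := 𝒰.overlap j i
  map_source' := by
    rintro _ ⟨x, xi, xj, rfl⟩
    exact ⟨x, xj, xi, (𝒰.holFun_p xi xj).symm⟩
  map_target' := by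
    rintro _ ⟨x, xj, xi, rfl⟩
    exact ⟨x, xi, xj, (𝒰.holFun_p xj xi).symm⟩
  left_inv' := by
    rintro _ ⟨x, xi, xj, rfl⟩
    rw [𝒰.holFun_p xi xj, 𝒰.holFun_p xj xi]
  right_inv' := by
    rintro _ ⟨x, xj, xi, rfl⟩
    rw [𝒰.holFun_p xj xi, 𝒰.holFun_p xi xj]
  open_source := 𝒰.isOpen_overlap i j
  open_target := 𝒰.isOpen_overlap j i
  continuousOn_toFun := 𝒰.continuousOn_holFun i j
  continuousOn_invFun := 𝒰.continuousOn_holFun j i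

/-- The representative `H` on `T` of the holonomy pseudogroup induced by the defining cocycle
`{U_i, p_i, h_{ij}}`. -/
def holonomyPseudogroup : Set (OpenPartialHomeomorph 𝒰.Transversal 𝒰.Transversal) :=
  generatedPseudogroup {h | ∃ i j, h = 𝒰.hol i j}

/-! ### The Molino space -/

variable (S : Set (OpenPartialHomeomorph 𝒰.Transversal 𝒰.Transversal)) (t₀ : 𝒰.Transversal)

/-- `X̃₀`: the subspace of `⨆ U_i × T̂_{i,0}` (disjoint union) of the triples `(x, γ, i)` with
`p_i(x) = π̂₀(γ)`. This equation forces `γ` to belong to `T̂_{i,0} = π̂₀⁻¹(T_i)`. -/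
abbrev XTilde : Type (max u v w) :=
  {q : Σ i, 𝒰.U i × That₀ S t₀ // 𝒰.p q.1 q.2.1 = q.2.2.source}

/-- `(x, γ, i) ∼ (y, δ, j)` when `x = y` and `γ = ĥ_{ji}(δ)`. -/
def glue (q r : 𝒰.XTilde S t₀) : Prop :=
  (q.1.2.1 : X) = r.1.2.1 ∧ hatGraph (𝒰.hol r.1.1 q.1.1) r.1.2.2 q.1.2.2

/-- `X̂₀`: the quotient space of `X̃₀`. -/
def XHat : Type (max u v w) := Quot (𝒰.glue S t₀)

instance : TopologicalSpace (𝒰.XHat S t₀) := inferInstanceAs (TopologicalSpace (Quot _))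

/-- `π̂₀ : X̂₀ → X`, `[x, γ, i] ↦ x`. -/
def piHat : 𝒰.XHat S t₀ → X := Quot.lift (fun q => (q.1.2.1 : X)) fun _ _ h => h.1

/-- The plaques of `X̂₀`: the fibres `{[x, γ, i] | x ∈ U_i, p_i(x) = π̂₀(γ)}` of the distinguished
submersions `p̂_{i,0} : Û_{i,0} → T̂_{i,0}`, `[x, γ, i] ↦ γ`, of the foliated structure `F̂₀`. -/
def hatPlaques : Set (Set (𝒰.XHat S t₀)) :=
  {P | ∃ (i : ι) (γ : That₀ S t₀), γ.source.1 = i ∧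
    P = {z | ∃ q : 𝒰.XTilde S t₀, q.1.1 = i ∧ q.1.2.2 = γ ∧ z = Quot.mk _ q}}

end RegularAtlas
end Foliated
end Molino
end

/-! A point `[x, γ, i]` of `X̂₀`, with `γ` the germ of `g`, is determined by the germ at `x` of the
map `g ∘ p_i : X → T`. Every `x` has an open neighbourhood on which `p_i` and `p'_j` have the same
fibres, so that `c p_i = p'_j` there for a homeomorphism `c` between open subsets of `T` and `T'`.
The key point is that such box maps `c`, `d` carry `S̄` to `S̄'`, locally and continuously, by
`f ↦ d f c⁻¹`: by equicontinuity, the holonomy germs between two compact cores of boxes extend to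
neighbourhoods of uniform size, as elements of `S` which `d` and `c⁻¹` carry to elements of `S'`,
and by quasi-analyticity these extensions are determined by their germs. Since leaves are dense,
there are holonomy maps moving any point of `T'` arbitrarily close to any other, and by
Arzelà–Ascoli their extensions accumulate at an element of `S̄'` with exact values. Composing it
with a box map gives a local homeomorphism `l : T → T'` between the two base points, and
`germ ψ ↦ germ (l ψ)` is the required foliated homeomorphism. -/

namespace Molino

section CompactOpen

variable {T T' : Type*} [TopologicalSpace T] [TopologicalSpace T']
  {S : Set (OpenPartialHomeomorph T T)} {S' : Set (OpenPartialHomeomorph T' T')}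

theorem mem_restr_source {e : OpenPartialHomeomorph T T'} {O : Set T} (hO : IsOpen O) {x : T} :
    x ∈ (e.restr O).source ↔ x ∈ e.source ∧ x ∈ O := by
  rw [e.restr_source' O hO, mem_inter_iff]

theorem restr_restr_of_subset (e : OpenPartialHomeomorph T T') {O V : Set T} (hO : IsOpen O)
    (hV : IsOpen V) (hVO : V ⊆ O) : (e.restr O).restr V = e.restr V := by
  refine OpenPartialHomeomorph.ext _ _ (fun _ => rfl) (fun _ => rfl) (ext fun x => ?_)
  simp only [mem_restr_source hV, mem_restr_source hO]
  exact ⟨fun h => ⟨h.1.1, h.2⟩, fun h => ⟨⟨h.1, hVO h.2⟩, h.2⟩⟩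

/-- The subbasic open set of the compact-open topology given by `K` and `O`. -/
def subbasicOpen (K O : Set T) : Set (OpenPartialHomeomorph T T) :=
  {h | K ⊆ h.source ∧ MapsTo h K O}

theorem isOpen_subbasicOpen {K O : Set T} (hK : IsCompact K) (hO : IsOpen O) :
    IsOpen (subbasicOpen K O) :=
  TopologicalSpace.isOpen_generateFrom_of_mem ⟨K, O, hK, hO, rfl⟩

theorem continuous_iff_isOpen_preimage_subbasicOpen {Y : Type*} [TopologicalSpace Y]
    {Φ : Y → OpenPartialHomeomorph T T} :
    Continuous Φ ↔ ∀ K O, IsCompact K → IsOpen O → IsOpen (Φ ⁻¹' subbasicOpen K O) := by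
  refine continuous_generateFrom_iff.trans ⟨fun h K O hK hO => h _ ⟨K, O, hK, hO, rfl⟩, ?_⟩
  rintro h _ ⟨K, O, hK, hO, rfl⟩
  exact h K O hK hO

theorem continuous_trans_trans (k : OpenPartialHomeomorph T' T) (l : OpenPartialHomeomorph T T') :
    Continuous fun f : OpenPartialHomeomorph T T => (k.trans f).trans l := by
  refine continuous_iff_isOpen_preimage_subbasicOpen.2 fun K O hK hO => ?_
  by_cases hk : K ⊆ k.source
  · convert isOpen_subbasicOpen (hK.image_of_continuousOn (k.continuousOn.mono hk))
      (l.isOpen_inter_preimage hO) using 1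
    ext f
    constructor
    · exact fun ⟨hsource, hmaps⟩ => ⟨image_subset_iff.2 fun x hx => (hsource hx).1.2,
        mapsTo_image_iff.2 fun x hx => ⟨(hsource hx).2, hmaps hx⟩⟩
    · exact fun ⟨hsource, hmaps⟩ => ⟨fun x hx => ⟨⟨hk hx, hsource ⟨x, hx, rfl⟩⟩,
        (hmaps ⟨x, hx, rfl⟩).1⟩, fun x hx => (hmaps ⟨x, hx, rfl⟩).2⟩
  · convert isOpen_empty using 1
    exact eq_empty_of_forall_notMem fun f hf => hk fun x hx => (hf.1 hx).1.1

theorem continuous_trans [LocallyCompactSpace T] :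
    Continuous fun q : OpenPartialHomeomorph T T × OpenPartialHomeomorph T T =>
      q.1.trans q.2 := by
  refine continuous_iff_isOpen_preimage_subbasicOpen.2 fun K O hK hO => isOpen_iff_mem_nhds.2 ?_
  rintro ⟨f, g⟩ ⟨hsource, hmaps⟩
  have hf : K ⊆ f.source := fun x hx => (hsource hx).1
  have himage : f '' K ⊆ g.source ∩ g ⁻¹' O :=
    image_subset_iff.2 fun x hx => ⟨(hsource hx).2, hmaps hx⟩
  obtain ⟨L, hL, hKL, hLO⟩ := exists_compact_between
    (hK.image_of_continuousOn (f.continuousOn.mono hf)) (g.isOpen_inter_preimage hO) himage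
  have hfnhds : subbasicOpen K (interior L) ∈ 𝓝 f :=
    (isOpen_subbasicOpen hK isOpen_interior).mem_nhds ⟨hf, fun x hx => hKL ⟨x, hx, rfl⟩⟩
  have hgnhds : subbasicOpen L O ∈ 𝓝 g :=
    (isOpen_subbasicOpen hL hO).mem_nhds ⟨fun x hx => (hLO hx).1, fun x hx => (hLO hx).2⟩
  refine mem_of_superset (prod_mem_nhds hfnhds hgnhds) ?_
  rintro ⟨f', g'⟩ ⟨⟨hf', hf'L⟩, ⟨hg', hg'O⟩⟩
  exact ⟨fun x hx => ⟨hf' hx, hg' (interior_subset (hf'L hx))⟩,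
    fun x hx => hg'O (interior_subset (hf'L hx))⟩

theorem continuous_restr (V : Set T) :
    Continuous fun f : OpenPartialHomeomorph T T => f.restr V := by
  refine continuous_iff_isOpen_preimage_subbasicOpen.2 fun K O hK hO => ?_
  by_cases hV : K ⊆ interior V
  · convert isOpen_subbasicOpen hK hO using 1
    ext f
    exact ⟨fun h => ⟨fun x hx => (h.1 hx).1, h.2⟩, fun h => ⟨fun x hx => ⟨h.1 hx, hV hx⟩, h.2⟩⟩
  · convert isOpen_empty using 1
    exact eq_empty_of_forall_notMem fun f hf => hV fun x hx => (hf.1 hx).2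

theorem map_mem_starClosure
    {Φ : OpenPartialHomeomorph T T → OpenPartialHomeomorph T' T'} (hΦ : Continuous Φ)
    {N : Set (OpenPartialHomeomorph T T)} (hN : IsOpen N) {f : OpenPartialHomeomorph T T}
    (hf : f ∈ starClosure S) (hfN : f ∈ N)
    (h : ∀ φ ∈ S, φ.source = f.source → φ ∈ N → Φ φ ∈ S' ∧ (Φ φ).source = (Φ f).source) :
    Φ f ∈ starClosure S' :=
  map_mem_closure hΦ (hN.inter_closure ⟨hfN, hf⟩ :
    f ∈ closure (N ∩ {φ | φ ∈ S ∧ φ.source = f.source})) fun φ hφ => h φ hφ.2.1 hφ.2.2 hφ.1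

theorem restr_mem_starClosure (hS : IsLocalPseudoStarGroup S) {f : OpenPartialHomeomorph T T}
    (hf : f ∈ starClosure S) {V : Set T} (hV : IsOpen V) : f.restr V ∈ starClosure S :=
  map_mem_starClosure (continuous_restr V) isOpen_univ hf (mem_univ _) fun φ hφ hs _ =>
    ⟨hS.restr_mem φ hφ V hV, by rw [φ.restr_source, f.restr_source, hs]⟩

theorem trans_restr_mem_starClosure [LocallyCompactSpace T] (hS : IsLocalPseudoStarGroup S)
    {f a : OpenPartialHomeomorph T T} (hf : f ∈ starClosure S) (ha : a ∈ starClosure S)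
    {K : Set T} (hK : IsCompact K) (hfK : f ∈ subbasicOpen K a.source) :
    (f.trans a).restr (interior K) ∈ starClosure S := by
  have hsource : ∀ φ ∈ subbasicOpen K a.source, ∀ ψ : OpenPartialHomeomorph T T,
      ψ.source = a.source → ((φ.trans ψ).restr (interior K)).source = interior K := by
    rintro φ ⟨hφ, hφa⟩ ψ hψ
    rw [OpenPartialHomeomorph.restr_source, interior_interior]
    refine inter_eq_right.2 fun y hy => ⟨hφ (interior_subset hy), ?_⟩
    exact hψ.symm ▸ hφa (interior_subset hy)
  have hclosure : (f, a) ∈ closure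
      ((subbasicOpen K a.source ∩ {φ | φ ∈ S ∧ φ.source = f.source}) ×ˢ
        {ψ | ψ ∈ S ∧ ψ.source = a.source}) := by
    rw [closure_prod_eq]
    exact ⟨(isOpen_subbasicOpen hK a.open_source).inter_closure ⟨hfK, hf⟩, ha⟩
  have hcont : Continuous fun q : OpenPartialHomeomorph T T × OpenPartialHomeomorph T T =>
      (q.1.trans q.2).restr (interior K) :=
    (continuous_restr (interior K)).comp continuous_trans
  refine map_mem_closure (f := fun q => (q.1.trans q.2).restr (interior K)) hcont hclosure ?_
  rintro ⟨φ, ψ⟩ ⟨⟨hφK, hφ, -⟩, hψ, hψa⟩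
  exact ⟨hS.restr_mem _ (hS.trans_mem _ hφ _ hψ) _ isOpen_interior,
    (hsource φ hφK ψ hψa).trans (hsource f hfK a rfl).symm⟩

theorem exists_trans_restr_mem_starClosure [LocallyCompactSpace T]
    (hS : IsLocalPseudoStarGroup S) {f a : OpenPartialHomeomorph T T} (ha : a ∈ starClosure S)
    {x : T} (hx : x ∈ f.source) (hfx : f x ∈ a.source) :
    ∃ V : Set T, IsOpen V ∧ x ∈ V ∧ ∃ N ∈ 𝓝 f, ∀ φ ∈ starClosure S, φ ∈ N →
      V ⊆ (φ.trans a).source ∧ (φ.trans a).restr V ∈ starClosure S := by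
  obtain ⟨K, hK, hxK, hKf⟩ := exists_compact_subset (f.isOpen_inter_preimage a.open_source)
    (x := x) ⟨hx, hfx⟩
  refine ⟨interior K, isOpen_interior, hxK, subbasicOpen K a.source,
    (isOpen_subbasicOpen hK a.open_source).mem_nhds
      ⟨fun y hy => (hKf hy).1, fun y hy => (hKf hy).2⟩, fun φ hφ hφK => ⟨fun y hy => ?_,
      trans_restr_mem_starClosure hS hφ ha hK hφK⟩⟩
  exact ⟨hφK.1 (interior_subset hy), hφK.2 (interior_subset hy)⟩

end CompactOpen

namespace QuasiLocalMetric

variable {T : Type u} [TopologicalSpace T] (Q : QuasiLocalMetric T)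

theorem exists_nhds_dist_lt (i : Q.ι) {x : T} (hx : x ∈ Q.dom i) {δ : ℝ} (hδ : 0 < δ) :
    ∃ V : Set T, IsOpen V ∧ x ∈ V ∧ ∃ h : V ⊆ Q.dom i,
      ∀ y (hy : y ∈ V) z (hz : z ∈ V), (Q.metric i).dist ⟨y, h hy⟩ ⟨z, h hz⟩ < δ := by
  let m : MetricSpace (Q.dom i) := (Q.metric i).replaceTopology (Q.topology_eq i).symm
  refine ⟨Subtype.val '' Metric.ball (⟨x, hx⟩ : Q.dom i) (δ / 2),
    (Q.isOpen_dom i).isOpenMap_subtype_val _ Metric.isOpen_ball,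
    ⟨⟨x, hx⟩, Metric.mem_ball_self (half_pos hδ), rfl⟩, Subtype.coe_image_subset _ _, ?_⟩
  rintro _ ⟨y, hy, rfl⟩ _ ⟨z, hz, rfl⟩
  calc dist y z ≤ dist y ⟨x, hx⟩ + dist z ⟨x, hx⟩ := dist_triangle_right y z _
    _ < δ / 2 + δ / 2 := add_lt_add (Metric.mem_ball.1 hy) (Metric.mem_ball.1 hz)
    _ = δ := add_halves δ

theorem exists_dist_lt_mem (i : Q.ι) {K W : Set T} (hK : IsCompact K) (hW : IsOpen W)
    (hKi : K ⊆ Q.dom i) (hKW : K ⊆ W) :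
    ∃ ε > 0, ∀ x (hx : x ∈ K) y (hy : y ∈ Q.dom i),
      (Q.metric i).dist ⟨x, hKi hx⟩ ⟨y, hy⟩ < ε → y ∈ W := by
  let m : MetricSpace (Q.dom i) := (Q.metric i).replaceTopology (Q.topology_eq i).symm
  have hKcompact : IsCompact ((Subtype.val : Q.dom i → T) ⁻¹' K) :=
    Topology.IsInducing.subtypeVal.isCompact_preimage' hK (Subtype.range_val.symm ▸ hKi)
  obtain ⟨ε, hε, hthick⟩ := hKcompact.exists_thickening_subset_open
    (hW.preimage continuous_subtype_val) fun x hx => hKW hx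
  refine ⟨ε, hε, fun x hx y hy hxy => hthick (a := ⟨y, hy⟩) ?_⟩
  exact Metric.mem_thickening_iff.2 ⟨⟨x, hKi hx⟩, hx, (dist_comm _ _).trans_lt hxy⟩

end QuasiLocalMetric

section UniformExtension

variable {T : Type u} [TopologicalSpace T] {A : Type*}

/-- Chains of the local transformations `h a b`, composable at the point `s`, where `h b c` may
only be applied at points of `M b c`. -/
inductive TransitionChain (h : A → A → OpenPartialHomeomorph T T) (M : A → A → Set T)
    (a : A) (s : T) : A → OpenPartialHomeomorph T T → Prop
  | nil : TransitionChain h M a s a (OpenPartialHomeomorph.refl T)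
  | snoc {b c : A} {φ : OpenPartialHomeomorph T T} (hφ : TransitionChain h M a s b φ)
      (hs : φ s ∈ M b c) : TransitionChain h M a s c (φ.trans (h b c))

namespace TransitionChain

variable {h : A → A → OpenPartialHomeomorph T T} {M : A → A → Set T} {a b c : A} {s : T}
  {φ ψ : OpenPartialHomeomorph T T}

theorem mem_source (hM : ∀ a b, M a b ⊆ (h a b).source) (hφ : TransitionChain h M a s b φ) :
    s ∈ φ.source := by
  induction hφ with
  | nil => exact mem_univ _
  | snoc _ hs ih => exact ⟨ih, hM _ _ hs⟩

theorem append (hφ : TransitionChain h M a s b φ) (hψ : TransitionChain h M b (φ s) c ψ) :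
    TransitionChain h M a s c (φ.trans ψ) := by
  induction hψ with
  | nil => rwa [OpenPartialHomeomorph.trans_refl]
  | snoc _ hs ih =>
    rw [← OpenPartialHomeomorph.trans_assoc]
    exact ih.snoc hs

theorem single (hs : s ∈ M a b) : TransitionChain h M a s b (h a b) := by
  simpa only [OpenPartialHomeomorph.refl_trans] using (nil (h := h) (M := M)).snoc hs

theorem symm (hM : ∀ a b, M a b ⊆ (h a b).source) (hsymm : ∀ a b, (h a b).symm = h b a)
    (hmaps : ∀ a b, MapsTo (h a b) (M a b) (M b a)) (hφ : TransitionChain h M a s b φ) :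
    TransitionChain h M b (φ s) a φ.symm := by
  induction hφ with
  | nil => exact nil
  | @snoc b c φ _ hs ih =>
    have hback : h c b ((φ.trans (h b c)) s) = φ s := by
      rw [← hsymm]
      exact (h b c).left_inv (hM _ _ hs)
    rw [← hback] at ih
    have hchain := (single (h := h) (s := (φ.trans (h b c)) s) (hmaps _ _ hs)).append ih
    rwa [← hsymm b c] at hchain

end TransitionChain

/-- A system of subfamilies `G a b` of `S`, thought of as maps from `a` to `b`, that is closed
under composition and restriction. -/
structure IsTransitionSystem (S : Set (OpenPartialHomeomorph T T))
    (G : A → A → Set (OpenPartialHomeomorph T T)) : Prop where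
  subset : ∀ a b, G a b ⊆ S
  trans_mem : ∀ a b c, ∀ f ∈ G a b, ∀ g ∈ G b c, f.trans g ∈ G a c
  restr_mem : ∀ a b, ∀ f ∈ G a b, ∀ O, IsOpen O → f.restr O ∈ G a b

/-- A restriction of `e` that belongs to `G` and takes values in a single domain of `Q`, with a
compact core in its domain. -/
structure TransitionPiece (Q : QuasiLocalMetric T) (e : OpenPartialHomeomorph T T)
    (G : Set (OpenPartialHomeomorph T T)) where
  index : Q.ι
  domain : Set T
  core : Set T
  isOpen_domain : IsOpen domain
  isCompact_core : IsCompact core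
  core_subset : core ⊆ domain
  domain_subset : domain ⊆ e.source
  mapsTo : MapsTo e domain (Q.dom index)
  restr_mem : e.restr domain ∈ G

namespace TransitionPiece

variable {Q : QuasiLocalMetric T} {e e' : OpenPartialHomeomorph T T}
  {G G' : Set (OpenPartialHomeomorph T T)}

theorem exists_core_mem_nhds [LocallyCompactSpace T]
    (hG : ∀ f ∈ G, ∀ O, IsOpen O → f.restr O ∈ G) {t : T} (ht : t ∈ e.source) {O : Set T}
    (hO : IsOpen O) (htO : t ∈ O) (hOG : e.restr O ∈ G) :
    ∃ P : TransitionPiece Q e G, P.core ∈ 𝓝 t := by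
  obtain ⟨j, hj⟩ := Q.cover (e t)
  have hW : IsOpen (O ∩ (e.source ∩ e ⁻¹' Q.dom j)) :=
    hO.inter (e.isOpen_inter_preimage (Q.isOpen_dom j))
  obtain ⟨C, hC, htC, hCW⟩ := exists_compact_subset hW (x := t) ⟨htO, ht, hj⟩
  refine ⟨⟨j, _, C, hW, hC, hCW, fun x hx => hx.2.1, fun x hx => hx.2.2, ?_⟩,
    mem_interior_iff_mem_nhds.1 htC⟩
  rw [← restr_restr_of_subset e hO hW inter_subset_left]
  exact hG _ hOG _ hW

theorem exists_finite_cover [LocallyCompactSpace T]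
    (hG : ∀ f ∈ G, ∀ O, IsOpen O → f.restr O ∈ G) {M : Set T} (hM : IsCompact M)
    (hMe : M ⊆ e.source) (hloc : ∀ t ∈ M, ∃ O, IsOpen O ∧ t ∈ O ∧ e.restr O ∈ G) :
    ∃ 𝒞 : Set (TransitionPiece Q e G), 𝒞.Finite ∧ M ⊆ ⋃ P ∈ 𝒞, P.core := by
  have hpiece : ∀ t ∈ M, ∃ P : TransitionPiece Q e G, P.core ∈ 𝓝 t := fun t ht =>
    let ⟨_, hO, htO, hOG⟩ := hloc t ht
    exists_core_mem_nhds hG (hMe ht) hO htO hOG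
  choose P hP using hpiece
  obtain ⟨τ, hτ⟩ := hM.elim_nhds_subcover' (fun t ht => (P t ht).core) hP
  refine ⟨(fun t : M => P t t.2) '' τ, τ.finite_toSet.image _, ?_⟩
  rwa [biUnion_image]

/-- Moving by less than `ε` from a point where the core of `P'` meets the image of the core of `P`
does not leave the domain of `P'`. -/
def IsMargin (P : TransitionPiece Q e G) (P' : TransitionPiece Q e' G') (ε : ℝ) : Prop :=
  ∀ u ∈ e '' P.core ∩ P'.core, ∀ v (hu : u ∈ Q.dom P.index) (hv : v ∈ Q.dom P.index),
    (Q.metric P.index).dist ⟨u, hu⟩ ⟨v, hv⟩ < ε → v ∈ P'.domain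

theorem eventually_isMargin [T2Space T] (P : TransitionPiece Q e G)
    (P' : TransitionPiece Q e' G') : ∀ᶠ ε in 𝓝[>] (0 : ℝ), P.IsMargin P' ε := by
  have hsub : e '' P.core ∩ P'.core ⊆ Q.dom P.index :=
    inter_subset_left.trans (image_subset_iff.2 fun z hz => P.mapsTo (P.core_subset hz))
  have hcompact : IsCompact (e '' P.core ∩ P'.core) :=
    (P.isCompact_core.image_of_continuousOn (e.continuousOn.mono
      (P.core_subset.trans P.domain_subset))).inter P'.isCompact_core
  obtain ⟨ε, hε, hmem⟩ := Q.exists_dist_lt_mem P.index hcompact P'.isOpen_domain hsub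
    (inter_subset_right.trans P'.core_subset)
  filter_upwards [Ioo_mem_nhdsGT hε] with ε' hε' u hu v _ hv huv
  exact hmem u hu v hv (huv.trans hε'.2)

theorem eventually_subset_domain [T2Space T] (P : TransitionPiece Q e G) (t : T) :
    ∀ᶠ V in (𝓝 t).smallSets, (V ∩ P.core).Nonempty → V ⊆ P.domain := by
  by_cases ht : t ∈ P.core
  · filter_upwards [eventually_smallSets_subset.2
      (P.isOpen_domain.mem_nhds (P.core_subset ht))] with V hV _ using hV
  · filter_upwards [eventually_smallSets_subset.2
      (P.isCompact_core.isClosed.isOpen_compl.mem_nhds ht)] with V hV ⟨y, hy, hyP⟩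
    exact absurd hyP (hV hy)

theorem exists_isMargin [T2Space T] [Finite A] {h : A → A → OpenPartialHomeomorph T T}
    {G : A → A → Set (OpenPartialHomeomorph T T)}
    {𝒞 : ∀ a b, Set (TransitionPiece Q (h a b) (G a b))} (h𝒞 : ∀ a b, (𝒞 a b).Finite) :
    ∃ ε > 0, ∀ a b c, ∀ P ∈ 𝒞 a b, ∀ P' ∈ 𝒞 b c, P.IsMargin P' ε := by
  have hev : ∀ᶠ ε in 𝓝[>] (0 : ℝ), ∀ a b c, ∀ P ∈ 𝒞 a b, ∀ P' ∈ 𝒞 b c, P.IsMargin P' ε := by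
    simp only [eventually_all, eventually_all_finite (h𝒞 _ _)]
    exact fun a b c P _ P' _ => P.eventually_isMargin P'
  obtain ⟨ε, hε, hε0⟩ := (hev.and self_mem_nhdsWithin).exists
  exact ⟨ε, hε0, hε⟩

end TransitionPiece

section

variable {S : Set (OpenPartialHomeomorph T T)} {Q : QuasiLocalMetric T}
  {h : A → A → OpenPartialHomeomorph T T} {M : A → A → Set T}
  {G : A → A → Set (OpenPartialHomeomorph T T)}

/-- By equicontinuity, an extension `f` of a chain maps `V` to a set of diameter less than `ε`,
which the margin condition keeps inside the domain of the next piece. -/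
theorem TransitionChain.exists_extension
    (hG : IsTransitionSystem S G) {𝒞 : ∀ a b, Set (TransitionPiece Q (h a b) (G a b))}
    (h𝒞M : ∀ a b, M a b ⊆ ⋃ P ∈ 𝒞 a b, P.core) {ε δ : ℝ}
    (hε : ∀ a b c, ∀ P ∈ 𝒞 a b, ∀ P' ∈ 𝒞 b c, P.IsMargin P' ε)
    (hδ : ∀ f ∈ S, ∀ (i j : Q.ι) (x y : T) (xi : x ∈ Q.dom i) (yi : y ∈ Q.dom i)
      (hxj : f x ∈ Q.dom j) (hyj : f y ∈ Q.dom j), x ∈ f.source → y ∈ f.source →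
        (Q.metric i).dist ⟨x, xi⟩ ⟨y, yi⟩ < δ → (Q.metric j).dist ⟨f x, hxj⟩ ⟨f y, hyj⟩ < ε)
    {i : Q.ι} {V O : Set T} (hVi : V ⊆ Q.dom i)
    (hVδ : ∀ y (hy : y ∈ V) z (hz : z ∈ V), (Q.metric i).dist ⟨y, hVi hy⟩ ⟨z, hVi hz⟩ < δ)
    {a b : A} (hV𝒞 : ∀ b, ∀ P ∈ 𝒞 a b, (V ∩ P.core).Nonempty → V ⊆ P.domain)
    (hO : IsOpen O) (hVO : V ⊆ O) (hrefl : (OpenPartialHomeomorph.refl T).restr O ∈ G a a)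
    {s : T} (hs : s ∈ V) {φ : OpenPartialHomeomorph T T} (hφ : TransitionChain h M a s b φ) :
    ∃ f ∈ G a b, V ⊆ f.source ∧ f =ᶠ[𝓝 s] φ ∧
      ∀ c, ∀ P ∈ 𝒞 b c, f s ∈ P.core → MapsTo f V P.domain := by
  induction hφ with
  | nil =>
    exact ⟨_, hrefl, fun x hx => (mem_restr_source hO).2 ⟨mem_univ _, hVO hx⟩, EventuallyEq.rfl,
      fun c P hP hsP => hV𝒞 c P hP ⟨s, hs, hsP⟩⟩
  | @snoc b c φ _ hsM ih =>
    obtain ⟨f, hf, hVf, hfφ, hfmaps⟩ := ih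
    obtain ⟨P, hP, hsP⟩ := mem_iUnion₂.1 (h𝒞M b c hsM)
    rw [← hfφ.self_of_nhds] at hsP
    have hmaps : MapsTo f V P.domain := hfmaps c P hP hsP
    have hfP := hG.trans_mem _ _ _ f hf _ P.restr_mem
    have hVsource : V ⊆ (f.trans ((h b c).restr P.domain)).source := fun y hy =>
      ⟨hVf hy, (mem_restr_source P.isOpen_domain).2 ⟨P.domain_subset (hmaps hy), hmaps hy⟩⟩
    have hdom : ∀ z ∈ V, (f.trans ((h b c).restr P.domain)) z ∈ Q.dom P.index :=
      fun z hz => P.mapsTo (hmaps hz)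
    refine ⟨_, hfP, hVsource, hfφ.fun_comp (h b c), fun d P' hP' hsP' z hz => ?_⟩
    exact hε b c d P hP P' hP' _ ⟨⟨f s, hsP, rfl⟩, hsP'⟩ _ (hdom s hs) (hdom z hz)
      (hδ _ (hG.subset _ _ hfP) i P.index s z _ _ _ _ (hVsource hs) (hVsource hz)
        (hVδ s hs z hz))

theorem exists_uniform_extension [LocallyCompactSpace T] [T2Space T] [Finite A]
    (hQ : Q.IsEquicontinuousFamily S) (hG : IsTransitionSystem S G)
    (hMc : ∀ a b, IsCompact (M a b)) (hM : ∀ a b, M a b ⊆ (h a b).source)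
    (hloc : ∀ a b, ∀ t ∈ M a b, ∃ O, IsOpen O ∧ t ∈ O ∧ (h a b).restr O ∈ G a b)
    (a : A) {t : T} {O : Set T} (hO : IsOpen O) (htO : t ∈ O)
    (hrefl : (OpenPartialHomeomorph.refl T).restr O ∈ G a a) :
    ∃ V, IsOpen V ∧ t ∈ V ∧ V ⊆ O ∧ ∀ s ∈ V, ∀ b φ, TransitionChain h M a s b φ →
      ∃ f ∈ G a b, V ⊆ f.source ∧ f =ᶠ[𝓝 s] φ := by
  choose 𝒞 h𝒞 h𝒞M using fun a b =>
    TransitionPiece.exists_finite_cover (Q := Q) (hG.restr_mem a b) (hMc a b) (hM a b) (hloc a b)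
  obtain ⟨ε, hε0, hε⟩ := TransitionPiece.exists_isMargin h𝒞
  obtain ⟨δ, hδ0, hδ⟩ := hQ ε hε0
  obtain ⟨i, hi⟩ := Q.cover t
  obtain ⟨V₀, hV₀, htV₀, hV₀i, hV₀δ⟩ := Q.exists_nhds_dist_lt i hi hδ0
  have hsmall : ∀ᶠ V in (𝓝 t).smallSets, ∀ b, ∀ P ∈ 𝒞 a b,
      (V ∩ P.core).Nonempty → V ⊆ P.domain := by
    simp only [eventually_all, eventually_all_finite (h𝒞 _ _)]
    exact fun b P _ => P.eventually_subset_domain t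
  obtain ⟨V₁, hV₁t, hV₁⟩ := eventually_smallSets.1 hsmall
  obtain ⟨V, hVsub, hV, htV⟩ := mem_nhds_iff.1
    (inter_mem hV₁t (inter_mem (hV₀.mem_nhds htV₀) (hO.mem_nhds htO)))
  have hVO : V ⊆ O := fun x hx => (hVsub hx).2.2
  refine ⟨V, hV, htV, hVO, fun s hs b φ hφ => ?_⟩
  obtain ⟨f, hf, hVf, hfφ, -⟩ := hφ.exists_extension hG h𝒞M hε hδ
    (fun x hx => hV₀i (hVsub hx).2.1) (fun y hy z hz => hV₀δ y (hVsub hy).2.1 z (hVsub hz).2.1)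
    (hV₁ V fun x hx => (hVsub hx).1) hO hVO hrefl hs
  exact ⟨f, hf, hVf, hfφ⟩

end

end UniformExtension

section LocalQuotient

variable {X T T' : Type*} [TopologicalSpace X] [TopologicalSpace T] [TopologicalSpace T']
  {B : Set X} {p : X → T} {q : X → T'}

theorem continuousOn_image_of_comp_eqOn (hB : IsOpen B) (hq : ContinuousOn q B)
    (hpo : ∀ O ⊆ B, IsOpen O → IsOpen (p '' O)) {f : T → T'} (hf : EqOn (f ∘ p) q B) :
    ContinuousOn f (p '' B) := by
  rw [continuousOn_open_iff (hpo B Subset.rfl hB)]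
  intro O hO
  have himage : p '' B ∩ f ⁻¹' O = p '' (B ∩ q ⁻¹' O) := by
    rw [← image_inter_preimage]
    refine congrArg (p '' ·) (ext fun x => and_congr_right fun hx => ?_)
    rw [← preimage_comp, mem_preimage, mem_preimage, hf hx]
  rw [himage]
  exact hpo _ inter_subset_left (hq.isOpen_inter_preimage hB hO)

theorem exists_openPartialHomeomorph_of_fibers (hB : IsOpen B)
    (hp : ContinuousOn p B) (hq : ContinuousOn q B)
    (hpo : ∀ O ⊆ B, IsOpen O → IsOpen (p '' O)) (hqo : ∀ O ⊆ B, IsOpen O → IsOpen (q '' O))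
    (hpq : ∀ x ∈ B, ∀ y ∈ B, p x = p y ↔ q x = q y) (hne : B.Nonempty) :
    ∃ c : OpenPartialHomeomorph T T', c.source = p '' B ∧ c.target = q '' B ∧
      ∀ x ∈ B, c (p x) = q x := by
  classical
  have : Nonempty X := ⟨hne.some⟩
  have hf : ∀ x ∈ B, q (Function.invFunOn p B (p x)) = q x := fun x hx =>
    (hpq _ (Function.invFunOn_mem ⟨x, hx, rfl⟩) _ hx).1 (Function.invFunOn_eq ⟨x, hx, rfl⟩)
  have hg : ∀ x ∈ B, p (Function.invFunOn q B (q x)) = p x := fun x hx =>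
    (hpq _ (Function.invFunOn_mem ⟨x, hx, rfl⟩) _ hx).2 (Function.invFunOn_eq ⟨x, hx, rfl⟩)
  exact ⟨{
    toFun := fun t => q (Function.invFunOn p B t)
    invFun := fun t => p (Function.invFunOn q B t)
    source := p '' B
    target := q '' B
    map_source' := by
      rintro _ ⟨x, hx, rfl⟩
      exact ⟨x, hx, (hf x hx).symm⟩
    map_target' := by
      rintro _ ⟨x, hx, rfl⟩
      exact ⟨x, hx, (hg x hx).symm⟩
    left_inv' := by
      rintro _ ⟨x, hx, rfl⟩
      rw [hf x hx, hg x hx]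
    right_inv' := by
      rintro _ ⟨x, hx, rfl⟩
      rw [hg x hx, hf x hx]
    open_source := hpo B Subset.rfl hB
    open_target := hqo B Subset.rfl hB
    continuousOn_toFun := continuousOn_image_of_comp_eqOn hB hq hpo hf
    continuousOn_invFun := continuousOn_image_of_comp_eqOn hB hp hqo hg }, rfl, rfl, hf⟩

end LocalQuotient

namespace FoliatedChart

variable {n : ℕ} {X : Type u} {Z : Type v} [TopologicalSpace X] [TopologicalSpace Z]
  {c d : FoliatedChart n X Z}

theorem isOpen_source (c : FoliatedChart n X Z) : IsOpen c.source := c.toHomeo.open_source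

theorem mem_target_iff {w : EuclideanSpace ℝ (Fin n) × Z} :
    w ∈ c.toHomeo.target ↔ w.1 ∈ Metric.ball c.center c.radius ∧ w.2 ∈ c.base := by
  rw [c.target_eq, mem_prod]

theorem snd_mem_base {x : X} (hx : x ∈ c.source) : (c.toHomeo x).2 ∈ c.base :=
  (mem_target_iff.1 (c.toHomeo.map_source hx)).2

theorem mem_plaque_iff {y : c.base} {x : X} :
    x ∈ c.plaque y ↔ x ∈ c.source ∧ (c.toHomeo x).2 = y := by
  constructor
  · rintro ⟨z, hz, rfl⟩
    exact ⟨z.2, congrArg Subtype.val hz⟩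
  · rintro ⟨hx, hxy⟩
    exact ⟨⟨x, hx⟩, Subtype.ext hxy, rfl⟩

theorem continuous_proj (c : FoliatedChart n X Z) : Continuous c.proj :=
  (continuous_snd.comp (continuousOn_iff_continuous_domRestrict.1
    c.toHomeo.continuousOn)).subtype_mk _

theorem center_mem_target (c : FoliatedChart n X Z) (b : c.base) :
    (c.center, (b : Z)) ∈ c.toHomeo.target :=
  mem_target_iff.2 ⟨Metric.mem_ball_self c.radius_pos, b.2⟩

/-- The section of `proj` formed by the centres of the plaques. -/
def centerSection (c : FoliatedChart n X Z) (b : c.base) : c.source :=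
  ⟨c.toHomeo.symm (c.center, b), c.toHomeo.map_target (c.center_mem_target b)⟩

theorem continuous_centerSection (c : FoliatedChart n X Z) : Continuous c.centerSection :=
  (c.toHomeo.symm.continuousOn.comp_continuous (by fun_prop) c.center_mem_target).subtype_mk _

theorem proj_centerSection (c : FoliatedChart n X Z) :
    Function.LeftInverse c.proj c.centerSection := fun b =>
  Subtype.ext (congrArg Prod.snd (c.toHomeo.right_inv (c.center_mem_target b)))

instance [T2Space X] (c : FoliatedChart n X Z) : T2Space c.base :=
  (c.proj_centerSection.isEmbedding c.continuous_proj c.continuous_centerSection).t2Space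

instance [T2Space X] [LocallyCompactSpace X] (c : FoliatedChart n X Z) :
    LocallyCompactSpace c.base :=
  have : LocallyCompactSpace c.source := c.isOpen_source.locallyCompactSpace
  (c.proj_centerSection.isClosedEmbedding c.continuous_proj
    c.continuous_centerSection).locallyCompactSpace

theorem isPreconnected_slice {v : EuclideanSpace ℝ (Fin n)} {r : ℝ} {z : Z}
    (h : Metric.ball v r ×ˢ {z} ⊆ c.toHomeo.target) :
    IsPreconnected (c.toHomeo.symm '' (Metric.ball v r ×ˢ {z})) :=
  ((convex_ball v r).isPreconnected.prod isPreconnected_singleton).image _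
    (c.toHomeo.symm.continuousOn.mono h)

theorem mem_slice_iff {B : Set (EuclideanSpace ℝ (Fin n))} {z : Z}
    (h : B ×ˢ {z} ⊆ c.toHomeo.target) {x : X} :
    x ∈ c.toHomeo.symm '' (B ×ˢ {z}) ↔
      x ∈ c.source ∧ (c.toHomeo x).1 ∈ B ∧ (c.toHomeo x).2 = z := by
  constructor
  · rintro ⟨w, hw, rfl⟩
    rw [c.toHomeo.right_inv (h hw)]
    exact ⟨c.toHomeo.map_target (h hw), hw⟩
  · rintro ⟨hx, hxz⟩
    exact ⟨c.toHomeo x, hxz, c.toHomeo.left_inv hx⟩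

theorem isPreconnected_plaque (c : FoliatedChart n X Z) (y : c.base) :
    IsPreconnected (c.plaque y) := by
  have hsub : Metric.ball c.center c.radius ×ˢ {(y : Z)} ⊆ c.toHomeo.target := by
    rw [c.target_eq]
    exact prod_mono Subset.rfl (singleton_subset_iff.2 y.2)
  convert isPreconnected_slice hsub using 1
  ext x
  rw [mem_plaque_iff, mem_slice_iff hsub]
  exact ⟨fun h => ⟨h.1, (mem_target_iff.1 (c.toHomeo.map_source h.1)).1, h.2⟩,
    fun h => ⟨h.1, h.2.2⟩⟩

theorem exists_ball_prod_subset {x : X} (hx : x ∈ c.source) {O : Set X} (hO : O ∈ 𝓝 x) :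
    ∃ r > 0, ∃ D : Set Z, IsOpen D ∧ (c.toHomeo x).2 ∈ D ∧
      Metric.ball (c.toHomeo x).1 r ×ˢ D ⊆ c.toHomeo.symm ⁻¹' O ∩ c.toHomeo.target := by
  have hxt : c.toHomeo x ∈ c.toHomeo.target := c.toHomeo.map_source hx
  have hpre : c.toHomeo.symm ⁻¹' O ∈ 𝓝 (c.toHomeo x) := by
    refine (c.toHomeo.symm.continuousAt hxt).preimage_mem_nhds ?_
    rwa [c.toHomeo.left_inv hx]
  obtain ⟨V, hV, D, hD, hVD⟩ :=
    mem_nhds_prod_iff.1 (inter_mem hpre (c.toHomeo.open_target.mem_nhds hxt))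
  obtain ⟨r, hr, hrV⟩ := Metric.mem_nhds_iff.1 hV
  obtain ⟨D', hD'D, hD', hxD'⟩ := mem_nhds_iff.1 hD
  exact ⟨r, hr, D', hD', hxD', (prod_mono hrV hD'D).trans hVD⟩

theorem Coherent.snd_eq_of_isPreconnected (hcd : c.Coherent d) {A : Set X}
    (hA : IsPreconnected A) {b : c.base} (hAc : A ⊆ c.plaque b) (hAd : A ⊆ d.source)
    {y z : X} (hy : y ∈ A) (hz : z ∈ A) : (d.toHomeo y).2 = (d.toHomeo z).2 := by
  refine hA.induction₂ (fun y z => (d.toHomeo y).2 = (d.toHomeo z).2) (fun w hw => ?_)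
    (fun _ _ _ _ _ _ h h' => h.trans h') (fun _ _ _ _ h => h.symm) hy hz
  let b' : d.base := ⟨(d.toHomeo w).2, snd_mem_base (hAd hw)⟩
  obtain ⟨W, hW, hWe⟩ := (hcd b b').1
  have hwW : w ∈ c.plaque b ∩ W := hWe ▸ ⟨hAc hw, mem_plaque_iff.2 ⟨hAd hw, rfl⟩⟩
  filter_upwards [mem_nhdsWithin_of_mem_nhds (hW.mem_nhds hwW.2), self_mem_nhdsWithin]
    with w' hw' hw'A
  have hw'd : w' ∈ c.plaque b ∩ d.plaque b' := hWe ▸ ⟨hAc hw'A, hw'⟩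
  exact (mem_plaque_iff.1 hw'd.2).2.symm

theorem Coherent.exists_nhds_snd_eq (hcd : c.Coherent d) {x : X} (hx : x ∈ c.source) {O : Set X}
    (hO : O ∈ 𝓝 x) (hOd : O ⊆ d.source) :
    ∃ B ⊆ O, IsOpen B ∧ x ∈ B ∧ B ⊆ c.source ∧ ∀ y ∈ B, ∀ z ∈ B,
      (c.toHomeo y).2 = (c.toHomeo z).2 → (d.toHomeo y).2 = (d.toHomeo z).2 := by
  obtain ⟨r, hr, D, hD, hxD, hsub⟩ := exists_ball_prod_subset hx hO
  refine ⟨c.toHomeo.source ∩ c.toHomeo ⁻¹' (Metric.ball (c.toHomeo x).1 r ×ˢ D), ?_,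
    c.toHomeo.isOpen_inter_preimage (Metric.isOpen_ball.prod hD),
    ⟨hx, Metric.mem_ball_self hr, hxD⟩, inter_subset_left, ?_⟩
  · rintro y ⟨hy, hyD⟩
    exact c.toHomeo.left_inv hy ▸ (hsub hyD).1
  · rintro y ⟨hy, hyr, hyD⟩ z ⟨hz, hzr, -⟩ hyz
    have hslice : Metric.ball (c.toHomeo x).1 r ×ˢ {(c.toHomeo y).2} ⊆
        c.toHomeo.symm ⁻¹' O ∩ c.toHomeo.target :=
      (prod_mono Subset.rfl (singleton_subset_iff.2 hyD)).trans hsub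
    have htarget := hslice.trans inter_subset_right
    refine hcd.snd_eq_of_isPreconnected (isPreconnected_slice htarget)
      (b := ⟨(c.toHomeo y).2, snd_mem_base hy⟩) (fun w hw => ?_) ?_
      ((mem_slice_iff htarget).2 ⟨hy, hyr, rfl⟩) ((mem_slice_iff htarget).2 ⟨hz, hzr, hyz.symm⟩)
    · obtain ⟨hwc, -, hwy⟩ := (mem_slice_iff htarget).1 hw
      exact mem_plaque_iff.2 ⟨hwc, hwy⟩
    · exact image_subset_iff.2 fun w hw => hOd (hslice hw).1

end FoliatedChart

theorem locallyCompactSpace_sigma {ι : Type*} {Y : ι → Type*} [∀ i, TopologicalSpace (Y i)]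
    [∀ i, LocallyCompactSpace (Y i)] : LocallyCompactSpace (Σ i, Y i) where
  local_compact_nhds := by
    rintro ⟨i, y⟩ O hO
    have hOi : Sigma.mk i ⁻¹' O ∈ 𝓝 y := continuous_sigmaMk.continuousAt.preimage_mem_nhds hO
    obtain ⟨K, hKy, hKO, hK⟩ := local_compact_nhds hOi
    exact ⟨_, isOpenMap_sigmaMk.image_mem_nhds hKy, image_subset_iff.2 hKO,
      hK.image continuous_sigmaMk⟩

namespace RegularAtlas

variable {n : ℕ} {X : Type u} {Z : Type v} [TopologicalSpace X] [TopologicalSpace Z]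
  {ℱ : FoliatedStructure n X Z} {ι : Type w} (𝒰 : RegularAtlas ℱ ι)

instance [T2Space X] [LocallyCompactSpace X] : LocallyCompactSpace 𝒰.Transversal :=
  locallyCompactSpace_sigma

variable {𝒰} in
theorem isOpen_U (i : ι) : IsOpen (𝒰.U i) := (𝒰.chart i).isOpen_source

variable [Nonempty 𝒰.Transversal]

open Classical in
/-- The distinguished submersion `p_i`, extended to `X` by an arbitrary constant. -/
noncomputable def pr (i : ι) (x : X) : 𝒰.Transversal :=
  if h : x ∈ 𝒰.U i then 𝒰.p i ⟨x, h⟩ else Classical.arbitrary _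

variable {𝒰}

theorem pr_of_mem {i : ι} {x : X} (h : x ∈ 𝒰.U i) : 𝒰.pr i x = 𝒰.p i ⟨x, h⟩ := dif_pos h

theorem pr_coe (i : ι) (x : 𝒰.U i) : 𝒰.pr i x = 𝒰.p i x := pr_of_mem x.2

theorem pr_fst {i : ι} {x : X} (h : x ∈ 𝒰.U i) : (𝒰.pr i x).1 = i :=
  congrArg Sigma.fst (pr_of_mem h)

theorem pr_eq_iff {i : ι} {x y : X} (hx : x ∈ 𝒰.U i) (hy : y ∈ 𝒰.U i) :
    𝒰.pr i x = 𝒰.pr i y ↔ ((𝒰.chart i).toHomeo x).2 = ((𝒰.chart i).toHomeo y).2 := by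
  rw [pr_of_mem hx, pr_of_mem hy]
  exact ⟨fun h => congrArg Subtype.val (eq_of_heq (Sigma.mk.inj h).2),
    fun h => congrArg (Sigma.mk i) (Subtype.ext h)⟩

theorem exists_pr_eq (t : 𝒰.Transversal) : ∃ x ∈ 𝒰.U t.1, 𝒰.pr t.1 x = t :=
  ⟨_, ((𝒰.chart t.1).centerSection t.2).2, (pr_coe _ _).trans
    (congrArg (Sigma.mk t.1) ((𝒰.chart t.1).proj_centerSection t.2))⟩

theorem continuousOn_pr (i : ι) : ContinuousOn (𝒰.pr i) (𝒰.U i) := by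
  rw [continuousOn_iff_continuous_domRestrict]
  convert 𝒰.continuous_p i using 1
  exact funext (pr_coe i)

theorem continuousAt_pr {i : ι} {x : X} (hx : x ∈ 𝒰.U i) : ContinuousAt (𝒰.pr i) x :=
  (continuousOn_pr i).continuousAt ((isOpen_U i).mem_nhds hx)

theorem image_pr_mem_nhds {i : ι} {x : X} (hx : x ∈ 𝒰.U i) {O : Set X} (hO : O ∈ 𝓝 x) :
    𝒰.pr i '' O ∈ 𝓝 (𝒰.pr i x) := by
  obtain ⟨s, hs, hps, hsx⟩ := 𝒰.exists_section i ⟨x, hx⟩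
  have hpre : {t | ((s t : 𝒰.U i) : X) ∈ O} ∈ 𝓝 ((𝒰.chart i).proj ⟨x, hx⟩) :=
    (continuous_subtype_val.comp hs).continuousAt.preimage_mem_nhds
      (by rwa [Function.comp, hsx])
  rw [pr_of_mem hx]
  refine mem_of_superset
    ((isOpenMap_sigmaMk (σ := fun k => (𝒰.chart k).base)).image_mem_nhds hpre) ?_
  rintro _ ⟨t, ht, rfl⟩
  exact ⟨s t, ht, (pr_coe i (s t)).trans (hps t)⟩

theorem isOpen_image_pr {i : ι} {O : Set X} (hO : IsOpen O) (hOi : O ⊆ 𝒰.U i) :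
    IsOpen (𝒰.pr i '' O) := by
  rw [isOpen_iff_mem_nhds]
  rintro _ ⟨x, hx, rfl⟩
  exact image_pr_mem_nhds (hOi hx) (hO.mem_nhds hx)

theorem map_nhds_pr {i : ι} {x : X} (hx : x ∈ 𝒰.U i) : map (𝒰.pr i) (𝓝 x) = 𝓝 (𝒰.pr i x) :=
  le_antisymm (continuousAt_pr hx) fun _ hs =>
    mem_of_superset (image_pr_mem_nhds hx hs) (image_preimage_subset _ _)

theorem eventually_nhds_pr {i : ι} {x : X} (hx : x ∈ 𝒰.U i) {P : 𝒰.Transversal → Prop} :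
    (∀ᶠ t in 𝓝 (𝒰.pr i x), P t) ↔ ∀ᶠ y in 𝓝 x, P (𝒰.pr i y) := by
  rw [← map_nhds_pr hx, eventually_map]

theorem hol_pr {i j : ι} {x : X} (hi : x ∈ 𝒰.U i) (hj : x ∈ 𝒰.U j) :
    𝒰.hol i j (𝒰.pr i x) = 𝒰.pr j x := by
  rw [pr_of_mem hi, pr_of_mem hj]
  exact 𝒰.holFun_p hi hj

theorem pr_mem_hol_source {i j : ι} {x : X} (hi : x ∈ 𝒰.U i) (hj : x ∈ 𝒰.U j) :
    𝒰.pr i x ∈ (𝒰.hol i j).source := by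
  rw [pr_of_mem hi]
  exact ⟨x, hi, hj, rfl⟩

variable {ι' : Type*} {𝒰' : RegularAtlas ℱ ι'} [Nonempty 𝒰'.Transversal]

variable (𝒰') in
variable (𝒰) in
/-- `c` is the holonomy transformation of the small open set `B` from the chart `U_i` of `𝒰` to the
chart `U'_j` of `𝒰'`. -/
structure IsBox (i : ι) (j : ι') (c : OpenPartialHomeomorph 𝒰.Transversal 𝒰'.Transversal)
    (B : Set X) : Prop where
  isOpen : IsOpen B
  left : B ⊆ 𝒰.U i
  right : B ⊆ 𝒰'.U j
  source_eq : c.source = 𝒰.pr i '' B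
  target_eq : c.target = 𝒰'.pr j '' B
  map_pr : ∀ x ∈ B, c (𝒰.pr i x) = 𝒰'.pr j x

namespace IsBox

variable {i : ι} {j : ι'} {c : OpenPartialHomeomorph 𝒰.Transversal 𝒰'.Transversal} {B : Set X}

theorem pr_mem_source (h : IsBox 𝒰 𝒰' i j c B) {x : X} (hx : x ∈ B) : 𝒰.pr i x ∈ c.source :=
  h.source_eq ▸ ⟨x, hx, rfl⟩

theorem symm (h : IsBox 𝒰 𝒰' i j c B) : IsBox 𝒰' 𝒰 j i c.symm B where
  isOpen := h.isOpen
  left := h.right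
  right := h.left
  source_eq := h.target_eq
  target_eq := h.source_eq
  map_pr x hx := by rw [← h.map_pr x hx, c.left_inv (h.pr_mem_source hx)]

end IsBox

variable (𝒰 𝒰') in
theorem exists_isBox {i : ι} {j : ι'} {x : X} (hi : x ∈ 𝒰.U i) (hj : x ∈ 𝒰'.U j) {O : Set X}
    (hO : O ∈ 𝓝 x) : ∃ c B, IsBox 𝒰 𝒰' i j c B ∧ x ∈ B ∧ B ⊆ O := by
  obtain ⟨B₁, hB₁O, hB₁, hxB₁, hB₁i, h₁⟩ :=
    (ℱ.coherent _ (𝒰.chart_mem i) _ (𝒰'.chart_mem j)).exists_nhds_snd_eq hi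
      (O := O ∩ 𝒰'.U j) (inter_mem hO ((isOpen_U j).mem_nhds hj)) inter_subset_right
  obtain ⟨B, hBB₁, hB, hxB, hBj, h₂⟩ :=
    (ℱ.coherent _ (𝒰'.chart_mem j) _ (𝒰.chart_mem i)).exists_nhds_snd_eq hj
      (hB₁.mem_nhds hxB₁) hB₁i
  have hBi : B ⊆ 𝒰.U i := hBB₁.trans hB₁i
  have hfibers : ∀ y ∈ B, ∀ z ∈ B, 𝒰.pr i y = 𝒰.pr i z ↔ 𝒰'.pr j y = 𝒰'.pr j z := by
    intro y hy z hz
    rw [pr_eq_iff (hBi hy) (hBi hz), pr_eq_iff (hBj hy) (hBj hz)]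
    exact ⟨h₁ y (hBB₁ hy) z (hBB₁ hz), h₂ y hy z hz⟩
  obtain ⟨c, hsource, htarget, hc⟩ := exists_openPartialHomeomorph_of_fibers hB
    ((continuousOn_pr i).mono hBi) ((continuousOn_pr j).mono hBj)
    (fun O hO hO' => isOpen_image_pr hO' (hO.trans hBi))
    (fun O hO hO' => isOpen_image_pr hO' (hO.trans hBj)) hfibers ⟨x, hxB⟩
  exact ⟨c, B, ⟨hB, hBi, hBj, hsource, htarget, hc⟩, hxB, fun y hy => (hB₁O (hBB₁ hy)).1⟩

end RegularAtlas

theorem generatedPseudogroup_germ_induction {T : Type u} [TopologicalSpace T]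
    {E : Set (OpenPartialHomeomorph T T)} {P : (T → T) → T → Prop}
    (congr : ∀ {f g : T → T} {s}, P f s → f =ᶠ[𝓝 s] g → P g s)
    (id : ∀ s, P id s)
    (comp : ∀ {f g : T → T} {s}, ContinuousAt f s → P f s → P g (f s) → P (g ∘ f) s)
    (symm : ∀ {f : OpenPartialHomeomorph T T} {s}, s ∈ f.source → P f s → P f.symm (f s))
    (generator : ∀ f ∈ E, ∀ s ∈ f.source, P f s)
    {f : OpenPartialHomeomorph T T} (hf : f ∈ generatedPseudogroup E) {s : T}
    (hs : s ∈ f.source) : P f s := by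
  refine hf {f | ∀ s ∈ f.source, P f s} ⟨⟨fun s _ => id s, ?_, ?_, ?_, ?_, ?_⟩, generator⟩ s hs
  · exact fun e he f hf s hs => comp (f := e) (g := f) (e.continuousAt hs.1) (he s hs.1) (hf _ hs.2)
  · intro e he s hs
    exact e.right_inv hs ▸ symm (e.map_target hs) (he _ (e.map_target hs))
  · exact fun e he O _ s hs => he s hs.1
  · intro e he s hs
    obtain ⟨O, hO, hsO, h⟩ := he s hs
    exact h s ((mem_restr_source hO).2 ⟨hs, hsO⟩)
  · intro e he f hfe s hs
    exact congr (he s (hfe.source_eq ▸ hs))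
      (eventually_of_mem (f.open_source.mem_nhds hs) fun t ht => (hfe.eqOn ht).symm)

namespace RegularAtlas

variable {n : ℕ} {X : Type u} {Z : Type v} [TopologicalSpace X] [TopologicalSpace Z]
  {ℱ : FoliatedStructure n X Z} {ι : Type w} (𝒰 : RegularAtlas ℱ ι) [Nonempty 𝒰.Transversal]
  {A : Type*} (idx : A → ι) (K : A → Set X)

/-- Chains of holonomy transformations that are only applied at the projections of the points of the
sets `K a ∩ K b`. -/
abbrev CoreChain (a : A) (s : 𝒰.Transversal) (b : A)
    (φ : OpenPartialHomeomorph 𝒰.Transversal 𝒰.Transversal) : Prop :=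
  TransitionChain (fun a b => 𝒰.hol (idx a) (idx b)) (fun a b => 𝒰.pr (idx a) '' (K a ∩ K b))
    a s b φ

/-- The germ of `f` at `p_i(x)`, read in the charts with indices `idx a` and `idx b` around `x` and
`y`, where `f(p_i(x)) = p_j(y)`, is the germ of a chain. -/
def IsChainAlong (f : 𝒰.Transversal → 𝒰.Transversal) (i : ι) (a : A) (x : X) (j : ι) (b : A) :
    Prop :=
  ∃ φ, 𝒰.CoreChain idx K a (𝒰.pr (idx a) x) b φ ∧
    ∀ᶠ t in 𝓝 (𝒰.pr i x), φ (𝒰.hol i (idx a) t) = 𝒰.hol j (idx b) (f t)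

/-- The germ of `f` at `s` is the germ of a chain in whichever charts of the family `idx` it is
read. -/
def IsChainGerm (f : 𝒰.Transversal → 𝒰.Transversal) (s : 𝒰.Transversal) : Prop :=
  ∀ i x, x ∈ 𝒰.U i → 𝒰.pr i x = s → ∀ j y, y ∈ 𝒰.U j → 𝒰.pr j y = f s →
    ∀ a, x ∈ K a → ∀ b, y ∈ K b → 𝒰.IsChainAlong idx K f i a x j b

variable {𝒰 idx K}

theorem tendsto_hol {i j : ι} {x : X} (hi : x ∈ 𝒰.U i) (hj : x ∈ 𝒰.U j) :
    Tendsto (𝒰.hol i j) (𝓝 (𝒰.pr i x)) (𝓝 (𝒰.pr j x)) :=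
  hol_pr hi hj ▸ (𝒰.hol i j).continuousAt (pr_mem_hol_source hi hj)

theorem eventually_hol_hol {i j k : ι} {x : X} (hi : x ∈ 𝒰.U i) (hj : x ∈ 𝒰.U j)
    (hk : x ∈ 𝒰.U k) : ∀ᶠ t in 𝓝 (𝒰.pr i x), 𝒰.hol j k (𝒰.hol i j t) = 𝒰.hol i k t := by
  rw [eventually_nhds_pr hi]
  filter_upwards [(isOpen_U i).mem_nhds hi, (isOpen_U j).mem_nhds hj, (isOpen_U k).mem_nhds hk]
    with y hyi hyj hyk
  rw [hol_pr hyi hyj, hol_pr hyj hyk, hol_pr hyi hyk]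

theorem core_subset_source (hK : ∀ a, K a ⊆ 𝒰.U (idx a)) (a b : A) :
    𝒰.pr (idx a) '' (K a ∩ K b) ⊆ (𝒰.hol (idx a) (idx b)).source := by
  rintro _ ⟨x, ⟨hx, hx'⟩, rfl⟩
  exact pr_mem_hol_source (hK a hx) (hK b hx')

theorem mapsTo_core (hK : ∀ a, K a ⊆ 𝒰.U (idx a)) (a b : A) :
    MapsTo (𝒰.hol (idx a) (idx b)) (𝒰.pr (idx a) '' (K a ∩ K b))
      (𝒰.pr (idx b) '' (K b ∩ K a)) := by
  rintro _ ⟨x, ⟨hx, hx'⟩, rfl⟩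
  exact ⟨x, ⟨hx', hx⟩, (hol_pr (hK a hx) (hK b hx')).symm⟩

section
variable {f g : 𝒰.Transversal → 𝒰.Transversal} {i j k : ι} {a b c : A} {x y z : X}

theorem apply_pr_of_eventually {φ : 𝒰.Transversal → 𝒰.Transversal} (hxi : x ∈ 𝒰.U i)
    (hxa : x ∈ 𝒰.U (idx a)) (hyj : y ∈ 𝒰.U j) (hyb : y ∈ 𝒰.U (idx b))
    (hxy : 𝒰.pr j y = f (𝒰.pr i x))
    (hφ : ∀ᶠ t in 𝓝 (𝒰.pr i x), φ (𝒰.hol i (idx a) t) = 𝒰.hol j (idx b) (f t)) :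
    φ (𝒰.pr (idx a) x) = 𝒰.pr (idx b) y := by
  rw [← hol_pr hxi hxa, hφ.self_of_nhds, ← hxy, hol_pr hyj hyb]

theorem IsChainAlong.comp (hxi : x ∈ 𝒰.U i) (hxa : x ∈ 𝒰.U (idx a)) (hzk : z ∈ 𝒰.U k)
    (hzc : z ∈ 𝒰.U (idx c)) (hxz : 𝒰.pr k z = f (𝒰.pr i x)) (hfx : ContinuousAt f (𝒰.pr i x))
    (hf : 𝒰.IsChainAlong idx K f i a x k c) (hg : 𝒰.IsChainAlong idx K g k c z j b) :
    𝒰.IsChainAlong idx K (g ∘ f) i a x j b := by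
  obtain ⟨φ, hφ, hφf⟩ := hf
  obtain ⟨ψ, hψ, hψg⟩ := hg
  refine ⟨φ.trans ψ, hφ.append
    ((apply_pr_of_eventually hxi hxa hzk hzc hxz hφf).symm ▸ hψ), ?_⟩
  rw [hxz] at hψg
  filter_upwards [hφf, hfx.eventually hψg] with t ht ht'
  exact (congrArg ψ ht).trans ht'

theorem IsChainAlong.symm {f : OpenPartialHomeomorph 𝒰.Transversal 𝒰.Transversal}
    (hK : ∀ a, K a ⊆ 𝒰.U (idx a)) (hxi : x ∈ 𝒰.U i) (hxa : x ∈ K a) (hyj : y ∈ 𝒰.U j)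
    (hyb : y ∈ K b) (hxy : 𝒰.pr j y = f (𝒰.pr i x)) (hfx : 𝒰.pr i x ∈ f.source)
    (hf : 𝒰.IsChainAlong idx K f i a x j b) : 𝒰.IsChainAlong idx K f.symm j b y i a := by
  obtain ⟨φ, hφ, hφf⟩ := hf
  have hφx := apply_pr_of_eventually hxi (hK a hxa) hyj (hK b hyb) hxy hφf
  refine ⟨φ.symm, hφx ▸ hφ.symm (core_subset_source hK) (fun _ _ => rfl) (mapsTo_core hK), ?_⟩
  have hsource : ∀ᶠ t in 𝓝 (𝒰.pr i x), 𝒰.hol i (idx a) t ∈ φ.source :=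
    (tendsto_hol hxi (hK a hxa)).eventually
      (φ.open_source.mem_nhds (hφ.mem_source (core_subset_source hK)))
  have hfsymm : Tendsto f.symm (𝓝 (𝒰.pr j y)) (𝓝 (𝒰.pr i x)) :=
    hxy ▸ f.tendsto_symm hfx
  filter_upwards [hfsymm.eventually hφf, hfsymm.eventually hsource,
    f.open_target.mem_nhds (hxy ▸ f.map_source hfx)] with u hu hus hut
  rw [f.right_inv hut] at hu
  rw [← hu, φ.left_inv hus]

theorem isChainAlong_id_of_mem (hK : ∀ a, K a ⊆ 𝒰.U (idx a)) (hxi : x ∈ 𝒰.U i)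
    (hyi : y ∈ 𝒰.U i) (hxy : 𝒰.pr i x = 𝒰.pr i y) (hxc : x ∈ K c) (hyc : y ∈ K c)
    (hxa : x ∈ K a) (hyb : y ∈ K b) : 𝒰.IsChainAlong idx K id i a x i b := by
  have hx : 𝒰.hol (idx a) (idx c) (𝒰.pr (idx a) x) = 𝒰.pr (idx c) y := by
    rw [hol_pr (hK a hxa) (hK c hxc), ← hol_pr hxi (hK c hxc), hxy, hol_pr hyi (hK c hyc)]
  have hac : 𝒰.CoreChain idx K a (𝒰.pr (idx a) x) c (𝒰.hol (idx a) (idx c)) :=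
    TransitionChain.single ⟨x, ⟨hxa, hxc⟩, rfl⟩
  refine ⟨_, hac.snoc (c := b) ⟨y, ⟨hyc, hyb⟩, hx.symm⟩, ?_⟩
  have hcb := eventually_hol_hol hyi (hK c hyc) (hK b hyb)
  rw [← hxy] at hcb
  filter_upwards [eventually_hol_hol hxi (hK a hxa) (hK c hxc), hcb] with t ht ht'
  exact (congrArg _ ht).trans ht'

theorem isChainAlong_hol (hK : ∀ a, K a ⊆ 𝒰.U (idx a)) (hxi : x ∈ 𝒰.U i) (hxj : x ∈ 𝒰.U j)
    (hxa : x ∈ K a) : 𝒰.IsChainAlong idx K (𝒰.hol i j) i a x j a := by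
  refine ⟨_, TransitionChain.nil, ?_⟩
  filter_upwards [eventually_hol_hol hxi hxj (hK a hxa)] with t ht using ht.symm

theorem isChainAlong_id (hK : ∀ a, K a ⊆ 𝒰.U (idx a)) (hcov : ∀ x, ∃ a, x ∈ interior (K a))
    (hxi : x ∈ 𝒰.U i) (hyi : y ∈ 𝒰.U i) (hxy : 𝒰.pr i x = 𝒰.pr i y) (hxa : x ∈ K a)
    (hyb : y ∈ K b) : 𝒰.IsChainAlong idx K id i a x i b := by
  have hplaque : ∀ z ∈ (𝒰.chart i).plaque ((𝒰.chart i).proj ⟨x, hxi⟩),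
      z ∈ 𝒰.U i ∧ 𝒰.pr i z = 𝒰.pr i x := fun z hz =>
    have hz := FoliatedChart.mem_plaque_iff.1 hz
    ⟨hz.1, (pr_eq_iff hz.1 hxi).2 hz.2⟩
  refine ((𝒰.chart i).isPreconnected_plaque ((𝒰.chart i).proj ⟨x, hxi⟩)).induction₂'
    (fun x y => ∀ a, x ∈ K a → ∀ b, y ∈ K b → 𝒰.IsChainAlong idx K id i a x i b)
    (fun z hz => ?_) (fun z w v hz hw _ hzw hwv a ha b hb => ?_)
    (FoliatedChart.mem_plaque_iff.2 ⟨hxi, rfl⟩)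
    (FoliatedChart.mem_plaque_iff.2 ⟨hyi, (pr_eq_iff hyi hxi).1 hxy.symm⟩) a hxa b hyb
  · obtain ⟨c, hc⟩ := hcov z
    filter_upwards [mem_nhdsWithin_of_mem_nhds (isOpen_interior.mem_nhds hc),
      self_mem_nhdsWithin] with w hw hwP
    obtain ⟨hzi, hzx⟩ := hplaque z hz
    obtain ⟨hwi, hwx⟩ := hplaque w hwP
    have hzc := interior_subset hc
    have hwc := interior_subset hw
    have hzw := hzx.trans hwx.symm
    exact ⟨fun a ha b hb => isChainAlong_id_of_mem hK hzi hwi hzw hzc hwc ha hb,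
      fun a ha b hb => isChainAlong_id_of_mem hK hwi hzi hzw.symm hwc hzc ha hb⟩
  · obtain ⟨c, hc⟩ := hcov w
    have hwc := interior_subset hc
    obtain ⟨hzi, hzx⟩ := hplaque z hz
    obtain ⟨hwi, hwx⟩ := hplaque w hw
    exact (hzw a ha c hwc).comp hzi (hK a ha) hwi (hK c hwc) (hwx.trans hzx.symm) continuousAt_id
      (hwv c hwc b hb)

end

section
variable {f g : 𝒰.Transversal → 𝒰.Transversal} {s : 𝒰.Transversal}

theorem IsChainGerm.congr (hf : 𝒰.IsChainGerm idx K f s) (hfg : f =ᶠ[𝓝 s] g) :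
    𝒰.IsChainGerm idx K g s := by
  rintro i x hxi rfl j y hyj hy a ha b hb
  obtain ⟨φ, hφ, hφf⟩ := hf i x hxi rfl j y hyj (hy.trans hfg.self_of_nhds.symm) a ha b hb
  refine ⟨φ, hφ, ?_⟩
  filter_upwards [hφf, hfg] with t ht ht'
  rw [ht, ht']

theorem isChainGerm_id (hK : ∀ a, K a ⊆ 𝒰.U (idx a)) (hcov : ∀ x, ∃ a, x ∈ interior (K a))
    (s : 𝒰.Transversal) : 𝒰.IsChainGerm idx K id s := by
  rintro i x hxi rfl j y hyj hy a ha b hb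
  obtain rfl : j = i := by rw [← pr_fst hyj, hy, id, pr_fst hxi]
  exact isChainAlong_id hK hcov hxi hyj hy.symm ha hb

theorem IsChainGerm.comp (hK : ∀ a, K a ⊆ 𝒰.U (idx a)) (hcov : ∀ x, ∃ a, x ∈ interior (K a))
    (hfs : ContinuousAt f s) (hf : 𝒰.IsChainGerm idx K f s)
    (hg : 𝒰.IsChainGerm idx K g (f s)) : 𝒰.IsChainGerm idx K (g ∘ f) s := by
  rintro i x hxi rfl j y hyj hy a ha b hb
  obtain ⟨z, hzk, hz⟩ := exists_pr_eq (f (𝒰.pr i x))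
  obtain ⟨c, hc⟩ := hcov z
  have hzc := interior_subset hc
  exact (hf i x hxi rfl _ z hzk hz a ha c hzc).comp hxi (hK a ha) hzk (hK c hzc) hz hfs
    (hg _ z hzk hz j y hyj hy c hzc b hb)

theorem IsChainGerm.symm (hK : ∀ a, K a ⊆ 𝒰.U (idx a))
    {f : OpenPartialHomeomorph 𝒰.Transversal 𝒰.Transversal} (hs : s ∈ f.source)
    (hf : 𝒰.IsChainGerm idx K f s) : 𝒰.IsChainGerm idx K f.symm (f s) := by
  intro i x hxi hx j y hyj hy a ha b hb
  rw [f.left_inv hs] at hy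
  subst hy
  exact (hf j y hyj rfl i x hxi hx b hb a ha).symm hK hyj hb hxi ha hx hs

theorem isChainGerm_hol (hK : ∀ a, K a ⊆ 𝒰.U (idx a)) (hcov : ∀ x, ∃ a, x ∈ interior (K a))
    {i j : ι} (hs : s ∈ (𝒰.hol i j).source) : 𝒰.IsChainGerm idx K (𝒰.hol i j) s := by
  intro i' x hx hxs j' y hy hys a ha b hb
  obtain ⟨z, hzi, hzj, rfl⟩ := hs
  rw [← pr_of_mem hzi] at hxs hys
  rw [hol_pr hzi hzj] at hys
  obtain rfl : i' = i := by rw [← pr_fst hx, hxs, pr_fst hzi]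
  obtain rfl : j' = j := by rw [← pr_fst hy, hys, pr_fst hzj]
  obtain ⟨c, hc⟩ := hcov z
  have hzc := interior_subset hc
  have hxz := (isChainAlong_id hK hcov hx hzi hxs ha hzc).comp hx (hK a ha) hzi (hK c hzc)
    hxs.symm continuousAt_id (isChainAlong_hol hK hzi hzj hzc)
  have hpr : 𝒰.pr j' z = 𝒰.hol i' j' (𝒰.pr i' x) := by rw [hxs, hol_pr hzi hzj]
  have hcont : ContinuousAt (𝒰.hol i' j') (𝒰.pr i' x) :=
    hxs ▸ (𝒰.hol i' j').continuousAt (pr_mem_hol_source hzi hzj)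
  exact IsChainAlong.comp (f := 𝒰.hol i' j') hx (hK a ha) hzj (hK c hzc) hpr hcont hxz
    (isChainAlong_id hK hcov hzj hy hys.symm hzc hb)

theorem isChainGerm_of_mem_holonomyPseudogroup (hK : ∀ a, K a ⊆ 𝒰.U (idx a))
    (hcov : ∀ x, ∃ a, x ∈ interior (K a))
    {f : OpenPartialHomeomorph 𝒰.Transversal 𝒰.Transversal} (hf : f ∈ 𝒰.holonomyPseudogroup)
    (hs : s ∈ f.source) : 𝒰.IsChainGerm idx K f s := by
  refine generatedPseudogroup_germ_induction (P := 𝒰.IsChainGerm idx K) IsChainGerm.congr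
    (isChainGerm_id hK hcov) (IsChainGerm.comp hK hcov) (IsChainGerm.symm hK) ?_ hf hs
  rintro _ ⟨i, j, rfl⟩ s hs
  exact isChainGerm_hol hK hcov hs

end

end RegularAtlas

theorem IsQuasiAnalyticFamily.eq_of_eventually {T : Type*} [TopologicalSpace T]
    {S : Set (OpenPartialHomeomorph T T)} (hS : IsQuasiAnalyticFamily S)
    {h : OpenPartialHomeomorph T T} (hh : h ∈ S) {t : T} (ht : t ∈ h.source)
    (hid : ∀ᶠ r in 𝓝 t, h r = r) {x : T} (hx : x ∈ h.source) : h x = x := by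
  obtain ⟨O, hO, hOo, htO⟩ := mem_nhds_iff.1 (hid.and (h.open_source.mem_nhds ht))
  exact hS h hh ⟨O, hOo, ⟨t, htO⟩, fun y hy => (hO hy).2, fun y hy => (hO hy).1⟩ x hx

theorem IsQuasiAnalyticFamily.apply_apply_of_eventuallyEq {T : Type*} [TopologicalSpace T]
    {S : Set (OpenPartialHomeomorph T T)} (hS : IsLocalPseudoStarGroup S)
    (hSq : IsQuasiAnalyticFamily S) {f g k : OpenPartialHomeomorph T T} (hg : g ∈ S) (hk : k ∈ S)
    {t : T} (htf : t ∈ f.source) (htg : t ∈ g.source) (htk : f t ∈ k.source) (hgf : g =ᶠ[𝓝 t] f)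
    (hkf : k =ᶠ[𝓝 (f t)] f.symm) {x : T} (hxg : x ∈ g.source) (hxk : g x ∈ k.source) :
    k (g x) = x := by
  refine hSq.eq_of_eventually (hS.trans_mem _ hg _ hk) (t := t)
    ⟨htg, (congrArg (· ∈ k.source) hgf.self_of_nhds).mpr htk⟩ ?_ ⟨hxg, hxk⟩
  filter_upwards [hgf, (f.continuousAt htf).eventually hkf, f.open_source.mem_nhds htf]
    with r hr hfr hrf
  exact (congrArg k hr).trans (hfr.trans (f.left_inv hrf))

section Transports

variable {T T' : Type*} [TopologicalSpace T'] [TopologicalSpace T]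

/-- The maps `f ↦ l f k`, suitably restricted, locally map `S̄` to `S̄'`. -/
def Transports (S : Set (OpenPartialHomeomorph T T)) (S' : Set (OpenPartialHomeomorph T' T'))
    (k : OpenPartialHomeomorph T' T) (l : OpenPartialHomeomorph T T') : Prop :=
  ∀ g ∈ starClosure S, ∀ s ∈ k.source, k s ∈ g.source → g (k s) ∈ l.source →
    ∃ V, IsOpen V ∧ s ∈ V ∧ ∃ N ∈ 𝓝 g, ∀ f ∈ starClosure S, f ∈ N →
      V ⊆ ((k.trans f).trans l).source ∧ ((k.trans f).trans l).restr V ∈ starClosure S'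

namespace Transports

variable {S : Set (OpenPartialHomeomorph T T)} {S' : Set (OpenPartialHomeomorph T' T')}
  {k : OpenPartialHomeomorph T' T} {l : OpenPartialHomeomorph T T'}

theorem trans_right [LocallyCompactSpace T'] (hS' : IsLocalPseudoStarGroup S')
    (h : Transports S S' k l) {a : OpenPartialHomeomorph T' T'} (ha : a ∈ starClosure S') :
    Transports S S' k (l.trans a) := by
  intro g hg s hs hks hgs
  obtain ⟨V, hV, hsV, N, hN, H⟩ := h g hg s hs hks hgs.1
  have hsV' : s ∈ (((k.trans g).trans l).restr V).source :=
    (mem_restr_source hV).2 ⟨(H g hg (mem_of_mem_nhds hN)).1 hsV, hsV⟩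
  obtain ⟨V', hV', hsV', N', hN', H'⟩ := exists_trans_restr_mem_starClosure hS' ha hsV' hgs.2
  have hcont : Continuous fun f => ((k.trans f).trans l).restr V :=
    (continuous_restr V).comp (continuous_trans_trans k l)
  refine ⟨V ∩ V', hV.inter hV', ⟨hsV, hsV'⟩, _,
    inter_mem hN (hcont.continuousAt.preimage_mem_nhds hN'), ?_⟩
  rintro f hf ⟨hfN, hfN'⟩
  obtain ⟨hVf, hf'⟩ := H f hf hfN
  obtain ⟨hVa, hfa⟩ := H' _ hf' hfN'
  refine ⟨fun x hx => ⟨(hVf hx.1).1, (hVf hx.1).2, (hVa hx.2).2⟩, ?_⟩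
  have hrestr := restr_mem_starClosure hS' hfa (hV.inter hV')
  rwa [restr_restr_of_subset _ hV' (hV.inter hV') inter_subset_right,
    OpenPartialHomeomorph.restr_trans,
    restr_restr_of_subset _ hV (hV.inter hV') inter_subset_left,
    OpenPartialHomeomorph.trans_assoc] at hrestr

theorem trans_left [LocallyCompactSpace T] (hS : IsLocalPseudoStarGroup S)
    (h : Transports S S' k l) {a : OpenPartialHomeomorph T T} (ha : a ∈ starClosure S) :
    Transports S S' k (a.trans l) := by
  intro g hg s hs hks hgs
  obtain ⟨V, hV, hsV, N, hN, H⟩ := exists_trans_restr_mem_starClosure hS ha hks hgs.1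
  obtain ⟨hVg, hga⟩ := H g hg (mem_of_mem_nhds hN)
  obtain ⟨V', hV', hsV', N', hN', H'⟩ :=
    h _ hga s hs ((mem_restr_source hV).2 ⟨hVg hsV, hsV⟩) hgs.2
  have hcont : Continuous fun f : OpenPartialHomeomorph T T => (f.trans a).restr V :=
    (continuous_restr V).comp (continuous_trans.comp (continuous_id.prodMk continuous_const))
  refine ⟨V', hV', hsV', _, inter_mem hN (hcont.continuousAt.preimage_mem_nhds hN'), ?_⟩
  rintro f hf ⟨hfN, hfN'⟩
  obtain ⟨hVf, hfa⟩ := H f hf hfN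
  obtain ⟨hVl, hfl⟩ := H' _ hfa hfN'
  have hmaps : ∀ x ∈ V', k x ∈ V := fun x hx => ((mem_restr_source hV).1 (hVl hx).1.2).2
  have hsub : V' ⊆ ((k.trans f).trans (a.trans l)).source := fun x hx =>
    ⟨⟨(hVl hx).1.1, (hVf (hmaps x hx)).1⟩, (hVf (hmaps x hx)).2, (hVl hx).2⟩
  refine ⟨hsub, ?_⟩
  convert hfl using 1
  refine OpenPartialHomeomorph.ext _ _ (fun _ => rfl) (fun _ => rfl) (ext fun x => ?_)
  simp only [mem_restr_source hV']
  exact ⟨fun hx => ⟨hVl hx.2, hx.2⟩, fun hx => ⟨hsub hx.2, hx.2⟩⟩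

end Transports

end Transports

theorem trans_restr_trans_eqOnSource {T T₁ T₂ T₃ : Type*} [TopologicalSpace T] [TopologicalSpace T₁]
    [TopologicalSpace T₂] [TopologicalSpace T₃] (k : OpenPartialHomeomorph T T₁)
    (f : OpenPartialHomeomorph T₁ T₂) (l : OpenPartialHomeomorph T₂ T₃) {O : Set T₁}
    (hO : IsOpen O) :
    (k.trans (f.restr O)).trans l ≈ ((k.trans f).trans l).restr (k.source ∩ k ⁻¹' O) := by
  refine ⟨ext fun x => ?_, fun _ _ => rfl⟩
  simp only [OpenPartialHomeomorph.trans_source, mem_restr_source (k.isOpen_inter_preimage hO),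
    mem_inter_iff, mem_preimage, mem_restr_source hO, OpenPartialHomeomorph.coe_trans,
    OpenPartialHomeomorph.restr_apply]
  tauto

theorem trans_trans_trans_eqOnSource {T T₁ T₂ T₃ T₄ : Type*} [TopologicalSpace T]
    [TopologicalSpace T₁] [TopologicalSpace T₂] [TopologicalSpace T₃] [TopologicalSpace T₄]
    (k : OpenPartialHomeomorph T T₁) {f : OpenPartialHomeomorph T₁ T₂}
    (g : OpenPartialHomeomorph T₂ T₃) {b : OpenPartialHomeomorph T₂ T₄}
    (l : OpenPartialHomeomorph T₃ T) (hf : f.target ⊆ b.source) :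
    (k.trans (f.trans g)).trans l ≈
      ((k.trans f).trans b).trans ((b.symm.trans g).trans l) := by
  have hfb : ∀ x, k x ∈ f.source → f (k x) ∈ b.source := fun x hx => hf (f.map_source hx)
  refine ⟨ext fun x => ?_, fun x hx => ?_⟩
  · simp only [OpenPartialHomeomorph.trans_source, mem_inter_iff, mem_preimage,
      OpenPartialHomeomorph.coe_trans, Function.comp_apply, OpenPartialHomeomorph.symm_source]
    constructor
    · rintro ⟨⟨hxk, hxf, hxg⟩, hxl⟩
      have hxb := hfb x hxf
      rw [b.left_inv hxb]
      exact ⟨⟨⟨hxk, hxf⟩, hxb⟩, ⟨b.map_source hxb, hxg⟩, hxl⟩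
    · rintro ⟨⟨⟨hxk, hxf⟩, hxb⟩, ⟨-, hxg⟩, hxl⟩
      rw [b.left_inv hxb] at hxg hxl
      exact ⟨⟨hxk, hxf, hxg⟩, hxl⟩
  · exact congrArg (fun y => l (g y)) (b.left_inv (hfb x hx.1.2.1)).symm

namespace RegularAtlas

variable {n : ℕ} {X : Type u} {Z : Type v} [TopologicalSpace X] [TopologicalSpace Z]
  {ℱ : FoliatedStructure n X Z} {ι : Type w}

theorem hol_mem_holonomyPseudogroup (𝒰 : RegularAtlas ℱ ι) (i j : ι) :
    𝒰.hol i j ∈ 𝒰.holonomyPseudogroup :=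
  fun _ hH => hH.2 ⟨i, j, rfl⟩

theorem symm_mem_holonomyPseudogroup {𝒰 : RegularAtlas ℱ ι}
    {f : OpenPartialHomeomorph 𝒰.Transversal 𝒰.Transversal} (hf : f ∈ 𝒰.holonomyPseudogroup) :
    f.symm ∈ 𝒰.holonomyPseudogroup :=
  fun H hH => hH.1.symm_mem f (hf H hH)

theorem hol_self_apply {𝒰 : RegularAtlas ℱ ι} {i : ι} {t : 𝒰.Transversal}
    (ht : t ∈ (𝒰.hol i i).source) : 𝒰.hol i i t = t := by
  obtain ⟨x, hx, -, rfl⟩ := ht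
  exact 𝒰.holFun_p hx hx

variable {𝒰 : RegularAtlas ℱ ι} [Nonempty 𝒰.Transversal]
  {ι' : Type*} {𝒰' : RegularAtlas ℱ ι'} [Nonempty 𝒰'.Transversal]

variable (𝒰') in
variable (𝒰) in
/-- A small open set with its holonomy transformation between two atlases, and a compact subset of
it, whose points are those where the holonomy transformation is followed along chains. -/
structure CoreBox where
  left : ι
  right : ι'
  map : OpenPartialHomeomorph 𝒰.Transversal 𝒰'.Transversal
  carrier : Set X
  core : Set X
  isBox : IsBox 𝒰 𝒰' left right map carrier
  isCompact_core : IsCompact core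
  core_subset : core ⊆ carrier

/-- The local transformations in `S`, from the domain of a box to the domain of another one, which
correspond to elements of `S'`. -/
def boxMaps (S : Set (OpenPartialHomeomorph 𝒰.Transversal 𝒰.Transversal))
    (S' : Set (OpenPartialHomeomorph 𝒰'.Transversal 𝒰'.Transversal)) (a b : CoreBox 𝒰 𝒰') :
    Set (OpenPartialHomeomorph 𝒰.Transversal 𝒰.Transversal) :=
  {f | f ∈ S ∧ f.source ⊆ a.map.source ∧ f.target ⊆ b.map.source ∧
    (a.map.symm.trans f).trans b.map ∈ S'}

theorem exists_coreBox [LocallyCompactSpace X] {i : ι} {j : ι'}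
    {c : OpenPartialHomeomorph 𝒰.Transversal 𝒰'.Transversal}
    {B : Set X} (h : IsBox 𝒰 𝒰' i j c B) {x : X} (hx : x ∈ B) :
    ∃ a : CoreBox 𝒰 𝒰', a.left = i ∧ a.right = j ∧ a.map = c ∧ a.carrier = B ∧
      x ∈ interior a.core := by
  obtain ⟨K, hK, hxK, hKB⟩ := exists_compact_subset h.isOpen hx
  exact ⟨⟨i, j, c, B, K, h, hK, hKB⟩, rfl, rfl, rfl, rfl, hxK⟩

variable (𝒰 𝒰') in
theorem exists_finite_coreBox_cover [CompactSpace X] [LocallyCompactSpace X] :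
    ∃ A : Set (CoreBox 𝒰 𝒰'), A.Finite ∧ ∀ x, ∃ a ∈ A, x ∈ interior a.core := by
  have hbox : ∀ x : X, ∃ a : CoreBox 𝒰 𝒰', x ∈ interior a.core := by
    intro x
    obtain ⟨i, hi⟩ := 𝒰.cover x
    obtain ⟨j, hj⟩ := 𝒰'.cover x
    obtain ⟨c, B, hB, hxB, -⟩ := exists_isBox 𝒰 𝒰' hi hj univ_mem
    obtain ⟨a, -, -, -, -, ha⟩ := exists_coreBox hB hxB
    exact ⟨a, ha⟩
  choose a ha using hbox
  obtain ⟨τ, hτ⟩ := CompactSpace.elim_nhds_subcover (fun x => interior (a x).core)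
    fun x => isOpen_interior.mem_nhds (ha x)
  refine ⟨a '' τ, τ.finite_toSet.image a, fun x => ?_⟩
  obtain ⟨y, hy, hxy⟩ := mem_iUnion₂.1 (hτ ▸ mem_univ x : x ∈ ⋃ y ∈ τ, interior (a y).core)
  exact ⟨a y, ⟨y, hy, rfl⟩, hxy⟩

theorem CoreBox.core_subset_U (a : CoreBox 𝒰 𝒰') : a.core ⊆ 𝒰.U a.left :=
  a.core_subset.trans a.isBox.left

variable {S : Set (OpenPartialHomeomorph 𝒰.Transversal 𝒰.Transversal)}
  {S' : Set (OpenPartialHomeomorph 𝒰'.Transversal 𝒰'.Transversal)}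

theorem isTransitionSystem_boxMaps (hS : IsLocalPseudoStarGroup S)
    (hS' : IsLocalPseudoStarGroup S') {A : Type*} (box : A → CoreBox 𝒰 𝒰') :
    IsTransitionSystem S fun a b => boxMaps S S' (box a) (box b) where
  subset _ _ _ hf := hf.1
  trans_mem := by
    rintro a b c f ⟨hf, hfsource, hftarget, hf'⟩ g ⟨hg, -, hgtarget, hg'⟩
    exact ⟨hS.trans_mem _ hf _ hg, fun x hx => hfsource hx.1, fun x hx => hgtarget hx.1,
      hS'.mem_of_eqOnSource _ (hS'.trans_mem _ hf' _ hg') _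
        (trans_trans_trans_eqOnSource _ g _ hftarget)⟩
  restr_mem := by
    rintro a b f ⟨hf, hsource, htarget, hf'⟩ O hO
    exact ⟨hS.restr_mem _ hf _ hO, fun x hx => hsource hx.1, fun x hx => htarget hx.1,
      hS'.mem_of_eqOnSource _
        (hS'.restr_mem _ hf' _ ((box a).map.symm.isOpen_inter_preimage hO)) _
        (trans_restr_trans_eqOnSource _ f _ hO)⟩

section
variable {a b : CoreBox 𝒰 𝒰'}

theorem CoreBox.hol_restr_source_subset {O : Set 𝒰.Transversal} (hO : IsOpen O)
    (hOab : O ⊆ 𝒰.pr a.left '' (a.carrier ∩ b.carrier)) :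
    ((𝒰.hol a.left b.left).restr O).source ⊆ a.map.source := by
  rw [a.isBox.source_eq]
  exact fun t ht => image_mono inter_subset_left (hOab ((mem_restr_source hO).1 ht).2)

theorem CoreBox.hol_restr_target_subset {O : Set 𝒰.Transversal} (hO : IsOpen O)
    (hOab : O ⊆ 𝒰.pr a.left '' (a.carrier ∩ b.carrier)) :
    ((𝒰.hol a.left b.left).restr O).target ⊆ b.map.source := by
  rw [← OpenPartialHomeomorph.image_source_eq_target]
  rintro _ ⟨t, ht, rfl⟩
  obtain ⟨x, ⟨hxa, hxb⟩, rfl⟩ := hOab ((mem_restr_source hO).1 ht).2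
  rw [OpenPartialHomeomorph.restr_apply, hol_pr (a.isBox.left hxa) (b.isBox.left hxb)]
  exact b.isBox.pr_mem_source hxb

theorem CoreBox.trans_hol_restr_trans_eqOnSource {O : Set 𝒰.Transversal} (hO : IsOpen O)
    (hOab : O ⊆ 𝒰.pr a.left '' (a.carrier ∩ b.carrier)) :
    (a.map.symm.trans ((𝒰.hol a.left b.left).restr O)).trans b.map ≈
      (𝒰'.hol a.right b.right).restr (a.map.target ∩ a.map.symm ⁻¹' O) := by
  have hlift : ∀ t ∈ a.map.target, a.map.symm t ∈ O → ∃ x, x ∈ a.carrier ∧ x ∈ b.carrier ∧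
      a.map.symm t = 𝒰.pr a.left x ∧ t = 𝒰'.pr a.right x := by
    intro t ht htO
    obtain ⟨x, ⟨hxa, hxb⟩, hx⟩ := hOab htO
    exact ⟨x, hxa, hxb, hx.symm, by rw [← a.isBox.map_pr x hxa, hx, a.map.right_inv ht]⟩
  have hsource : ∀ t ∈ a.map.target, a.map.symm t ∈ O →
      t ∈ (𝒰'.hol a.right b.right).source ∧
      a.map.symm t ∈ (𝒰.hol a.left b.left).source ∧
      𝒰.hol a.left b.left (a.map.symm t) ∈ b.map.source ∧
      b.map (𝒰.hol a.left b.left (a.map.symm t)) = 𝒰'.hol a.right b.right t := by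
    intro t ht htO
    obtain ⟨x, hxa, hxb, hx, rfl⟩ := hlift t ht htO
    rw [hx, hol_pr (a.isBox.left hxa) (b.isBox.left hxb),
      hol_pr (a.isBox.right hxa) (b.isBox.right hxb)]
    exact ⟨pr_mem_hol_source (a.isBox.right hxa) (b.isBox.right hxb),
      pr_mem_hol_source (a.isBox.left hxa) (b.isBox.left hxb), b.isBox.pr_mem_source hxb,
      b.isBox.map_pr x hxb⟩
  have hO' : IsOpen (a.map.target ∩ a.map.symm ⁻¹' O) := a.map.symm.isOpen_inter_preimage hO
  refine ⟨ext fun t => ?_, fun t ht => ?_⟩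
  · rw [mem_restr_source hO']
    constructor
    · rintro ⟨⟨ht, htO⟩, -⟩
      have htO := ((mem_restr_source hO).1 htO).2
      exact ⟨(hsource t ht htO).1, ht, htO⟩
    · rintro ⟨-, ht, htO⟩
      obtain ⟨-, h₁, h₂, -⟩ := hsource t ht htO
      exact ⟨⟨ht, (mem_restr_source hO).2 ⟨h₁, htO⟩⟩, h₂⟩
  · exact (hsource t ht.1.1 ((mem_restr_source hO).1 ht.1.2).2).2.2.2

theorem exists_hol_restr_mem_boxMaps (hS : IsAdmissible 𝒰.holonomyPseudogroup S)
    (hS' : IsAdmissible 𝒰'.holonomyPseudogroup S') {y : X}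
    (ha : y ∈ a.carrier) (hb : y ∈ b.carrier) :
    ∃ O, IsOpen O ∧ 𝒰.pr a.left y ∈ O ∧ O ⊆ (𝒰.hol a.left b.left).source ∧
      (𝒰.hol a.left b.left).restr O ∈ boxMaps S S' a b := by
  obtain ⟨O₁, hO₁, hy₁, h₁⟩ := hS.generates _ (𝒰.hol_mem_holonomyPseudogroup a.left b.left)
    (𝒰.pr a.left y) (pr_mem_hol_source (a.isBox.left ha) (b.isBox.left hb))
  obtain ⟨O₂, hO₂, hy₂, h₂⟩ := hS'.generates _ (𝒰'.hol_mem_holonomyPseudogroup a.right b.right)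
    (𝒰'.pr a.right y) (pr_mem_hol_source (a.isBox.right ha) (b.isBox.right hb))
  set O := O₁ ∩ (a.map.source ∩ a.map ⁻¹' O₂) ∩ 𝒰.pr a.left '' (a.carrier ∩ b.carrier)
  have hO : IsOpen O := (hO₁.inter (a.map.isOpen_inter_preimage hO₂)).inter
    (isOpen_image_pr (a.isBox.isOpen.inter b.isBox.isOpen) fun x hx => a.isBox.left hx.1)
  have hOab : O ⊆ 𝒰.pr a.left '' (a.carrier ∩ b.carrier) := inter_subset_right
  have hOhol : O ⊆ (𝒰.hol a.left b.left).source := fun t ht => by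
    obtain ⟨x, ⟨hxa, hxb⟩, rfl⟩ := hOab ht
    exact pr_mem_hol_source (a.isBox.left hxa) (b.isBox.left hxb)
  have hO' : IsOpen (a.map.target ∩ a.map.symm ⁻¹' O) := a.map.symm.isOpen_inter_preimage hO
  have hO'O₂ : a.map.target ∩ a.map.symm ⁻¹' O ⊆ O₂ := fun t ht =>
    a.map.right_inv ht.1 ▸ ht.2.1.2.2
  refine ⟨O, hO, ⟨⟨hy₁, a.isBox.pr_mem_source ha, ?_⟩, y, ⟨ha, hb⟩, rfl⟩, hOhol, ?_,
    CoreBox.hol_restr_source_subset hO hOab, CoreBox.hol_restr_target_subset hO hOab, ?_⟩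
  · rwa [mem_preimage, a.isBox.map_pr y ha]
  · rw [← restr_restr_of_subset _ hO₁ hO fun t ht => ht.1.1]
    exact hS.isLocal.restr_mem _ h₁ _ hO
  · refine hS'.isLocal.mem_of_eqOnSource _ ?_ _ (CoreBox.trans_hol_restr_trans_eqOnSource hO hOab)
    rw [← restr_restr_of_subset _ hO₂ hO' hO'O₂]
    exact hS'.isLocal.restr_mem _ h₂ _ hO'

theorem exists_refl_restr_mem_boxMaps (hS : IsAdmissible 𝒰.holonomyPseudogroup S)
    (hS' : IsAdmissible 𝒰'.holonomyPseudogroup S') {y : X} (ha : y ∈ a.carrier) :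
    ∃ O, IsOpen O ∧ 𝒰.pr a.left y ∈ O ∧
      (OpenPartialHomeomorph.refl _).restr O ∈ boxMaps S S' a a := by
  obtain ⟨O, hO, hyO, hOhol, hOmem, hsource, htarget, hO'⟩ :=
    exists_hol_restr_mem_boxMaps hS hS' ha ha
  have hrefl : (OpenPartialHomeomorph.refl _).restr O ≈ (𝒰.hol a.left a.left).restr O := by
    refine ⟨ext fun t => ?_,
      fun t ht => (hol_self_apply (hOhol ((mem_restr_source hO).1 ht).2)).symm⟩
    rw [mem_restr_source hO, mem_restr_source hO]
    exact ⟨fun ht => ⟨hOhol ht.2, ht.2⟩, fun ht => ⟨mem_univ _, ht.2⟩⟩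
  exact ⟨O, hO, hyO, hS.isLocal.mem_of_eqOnSource _ hOmem _ hrefl, hrefl.source_eq ▸ hsource,
    hrefl.target_eq ▸ htarget, hS'.isLocal.mem_of_eqOnSource _ hO' _
      (((Setoid.refl a.map.symm).trans' hrefl).trans' (Setoid.refl a.map))⟩

end

theorem exists_chain_extension [T2Space X] [LocallyCompactSpace X]
    (hS : IsAdmissible 𝒰.holonomyPseudogroup S) (hS' : IsAdmissible 𝒰'.holonomyPseudogroup S')
    {A : Type*} [Finite A] (box : A → CoreBox 𝒰 𝒰') (a : A) {y : X} (hy : y ∈ (box a).core) :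
    ∃ V, IsOpen V ∧ 𝒰.pr (box a).left y ∈ V ∧ V ⊆ (box a).map.source ∧ ∀ s ∈ V, ∀ b φ,
      𝒰.CoreChain (fun c => (box c).left) (fun c => (box c).core) a s b φ →
        ∃ g ∈ boxMaps S S' (box a) (box b), V ⊆ g.source ∧ g =ᶠ[𝓝 s] φ := by
  obtain ⟨Q, hQ⟩ := hS.equicontinuous
  obtain ⟨O, hO, hyO, hrefl⟩ := exists_refl_restr_mem_boxMaps hS hS' ((box a).core_subset hy)
  have hloc : ∀ c d, ∀ t ∈ 𝒰.pr (box c).left '' ((box c).core ∩ (box d).core), ∃ O, IsOpen O ∧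
      t ∈ O ∧ (𝒰.hol (box c).left (box d).left).restr O ∈ boxMaps S S' (box c) (box d) := by
    rintro c d _ ⟨x, ⟨hxc, hxd⟩, rfl⟩
    obtain ⟨O, hO, hxO, -, hmem⟩ := exists_hol_restr_mem_boxMaps hS hS'
      ((box c).core_subset hxc) ((box d).core_subset hxd)
    exact ⟨O, hO, hxO, hmem⟩
  obtain ⟨V, hV, hyV, hVO, hext⟩ := exists_uniform_extension hQ
    (isTransitionSystem_boxMaps hS.isLocal hS'.isLocal box)
    (fun c d => ((box c).isCompact_core.inter (box d).isCompact_core).image_of_continuousOn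
      ((continuousOn_pr _).mono (inter_subset_left.trans (box c).core_subset_U)))
    (core_subset_source fun c => (box c).core_subset_U) hloc a hO hyO hrefl
  exact ⟨V, hV, hyV, fun t ht => hrefl.2.1 ((mem_restr_source hO).2 ⟨mem_univ t, hVO ht⟩), hext⟩

theorem exists_holonomy_extension [CompactSpace X] [T2Space X]
    (hS : IsAdmissible 𝒰.holonomyPseudogroup S) (hS' : IsAdmissible 𝒰'.holonomyPseudogroup S')
    (a b : CoreBox 𝒰 𝒰') {y : X} (hy : y ∈ a.core) :
    ∃ V, IsOpen V ∧ 𝒰.pr a.left y ∈ V ∧ V ⊆ a.map.source ∧ ∀ f ∈ 𝒰.holonomyPseudogroup,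
      ∀ s ∈ V, s ∈ f.source → s ∈ 𝒰.pr a.left '' a.core → f s ∈ 𝒰.pr b.left '' b.core →
        ∃ g ∈ boxMaps S S' a b, V ⊆ g.source ∧ g =ᶠ[𝓝 s] f := by
  obtain ⟨A₀, hA₀, hcov₀⟩ := exists_finite_coreBox_cover 𝒰 𝒰'
  let A : Set (CoreBox 𝒰 𝒰') := insert a (insert b A₀)
  have : Finite A := (hA₀.insert b).insert a
  let idx : A → ι := fun c => c.1.left
  let K : A → Set X := fun c => c.1.core
  have hK : ∀ c, K c ⊆ 𝒰.U (idx c) := fun c => c.1.core_subset_U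
  have hcov : ∀ x, ∃ c, x ∈ interior (K c) := fun x => by
    obtain ⟨c, hc, hxc⟩ := hcov₀ x
    exact ⟨⟨c, mem_insert_of_mem _ (mem_insert_of_mem _ hc)⟩, hxc⟩
  let a' : A := ⟨a, mem_insert _ _⟩
  let b' : A := ⟨b, mem_insert_of_mem _ (mem_insert _ _)⟩
  obtain ⟨V, hV, hyV, hVa, hext⟩ := exists_chain_extension hS hS' (Subtype.val : A → _) a' hy
  refine ⟨V, hV, hyV, hVa, ?_⟩
  rintro f hf _ hsV hsf ⟨x, hx, rfl⟩ ⟨z, hz, hzf⟩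
  obtain ⟨φ, hφ, hφf⟩ := isChainGerm_of_mem_holonomyPseudogroup (idx := idx) hK hcov hf hsf
    a.left x (hK a' hx) rfl b.left z (hK b' hz) hzf a' hx b' hz
  obtain ⟨g, hg, hVg, hgφ⟩ := hext _ hsV b' φ hφ
  refine ⟨g, hg, hVg, ?_⟩
  have hself : ∀ (c : CoreBox 𝒰 𝒰') (x : X), x ∈ c.core →
      ∀ᶠ t in 𝓝 (𝒰.pr c.left x), 𝒰.hol c.left c.left t = t := fun c x hx =>
    eventually_of_mem ((𝒰.hol c.left c.left).open_source.mem_nhds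
      (pr_mem_hol_source (c.core_subset_U hx) (c.core_subset_U hx))) fun t ht => hol_self_apply ht
  filter_upwards [hgφ, hφf, hself a x hx, (f.continuousAt hsf).eventually (hzf ▸ hself b z hz)]
    with t hgφt hφft hat hbt
  rw [hgφt, ← hbt, ← hφft, hat]

end RegularAtlas

namespace RegularAtlas

variable {n : ℕ} {X : Type u} {Z : Type v} [TopologicalSpace X] [TopologicalSpace Z]
  {ℱ : FoliatedStructure n X Z} {ι : Type w} {𝒰 : RegularAtlas ℱ ι} [Nonempty 𝒰.Transversal]
  {ι' : Type*} {𝒰' : RegularAtlas ℱ ι'} [Nonempty 𝒰'.Transversal]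
  {S : Set (OpenPartialHomeomorph 𝒰.Transversal 𝒰.Transversal)}
  {S' : Set (OpenPartialHomeomorph 𝒰'.Transversal 𝒰'.Transversal)}

theorem restr_trans_mem_of_leftInverse {a b : CoreBox 𝒰 𝒰'} (hS' : IsLocalPseudoStarGroup S')
    {F φ : OpenPartialHomeomorph 𝒰.Transversal 𝒰.Transversal} (hF : F ∈ boxMaps S S' b a)
    {U : Set 𝒰.Transversal} (hU : IsOpen U) (hUφ : U ⊆ φ.source) (hφF : MapsTo φ U F.source)
    (hFφ : ∀ x ∈ U, F (φ x) = x) :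
    ((a.map.symm.trans φ).trans b.map).restr (a.map.target ∩ a.map.symm ⁻¹' U) ∈ S' := by
  obtain ⟨-, hFsource, -, hF'⟩ := hF
  have hV : IsOpen (a.map.target ∩ a.map.symm ⁻¹' U) := a.map.symm.isOpen_inter_preimage hU
  have hsymm : ∀ x ∈ U, F.symm x = φ x := fun x hx => by
    rw [← F.left_inv (hφF hx), hFφ x hx]
  refine hS'.mem_of_eqOnSource _ (hS'.restr_mem _ (hS'.symm_mem _ hF') _ hV) _
    ⟨ext fun t => ?_, fun t ht => congrArg b.map ?_⟩
  · rw [mem_restr_source hV, mem_restr_source hV]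
    refine and_congr_left fun ⟨hta, htU⟩ => ⟨fun _ => ⟨hta, ?_, ?_⟩, fun _ => ⟨⟨hta, hUφ htU⟩, ?_⟩⟩
    · exact hFφ _ htU ▸ F.map_source (hφF htU)
    · exact (congrArg (· ∈ b.map.source) (hsymm _ htU)).mpr (hFsource (hφF htU))
    · exact hFsource (hφF htU)
  · exact (hsymm _ ((mem_restr_source hV).1 ht).2.2).symm

theorem exists_leftInverse_boxMaps (hS : IsAdmissible 𝒰.holonomyPseudogroup S)
    {a b : CoreBox 𝒰 𝒰'} {W : Set 𝒰.Transversal}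
    (hext : ∀ f ∈ 𝒰.holonomyPseudogroup, ∀ s ∈ W, s ∈ f.source → s ∈ 𝒰.pr b.left '' b.core →
      f s ∈ 𝒰.pr a.left '' a.core → ∃ g ∈ boxMaps S S' b a, W ⊆ g.source ∧ g =ᶠ[𝓝 s] f)
    {φ : OpenPartialHomeomorph 𝒰.Transversal 𝒰.Transversal} (hφ : φ ∈ S) {y : X}
    (hya : y ∈ a.core) (hyφ : 𝒰.pr a.left y ∈ φ.source) (hyW : φ (𝒰.pr a.left y) ∈ W)
    (hyb : φ (𝒰.pr a.left y) ∈ 𝒰.pr b.left '' b.core) :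
    ∃ F ∈ boxMaps S S' b a, W ⊆ F.source ∧ ∀ x ∈ φ.source, φ x ∈ W → F (φ x) = x := by
  obtain ⟨F, hF, hWF, hFφ⟩ := hext φ.symm (symm_mem_holonomyPseudogroup (hS.subset hφ)) _ hyW
    (φ.map_source hyφ) hyb ⟨y, hya, (φ.left_inv hyφ).symm⟩
  exact ⟨F, hF, hWF, fun x hx hxW => hS.quasiAnalytic.apply_apply_of_eventuallyEq hS.isLocal hφ hF.1
    hyφ hyφ (hWF hyW) .rfl hFφ hx (hWF hxW)⟩

theorem transports_of_isBox [CompactSpace X] [T2Space X]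
    (hS : IsAdmissible 𝒰.holonomyPseudogroup S) (hS' : IsAdmissible 𝒰'.holonomyPseudogroup S')
    {i₁ i₂ : ι} {j₁ j₂ : ι'} {c d : OpenPartialHomeomorph 𝒰.Transversal 𝒰'.Transversal}
    {B C : Set X} (hc : IsBox 𝒰 𝒰' i₁ j₁ c B) (hd : IsBox 𝒰 𝒰' i₂ j₂ d C) :
    Transports S S' c.symm d := by
  intro g _ s hs hks hgs
  obtain ⟨y, hy, rfl⟩ : s ∈ 𝒰'.pr j₁ '' B := hc.target_eq ▸ hs
  have hcy := hc.symm.map_pr y hy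
  rw [hcy] at hks hgs
  obtain ⟨z, hz, hzg⟩ : g (𝒰.pr i₁ y) ∈ 𝒰.pr i₂ '' C := hd.source_eq ▸ hgs
  obtain ⟨a, rfl, rfl, rfl, rfl, hya⟩ := exists_coreBox hc hy
  obtain ⟨b, rfl, rfl, rfl, rfl, hzb⟩ := exists_coreBox hd hz
  obtain ⟨W, hW, hzW, hWb, hext⟩ := exists_holonomy_extension hS hS' b a (interior_subset hzb)
  have hW' : IsOpen (W ∩ 𝒰.pr b.left '' interior b.core) :=
    hW.inter (isOpen_image_pr isOpen_interior (interior_subset.trans b.core_subset_U))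
  obtain ⟨K, hK, hyK, hKg⟩ := exists_compact_subset (g.isOpen_inter_preimage hW')
    (x := 𝒰.pr a.left y) ⟨hks, by rw [mem_preimage, ← hzg]; exact ⟨hzW, z, hzb, rfl⟩⟩
  have hN := isOpen_subbasicOpen hK hW'
  have hV : IsOpen (a.map.target ∩ a.map.symm ⁻¹' interior K) :=
    a.map.symm.isOpen_inter_preimage isOpen_interior
  set V := a.map.target ∩ a.map.symm ⁻¹' interior K
  have hVsource : ∀ f ∈ subbasicOpen K (W ∩ 𝒰.pr b.left '' interior b.core),
      V ⊆ ((a.map.symm.trans f).trans b.map).source := fun f hf x hx =>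
    have hxK := interior_subset hx.2
    ⟨⟨hx.1, hf.1 hxK⟩, hWb (hf.2 hxK).1⟩
  refine ⟨V, hV, ⟨hs, by rwa [mem_preimage, hcy]⟩, _,
    hN.mem_nhds ⟨fun x hx => (hKg hx).1, fun x hx => (hKg hx).2⟩, fun f hf hfN =>
    ⟨hVsource f hfN, map_mem_starClosure
      (Φ := fun f => ((a.map.symm.trans f).trans b.map).restr V)
      ((continuous_restr V).comp (continuous_trans_trans _ _)) hN hf hfN ?_⟩⟩
  intro φ hφ _ hφN
  obtain ⟨hφW, z', hz', hz'φ⟩ := hφN.2 (interior_subset hyK)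
  obtain ⟨F, hF, hWF, hFφ⟩ := exists_leftInverse_boxMaps hS hext hφ (interior_subset hya)
    (hφN.1 (interior_subset hyK)) hφW ⟨z', interior_subset hz', hz'φ⟩
  have hKφ : interior K ⊆ φ.source := interior_subset.trans hφN.1
  have hφKW : MapsTo φ (interior K) W := fun x hx => (hφN.2 (interior_subset hx)).1
  refine ⟨restr_trans_mem_of_leftInverse hS'.isLocal hF isOpen_interior hKφ
    (hφKW.mono_right hWF) fun x hx => hFφ x (hKφ hx) (hφKW hx), ?_⟩
  rw [OpenPartialHomeomorph.restr_source' _ _ hV, OpenPartialHomeomorph.restr_source' _ _ hV,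
    inter_eq_right.2 (hVsource φ hφN), inter_eq_right.2 (hVsource f hfN)]

end RegularAtlas

section ContinuousConvergence

variable {Ω T T' : Type*} [TopologicalSpace T] [TopologicalSpace T'] {𝒱 : Filter Ω}

/-- Continuous convergence on `V` of the maps `F ω` to `ℓ` along `𝒱`: locally uniform convergence
to a continuous limit, in a form that needs no uniform structure on `T'`. -/
def TendstoContinuouslyOn (F : Ω → T → T') (ℓ : T → T') (𝒱 : Filter Ω) (V : Set T) : Prop :=
  ∀ y ∈ V, Tendsto (fun q : Ω × T => F q.1 q.2) (𝒱 ×ˢ 𝓝[V] y) (𝓝 (ℓ y))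

namespace TendstoContinuouslyOn

variable {F : Ω → T → T'} {ℓ : T → T'} {V : Set T}

theorem tendsto (h : TendstoContinuouslyOn F ℓ 𝒱 V) {y : T} (hy : y ∈ V) :
    Tendsto (fun ω => F ω y) 𝒱 (𝓝 (ℓ y)) :=
  (h y hy).comp (tendsto_id.prodMk (tendsto_const_pure.mono_right (pure_le_nhdsWithin hy)))

theorem continuousOn [RegularSpace T'] [𝒱.NeBot] (h : TendstoContinuouslyOn F ℓ 𝒱 V) :
    ContinuousOn ℓ V := by
  intro y hy O hO
  obtain ⟨C, hC, hCclosed, hCO⟩ := exists_mem_nhds_isClosed_subset hO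
  have hFC : ∀ᶠ z in 𝓝[V] y, ∀ᶠ ω in 𝒱, F ω z ∈ C :=
    (eventually_swap_iff.1 ((h y hy).eventually hC)).curry
  rw [mem_map]
  filter_upwards [hFC, self_mem_nhdsWithin] with z hz hzV
  exact hCO (hCclosed.mem_of_tendsto (h.tendsto hzV) hz)

theorem eventually_mapsTo (h : TendstoContinuouslyOn F ℓ 𝒱 V) {K : Set T} {O : Set T'}
    (hK : IsCompact K) (hKV : K ⊆ V) (hO : IsOpen O) (hKO : MapsTo ℓ K O) :
    ∀ᶠ ω in 𝒱, MapsTo (F ω) K O := by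
  refine hK.induction_on (p := fun K => ∀ᶠ ω in 𝒱, MapsTo (F ω) K O)
    (Eventually.of_forall fun _ => mapsTo_empty _ _) (fun _ _ hst ht => ht.mono fun _ => .mono_left
      (hs := hst)) (fun _ _ hs ht => (hs.and ht).mono fun _ hst => hst.1.union hst.2) fun y hy => ?_
  obtain ⟨pa, ha, pb, hb, hab⟩ :=
    eventually_prod_iff.1 ((h y (hKV hy)).eventually (hO.mem_nhds (hKO hy)))
  exact ⟨{z | pb z}, nhdsWithin_mono y hKV hb, ha.mono fun ω hω z hz => hab hω hz⟩

theorem leftInverse [T2Space T] [𝒱.NeBot] {G : Ω → T' → T} {m : T' → T} {W : Set T'}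
    (h : TendstoContinuouslyOn F ℓ 𝒱 V) (h' : TendstoContinuouslyOn G m 𝒱 W) (hW : IsOpen W)
    (hGF : ∀ ω, ∀ y ∈ V, F ω y ∈ W → G ω (F ω y) = y) {y : T} (hy : y ∈ V) (hyW : ℓ y ∈ W) :
    m (ℓ y) = y := by
  have hF : Tendsto (fun ω => (ω, F ω y)) 𝒱 (𝒱 ×ˢ 𝓝[W] ℓ y) := by
    rw [hW.nhdsWithin_eq hyW]
    exact tendsto_id.prodMk (h.tendsto hy)
  refine tendsto_nhds_unique ((h' (ℓ y) hyW).comp hF) (tendsto_const_nhds.congr' ?_)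
  filter_upwards [(h.tendsto hy).eventually (hW.mem_nhds hyW)] with ω hω
  exact (hGF ω y hy hω).symm

theorem mem_starClosure {S : Set (OpenPartialHomeomorph T T)} [𝒱.NeBot]
    {F : Ω → OpenPartialHomeomorph T T} {ℓ : T → T}
    (h : TendstoContinuouslyOn (fun ω => F ω) ℓ 𝒱 V) (hS : IsLocalPseudoStarGroup S)
    (hF : ∀ ω, F ω ∈ S) (hV : ∀ ω, V ⊆ (F ω).source) {a : OpenPartialHomeomorph T T}
    (haV : a.source ⊆ V) (ha : EqOn a ℓ a.source) : a ∈ starClosure S := by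
  have hsource : ∀ ω, ((F ω).restr a.source).source = a.source := fun ω => by
    rw [OpenPartialHomeomorph.restr_source' _ _ a.open_source]
    exact inter_eq_right.2 (haV.trans (hV ω))
  refine mem_closure_of_tendsto (f := fun ω => (F ω).restr a.source) (b := 𝒱) ?_
    (Eventually.of_forall fun ω => ⟨hS.restr_mem _ (hF ω) _ a.open_source, hsource ω⟩)
  refine TopologicalSpace.tendsto_nhds_generateFrom_iff.2 ?_
  rintro _ ⟨K, O, hK, hO, rfl⟩ ⟨hKa, hKO⟩
  filter_upwards [h.eventually_mapsTo hK (hKa.trans haV) hO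
    fun x hx => ha (hKa hx) ▸ hKO hx] with ω hω
  exact ⟨hKa.trans (hsource ω).symm.subset, hω⟩

end TendstoContinuouslyOn

end ContinuousConvergence

theorem exists_openPartialHomeomorph_of_leftInverse {T T' : Type*} [TopologicalSpace T]
    [TopologicalSpace T'] {f : T → T'} {g : T' → T} {V : Set T} {W : Set T'} (hV : IsOpen V)
    (hW : IsOpen W) (hf : ContinuousOn f V) (hg : ContinuousOn g W)
    (hgf : ∀ x ∈ V, f x ∈ W → g (f x) = x) (hfg : ∀ y ∈ W, g y ∈ V → f (g y) = y) :
    ∃ a : OpenPartialHomeomorph T T', a.source = V ∩ f ⁻¹' W ∧ a.target = W ∩ g ⁻¹' V ∧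
      ⇑a = f ∧ ⇑a.symm = g :=
  ⟨{ toFun := f
     invFun := g
     source := V ∩ f ⁻¹' W
     target := W ∩ g ⁻¹' V
     map_source' := fun x hx => ⟨hx.2, (congrArg (· ∈ V) (hgf x hx.1 hx.2)).mpr hx.1⟩
     map_target' := fun y hy => ⟨hy.2, (congrArg (· ∈ W) (hfg y hy.1 hy.2)).mpr hy.1⟩
     left_inv' := fun x hx => hgf x hx.1 hx.2
     right_inv' := fun y hy => hfg y hy.1 hy.2
     open_source := hf.isOpen_inter_preimage hV hW
     open_target := hg.isOpen_inter_preimage hW hV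
     continuousOn_toFun := hf.mono inter_subset_left
     continuousOn_invFun := hg.mono inter_subset_left }, rfl, rfl, rfl, rfl⟩

section ArzelaAscoli

variable {T : Type u} [TopologicalSpace T] {S : Set (OpenPartialHomeomorph T T)}

theorem exists_tendstoContinuouslyOn {Ω : Type*} {Q : QuasiLocalMetric T}
    (hQ : Q.IsEquicontinuousFamily S) (𝒱 : Ultrafilter Ω) {F : Ω → OpenPartialHomeomorph T T}
    (hF : ∀ ω, F ω ∈ S) {V C : Set T} (hV : ∀ ω, V ⊆ (F ω).source) (hC : IsCompact C)
    (hVC : ∀ ω, MapsTo (F ω) V C) {i j : Q.ι} (hVi : V ⊆ Q.dom i) (hCj : C ⊆ Q.dom j) :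
    ∃ ℓ : T → T, TendstoContinuouslyOn (fun ω => F ω) ℓ 𝒱 V := by
  have hlim : ∀ y : T, ∃ z, y ∈ V → z ∈ C ∧ Tendsto (fun ω => F ω y) 𝒱 (𝓝 z) := by
    intro y
    by_cases hy : y ∈ V
    · obtain ⟨z, hz, hlim⟩ := hC.ultrafilter_le_nhds (𝒱.map fun ω => F ω y)
        (le_principal_iff.2 (mem_map.2 (univ_mem' fun ω => hVC ω hy)))
      exact ⟨z, fun _ => ⟨hz, hlim⟩⟩
    · exact ⟨y, fun h => absurd h hy⟩
  choose ℓ hℓ using hlim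
  refine ⟨ℓ, fun y hy O hO => ?_⟩
  obtain ⟨hyC, hlim⟩ := hℓ y hy
  obtain ⟨ε, hε, hball⟩ := Q.exists_dist_lt_mem j (K := {ℓ y}) isCompact_singleton
    (isOpen_interior (s := O)) (singleton_subset_iff.2 (hCj hyC))
    (singleton_subset_iff.2 (mem_interior_iff_mem_nhds.2 hO))
  obtain ⟨δ, hδ, hequi⟩ := hQ (ε / 2) (half_pos hε)
  obtain ⟨N, hN, hyN, _, hNδ⟩ := Q.exists_nhds_dist_lt i (hVi hy) hδ
  obtain ⟨M, hM, hyM, _, hMε⟩ := Q.exists_nhds_dist_lt j (hCj hyC) (half_pos hε)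
  rw [mem_map]
  filter_upwards [(hlim.eventually (hM.mem_nhds hyM)).prod_mk
    (inter_mem (mem_nhdsWithin_of_mem_nhds (hN.mem_nhds hyN)) self_mem_nhdsWithin)]
    with ⟨ω, z⟩ ⟨hω, hzN, hzV⟩
  have hzj := hCj (hVC ω hzV)
  refine interior_subset (s := O) (hball (ℓ y) rfl (F ω z) hzj ?_)
  calc (Q.metric j).dist ⟨ℓ y, hCj hyC⟩ ⟨F ω z, hzj⟩
      ≤ (Q.metric j).dist ⟨ℓ y, hCj hyC⟩ ⟨F ω y, hCj (hVC ω hy)⟩ +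
        (Q.metric j).dist ⟨F ω y, hCj (hVC ω hy)⟩ ⟨F ω z, hzj⟩ := (Q.metric j).dist_triangle _ _ _
    _ < ε / 2 + ε / 2 := add_lt_add (hMε (ℓ y) hyM (F ω y) hω)
        (hequi (F ω) (hF ω) i j y z (hVi hy) (hVi hzV) _ hzj (hV ω hy) (hV ω hzV)
          (hNδ y hyN z hzN))
    _ = ε := add_halves ε

/-- `f ∈ S` is defined on `V`, maps it to `D`, and has inverse `g` at the points that it maps to
`W`. In the Arzelà–Ascoli argument this keeps both `f` and its inverse on fixed domains. -/
structure IsInvertedOn (S : Set (OpenPartialHomeomorph T T)) (V W D : Set T)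
    (f g : OpenPartialHomeomorph T T) : Prop where
  mem : f ∈ S
  subset_source : V ⊆ f.source
  mapsTo : MapsTo f V D
  apply_apply : ∀ y ∈ V, f y ∈ W → g (f y) = y

theorem exists_mem_starClosure_of_forall_nhds [T3Space T] (hS : IsLocalPseudoStarGroup S)
    {Q : QuasiLocalMetric T} (hQ : Q.IsEquicontinuousFamily S) {V W C D : Set T} (hV : IsOpen V)
    (hW : IsOpen W) (hC : IsCompact C) (hD : IsCompact D) {i j : Q.ι} (hVi : V ⊆ Q.dom i)
    (hCi : C ⊆ Q.dom i) (hWj : W ⊆ Q.dom j) (hDj : D ⊆ Q.dom j) {t t' : T} (ht : t ∈ V)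
    (ht' : t' ∈ W)
    (h : ∀ O ∈ 𝓝 t', ∃ f g, IsInvertedOn S V W D f g ∧ IsInvertedOn S W V C g f ∧ f t ∈ O) :
    ∃ a ∈ starClosure S, a.symm ∈ starClosure S ∧ t ∈ a.source ∧ a t = t' := by
  let Ω := {ω : OpenPartialHomeomorph T T × OpenPartialHomeomorph T T //
    IsInvertedOn S V W D ω.1 ω.2 ∧ IsInvertedOn S W V C ω.2 ω.1}
  have hne : (comap (fun ω : Ω => ω.1.1 t) (𝓝 t')).NeBot :=
    comap_neBot_iff.2 fun O hO =>
      let ⟨f, g, hf, hg, hfO⟩ := h O hO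
      ⟨⟨(f, g), hf, hg⟩, hfO⟩
  let 𝒱 : Ultrafilter Ω := Ultrafilter.of (comap (fun ω : Ω => ω.1.1 t) (𝓝 t'))
  have h𝒱 : Tendsto (fun ω : Ω => ω.1.1 t) 𝒱 (𝓝 t') :=
    tendsto_comap.mono_left (Ultrafilter.of_le _)
  obtain ⟨ℓ, hℓ⟩ := exists_tendstoContinuouslyOn hQ 𝒱 (fun ω => ω.2.1.mem)
    (fun ω => ω.2.1.subset_source) hD (fun ω => ω.2.1.mapsTo) hVi hDj
  obtain ⟨m, hm⟩ := exists_tendstoContinuouslyOn hQ 𝒱 (fun ω => ω.2.2.mem)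
    (fun ω => ω.2.2.subset_source) hC (fun ω => ω.2.2.mapsTo) hWj hCi
  have hmℓ : ∀ y ∈ V, ℓ y ∈ W → m (ℓ y) = y := fun _ =>
    hℓ.leftInverse hm hW fun ω => ω.2.1.apply_apply
  have hℓm : ∀ y ∈ W, m y ∈ V → ℓ (m y) = y := fun _ =>
    hm.leftInverse hℓ hV fun ω => ω.2.2.apply_apply
  obtain ⟨a, hasource, hatarget, hal, ham⟩ := exists_openPartialHomeomorph_of_leftInverse hV hW
    hℓ.continuousOn hm.continuousOn hmℓ hℓm
  have hℓt : ℓ t = t' := tendsto_nhds_unique (hℓ.tendsto ht) h𝒱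
  refine ⟨a, ?_, ?_, hasource ▸ ⟨ht, by rwa [mem_preimage, hℓt]⟩, (congrFun hal t).trans hℓt⟩
  · exact hℓ.mem_starClosure hS (fun ω => ω.2.1.mem) (fun ω => ω.2.1.subset_source)
      (hasource ▸ inter_subset_left) fun x _ => congrFun hal x
  · exact hm.mem_starClosure hS (fun ω => ω.2.2.mem) (fun ω => ω.2.2.subset_source)
      (a := a.symm) (hatarget ▸ inter_subset_left : a.target ⊆ W) fun x _ => congrFun ham x

end ArzelaAscoli

theorem rel_of_mem_leaf {X : Type*} [TopologicalSpace X] {Ps : Set (Set X)} {R : X → X → Prop}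
    (hplaque : ∀ x, ∃ P ∈ Ps, x ∈ P ∧ ∀ y ∈ P, R x y)
    (htrans : ∀ x y z, R x y → R y z → R x z) (hsymm : ∀ x y, R x y → R y x) {x y : X}
    (hxy : y ∈ leaf Ps x) : R x y := by
  refine @IsPreconnected.induction₂ X (leafTopology Ps) (leaf Ps x)
    (@isPreconnected_connectedComponent X (leafTopology Ps) x) R (fun z _ => ?_)
    (fun x y z _ _ _ => htrans x y z) (fun x y _ _ => hsymm x y) x y
    (@mem_connectedComponent X (leafTopology Ps) x) hxy
  obtain ⟨P, hP, hzP, hR⟩ := hplaque z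
  have hPopen : IsOpen[leafTopology Ps] P :=
    TopologicalSpace.isOpen_generateFrom_of_mem ⟨P, hP, univ, isOpen_univ, (inter_univ P).symm⟩
  exact @mem_nhdsWithin_of_mem_nhds X (leafTopology Ps) _ _ _ (mem_of_superset
    (@IsOpen.mem_nhds X (leafTopology Ps) _ _ hPopen hzP) hR)

namespace RegularAtlas

variable {n : ℕ} {X : Type u} {Z : Type v} [TopologicalSpace X] [TopologicalSpace Z]
  {ℱ : FoliatedStructure n X Z} {ι : Type w} {𝒰 : RegularAtlas ℱ ι}

variable (𝒰) in
/-- `t` and `t'` are in the same orbit of the holonomy pseudogroup. -/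
def SameOrbit (t t' : 𝒰.Transversal) : Prop :=
  ∃ f ∈ 𝒰.holonomyPseudogroup, t ∈ f.source ∧ f t = t'

namespace SameOrbit

variable {t t' t'' : 𝒰.Transversal}

theorem symm (h : 𝒰.SameOrbit t t') : 𝒰.SameOrbit t' t := by
  obtain ⟨f, hf, ht, rfl⟩ := h
  exact ⟨f.symm, symm_mem_holonomyPseudogroup hf, f.map_source ht, f.left_inv ht⟩

theorem trans (h : 𝒰.SameOrbit t t') (h' : 𝒰.SameOrbit t' t'') : 𝒰.SameOrbit t t'' := by
  obtain ⟨f, hf, ht, rfl⟩ := h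
  obtain ⟨g, hg, ht', rfl⟩ := h'
  exact ⟨f.trans g, fun H hH => hH.1.trans_mem f (hf H hH) g (hg H hH), ⟨ht, ht'⟩, rfl⟩

end SameOrbit

variable [Nonempty 𝒰.Transversal]

theorem sameOrbit_pr {i j : ι} {x : X} (hi : x ∈ 𝒰.U i) (hj : x ∈ 𝒰.U j) :
    𝒰.SameOrbit (𝒰.pr i x) (𝒰.pr j x) :=
  ⟨𝒰.hol i j, hol_mem_holonomyPseudogroup 𝒰 i j, pr_mem_hol_source hi hj, hol_pr hi hj⟩

theorem sameOrbit_of_mem_leaf {x y : X} (hxy : y ∈ leaf ℱ.plaques x) {i j : ι}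
    (hi : x ∈ 𝒰.U i) (hj : y ∈ 𝒰.U j) : 𝒰.SameOrbit (𝒰.pr i x) (𝒰.pr j y) := by
  let R : X → X → Prop := fun x y => ∀ i j, x ∈ 𝒰.U i → y ∈ 𝒰.U j →
    𝒰.SameOrbit (𝒰.pr i x) (𝒰.pr j y)
  suffices hR : R x y from hR i j hi hj
  refine rel_of_mem_leaf (fun x => ?_) (fun x y z hxy hyz i j hi hj => ?_)
    (fun x y hxy i j hi hj => (hxy j i hj hi).symm) hxy
  · obtain ⟨k, hk⟩ := 𝒰.cover x
    refine ⟨_, ⟨_, 𝒰.chart_mem k, (𝒰.chart k).proj ⟨x, hk⟩, rfl⟩,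
      FoliatedChart.mem_plaque_iff.2 ⟨hk, rfl⟩, fun y hy i j hi hj => ?_⟩
    obtain ⟨hyk, hyx⟩ := FoliatedChart.mem_plaque_iff.1 hy
    exact (sameOrbit_pr hi hk).trans ((pr_eq_iff hk hyk).2 hyx.symm ▸ sameOrbit_pr hyk hj)
  · obtain ⟨k, hk⟩ := 𝒰.cover y
    exact (hxy i k hi hk).trans (hyz k j hk hj)

theorem exists_sameOrbit_mem_nhds (hmin : ℱ.IsMinimal) (t t' : 𝒰.Transversal)
    {O : Set 𝒰.Transversal} (hO : O ∈ 𝓝 t') : ∃ s ∈ O, 𝒰.SameOrbit t s := by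
  obtain ⟨x, hx, hxt⟩ := exists_pr_eq t
  obtain ⟨y, hy, hyt⟩ := exists_pr_eq t'
  have hOy : 𝒰.pr t'.1 ⁻¹' O ∩ 𝒰.U t'.1 ∈ 𝓝 y :=
    inter_mem ((continuousAt_pr hy).preimage_mem_nhds (by rwa [hyt])) ((isOpen_U _).mem_nhds hy)
  obtain ⟨z, hzleaf, hzO, hzU⟩ := (hmin x).inter_nhds_nonempty hOy
  exact ⟨_, hzO, by simpa only [hxt] using sameOrbit_of_mem_leaf hzleaf hx hzU⟩

variable {S : Set (OpenPartialHomeomorph 𝒰.Transversal 𝒰.Transversal)}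

theorem exists_coreBox_of_mem_nhds [LocallyCompactSpace X] {t : 𝒰.Transversal}
    {O : Set 𝒰.Transversal} (hO : O ∈ 𝓝 t) :
    ∃ (a : CoreBox 𝒰 𝒰) (x : X), x ∈ interior a.core ∧ 𝒰.pr a.left x = t ∧ a.map.source ⊆ O := by
  obtain ⟨x, hx, hxt⟩ := exists_pr_eq t
  obtain ⟨c, B, hB, hxB, hBO⟩ := exists_isBox 𝒰 𝒰 hx hx (O := 𝒰.pr t.1 ⁻¹' O)
    ((continuousAt_pr hx).preimage_mem_nhds (by rwa [hxt]))
  obtain ⟨a, ha, -, rfl, rfl, hxa⟩ := exists_coreBox hB hxB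
  exact ⟨a, x, hxa, ha ▸ hxt, hB.source_eq ▸ image_subset_iff.2 hBO⟩

theorem exists_isInvertedOn_of_extension (hS : IsAdmissible 𝒰.holonomyPseudogroup S)
    {a b : CoreBox 𝒰 𝒰} {V W : Set 𝒰.Transversal}
    (hV : ∀ f ∈ 𝒰.holonomyPseudogroup, ∀ s ∈ V, s ∈ f.source → s ∈ 𝒰.pr a.left '' a.core →
      f s ∈ 𝒰.pr b.left '' b.core → ∃ g ∈ boxMaps S S a b, V ⊆ g.source ∧ g =ᶠ[𝓝 s] f)
    (hW : ∀ f ∈ 𝒰.holonomyPseudogroup, ∀ s ∈ W, s ∈ f.source → s ∈ 𝒰.pr b.left '' b.core →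
      f s ∈ 𝒰.pr a.left '' a.core → ∃ g ∈ boxMaps S S b a, W ⊆ g.source ∧ g =ᶠ[𝓝 s] f)
    {t s : 𝒰.Transversal} (hts : 𝒰.SameOrbit t s) (htV : t ∈ V) (hsW : s ∈ W)
    (hta : t ∈ 𝒰.pr a.left '' a.core) (hsb : s ∈ 𝒰.pr b.left '' b.core) :
    ∃ f g, IsInvertedOn S V W b.map.source f g ∧ IsInvertedOn S W V a.map.source g f ∧
      f t = s := by
  obtain ⟨h, hh, hth, rfl⟩ := hts
  obtain ⟨f, ⟨hf, -, hfb, -⟩, hVf, hfh⟩ := hV h hh t htV hth hta hsb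
  obtain ⟨g, ⟨hg, -, hga, -⟩, hWg, hgh⟩ := hW h.symm (symm_mem_holonomyPseudogroup hh) _ hsW
    (h.map_source hth) hsb (by rwa [h.left_inv hth])
  have hfh' : f =ᶠ[𝓝 (h.symm (h t))] h.symm.symm := by rwa [h.left_inv hth]
  refine ⟨f, g, ⟨hf, hVf, fun x hx => hfb (f.map_source (hVf hx)), fun x hx hxW => ?_⟩,
    ⟨hg, hWg, fun x hx => hga (g.map_source (hWg hx)), fun x hx hxV => ?_⟩, hfh.self_of_nhds⟩
  · exact hS.quasiAnalytic.apply_apply_of_eventuallyEq hS.isLocal hf hg hth (hVf htV) (hWg hsW)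
      hfh hgh (hVf hx) (hWg hxW)
  · exact hS.quasiAnalytic.apply_apply_of_eventuallyEq hS.isLocal hg hf (h.map_source hth)
      (hWg hsW) (by rw [h.left_inv hth]; exact hVf htV) hgh hfh' (hWg hx) (hVf hxV)

theorem exists_mem_starClosure_apply_eq [CompactSpace X] [T2Space X] (hmin : ℱ.IsMinimal)
    (hS : IsAdmissible 𝒰.holonomyPseudogroup S) (t t' : 𝒰.Transversal) :
    ∃ a ∈ starClosure S, a.symm ∈ starClosure S ∧ t ∈ a.source ∧ a t = t' := by
  obtain ⟨Q, hQ⟩ := hS.equicontinuous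
  obtain ⟨i, hi⟩ := Q.cover t
  obtain ⟨j, hj⟩ := Q.cover t'
  obtain ⟨C, hC, htC, hCi⟩ := exists_compact_subset (Q.isOpen_dom i) hi
  obtain ⟨D, hD, htD, hDj⟩ := exists_compact_subset (Q.isOpen_dom j) hj
  obtain ⟨a, x, hx, rfl, haC⟩ := exists_coreBox_of_mem_nhds (mem_interior_iff_mem_nhds.1 htC)
  obtain ⟨b, y, hy, rfl, hbD⟩ := exists_coreBox_of_mem_nhds (mem_interior_iff_mem_nhds.1 htD)
  obtain ⟨V, hV, hxV, hVa, hVext⟩ := exists_holonomy_extension hS hS a b (interior_subset hx)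
  obtain ⟨W, hW, hyW, hWb, hWext⟩ := exists_holonomy_extension hS hS b a (interior_subset hy)
  refine exists_mem_starClosure_of_forall_nhds hS.isLocal hQ hV hW hC hD
    (hVa.trans (haC.trans hCi)) hCi (hWb.trans (hbD.trans hDj)) hDj hxV hyW fun O hO => ?_
  obtain ⟨s, ⟨⟨hsO, hsW⟩, z, hz, rfl⟩, hs⟩ := exists_sameOrbit_mem_nhds hmin (𝒰.pr a.left x) _
    (inter_mem (inter_mem hO (hW.mem_nhds hyW))
      (image_pr_mem_nhds (b.core_subset_U (interior_subset hy)) (isOpen_interior.mem_nhds hy)))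
  obtain ⟨f, g, hf, hg, hfs⟩ := exists_isInvertedOn_of_extension hS hVext hWext hs hxV hsW
    ⟨x, interior_subset hx, rfl⟩ ⟨z, interior_subset hz, rfl⟩
  exact ⟨f, g, { hf with mapsTo := hf.mapsTo.mono_right hbD },
    { hg with mapsTo := hg.mapsTo.mono_right haC }, hfs ▸ hsO⟩

end RegularAtlas

section GermConj

theorem sigma_germ_eq_iff {T T' : Type*} [TopologicalSpace T] {x y : T} {f g : T → T'} :
    (⟨x, (f : Germ (𝓝 x) T')⟩ : Σ x : T, Germ (𝓝 x) T') = ⟨y, (g : Germ (𝓝 y) T')⟩ ↔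
      x = y ∧ f =ᶠ[𝓝 x] g := by
  constructor
  · intro h
    obtain ⟨rfl, h⟩ := Sigma.mk.inj_iff.1 h
    exact ⟨rfl, Germ.coe_eq.1 (eq_of_heq h)⟩
  · rintro ⟨rfl, h⟩
    exact congrArg (Sigma.mk x) (Germ.coe_eq.2 h)

variable {T T' : Type*} [TopologicalSpace T'] [TopologicalSpace T]

/-- `γ'` is the germ `l γ k`, the germ `γ` of a self-map of `T` being composable with `k` and
`l`. -/
def GermConj (k : OpenPartialHomeomorph T' T) (l : OpenPartialHomeomorph T T')
    (γ : Σ x : T, Germ (𝓝 x) T) (γ' : Σ x : T', Germ (𝓝 x) T') : Prop :=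
  ∃ (g : T → T) (s : T'), s ∈ k.source ∧ g (k s) ∈ l.source ∧
    γ = ⟨k s, (g : Germ (𝓝 (k s)) T)⟩ ∧ γ' = ⟨s, ((l ∘ g ∘ k : T' → T') : Germ (𝓝 s) T')⟩

variable {k : OpenPartialHomeomorph T' T} {l : OpenPartialHomeomorph T T'}

namespace GermConj

variable {γ : Σ x : T, Germ (𝓝 x) T} {γ' γ₁ γ₂ : Σ x : T', Germ (𝓝 x) T'}

theorem unique (h₁ : GermConj k l γ γ₁) (h₂ : GermConj k l γ γ₂) : γ₁ = γ₂ := by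
  obtain ⟨g₁, s₁, hs₁, -, rfl, rfl⟩ := h₁
  obtain ⟨g₂, s₂, hs₂, -, hγ, rfl⟩ := h₂
  obtain ⟨hs, hg⟩ := sigma_germ_eq_iff.1 hγ
  obtain rfl := k.injOn hs₁ hs₂ hs
  refine sigma_germ_eq_iff.2 ⟨rfl, ?_⟩
  filter_upwards [(k.continuousAt hs₁).eventually hg] with t ht
  exact congrArg l ht

theorem composable (h : GermConj k l γ γ') : γ.1 ∈ k.target ∧ γ.2.value ∈ l.source := by
  obtain ⟨g, s, hs, hgs, rfl, rfl⟩ := h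
  exact ⟨k.map_source hs, hgs⟩

theorem fst_eq (h : GermConj k l γ γ') : γ'.1 = k.symm γ.1 := by
  obtain ⟨g, s, hs, -, rfl, rfl⟩ := h
  exact (k.left_inv hs).symm

theorem value_eq (h : GermConj k l γ γ') : γ'.2.value = l γ.2.value := by
  obtain ⟨g, s, -, -, rfl, rfl⟩ := h
  rfl

end GermConj

theorem germConj_germ {f : OpenPartialHomeomorph T T} {y : T} (hy : y ∈ k.target)
    (hfy : f y ∈ l.source) (V : Set T') :
    GermConj k l (germ f y) (germ (((k.trans f).trans l).restr V) (k.symm y)) :=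
  ⟨f, k.symm y, k.map_target hy, by rwa [k.right_inv hy],
    sigma_germ_eq_iff.2 ⟨(k.right_inv hy).symm, EventuallyEq.rfl⟩, rfl⟩

variable {S : Set (OpenPartialHomeomorph T T)} {S' : Set (OpenPartialHomeomorph T' T')}

theorem germMap_surjective : Function.Surjective (germMap S) := by
  rintro ⟨γ, g, hg, x, hx, rfl⟩
  obtain ⟨O, hO, hxO, -, hgO⟩ := hg x hx
  exact ⟨⟨(_, x), hgO, (mem_restr_source hO).2 ⟨hx, hxO⟩⟩, rfl⟩

theorem continuous_germMap : Continuous (germMap S) :=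
  continuous_coinduced_rng

namespace Transports

theorem exists_local_lift (h : Transports S S' k l) (q₀ : StarPairs S) (hk : q₀.1.2 ∈ k.target)
    (hl : q₀.1.1 q₀.1.2 ∈ l.source) :
    ∃ W : Set (StarPairs S), IsOpen W ∧ q₀ ∈ W ∧ ∃ Θ : W → StarPairs S', Continuous Θ ∧
      ∀ q, GermConj k l (germMap S q.1).1 (germMap S' (Θ q)).1 := by
  obtain ⟨⟨f, y⟩, hf, hy⟩ := q₀
  have hky : k (k.symm y) = y := k.right_inv hk
  obtain ⟨V, hV, hyV, N, hN, hVN⟩ := h f hf (k.symm y) (k.map_target hk) (by rwa [hky])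
    (by rwa [hky])
  let W : Set (StarPairs S) := {q | q.1.1 ∈ interior N ∧ q.1.2 ∈ k.target ∩ k.symm ⁻¹' V}
  have hW : IsOpen W :=
    (isOpen_interior.preimage (continuous_fst.comp continuous_subtype_val)).inter
      ((k.symm.isOpen_inter_preimage hV).preimage (continuous_snd.comp continuous_subtype_val))
  have hVW (q : W) := hVN q.1.1.1 q.1.2.1 (interior_subset q.2.1)
  let Θ : W → StarPairs S' := fun q =>
    ⟨(((k.trans q.1.1.1).trans l).restr V, k.symm q.1.1.2), (hVW q).2,
      (mem_restr_source hV).2 ⟨(hVW q).1 q.2.2.2, q.2.2.2⟩⟩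
  have hΘ : Continuous Θ := by
    refine Continuous.subtype_mk (Continuous.prodMk ?_ ?_) _
    · exact ((continuous_restr V).comp (continuous_trans_trans k l)).comp
        (continuous_fst.comp (continuous_subtype_val.comp continuous_subtype_val))
    · exact k.symm.continuousOn.comp_continuous
        (continuous_snd.comp (continuous_subtype_val.comp continuous_subtype_val))
        fun q => q.2.2.1
  refine ⟨W, hW, ⟨mem_interior_iff_mem_nhds.2 hN, hk, hyV⟩, Θ, hΘ, fun q =>
    germConj_germ q.2.2.1 ?_ V⟩
  have hql : q.1.1.1 (k (k.symm q.1.1.2)) ∈ l.source := ((hVW q).1 q.2.2.2).2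
  rwa [k.right_inv q.2.2.1] at hql

theorem exists_continuous_germConj (h : Transports S S' k l) :
    ∃ Φ : {γ : That S // γ.1.1 ∈ k.target ∧ γ.1.2.value ∈ l.source} → That S',
      Continuous Φ ∧ ∀ γ, GermConj k l γ.1.1 (Φ γ).1 := by
  have hex : ∀ γ : {γ : That S // γ.1.1 ∈ k.target ∧ γ.1.2.value ∈ l.source},
      ∃ γ' : That S', GermConj k l γ.1.1 γ'.1 := by
    rintro ⟨γ, hγ⟩
    obtain ⟨q, rfl⟩ := germMap_surjective γ
    obtain ⟨W, -, hqW, Θ, -, hΘ⟩ := h.exists_local_lift q hγ.1 hγ.2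
    exact ⟨_, hΘ ⟨q, hqW⟩⟩
  choose Φ hΦ using hex
  refine ⟨Φ, continuous_def.2 fun A hA => ?_, hΦ⟩
  suffices hU : IsOpen {γ : That S | ∃ hγ : γ.1.1 ∈ k.target ∧ γ.1.2.value ∈ l.source,
      Φ ⟨γ, hγ⟩ ∈ A} by
    convert hU.preimage continuous_subtype_val using 1
    ext γ
    exact ⟨fun h => ⟨γ.2, h⟩, fun ⟨_, h⟩ => h⟩
  refine isOpen_coinduced.2 (isOpen_iff_mem_nhds.2 ?_)
  rintro q₀ ⟨hq₀, hq₀A⟩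
  obtain ⟨W, hW, hq₀W, Θ, hΘ, hΘconj⟩ := h.exists_local_lift q₀ hq₀.1 hq₀.2
  have hΦΘ : ∀ q : W, Φ ⟨germMap S q.1, (hΘconj q).composable⟩ = germMap S' (Θ q) := fun q =>
    Subtype.ext ((hΦ _).unique (hΘconj q))
  refine mem_of_superset ((hW.isOpenMap_subtype_val _
    (hA.preimage (continuous_germMap.comp hΘ))).mem_nhds ⟨⟨q₀, hq₀W⟩, ?_, rfl⟩) ?_
  · exact mem_preimage.2 (mem_of_eq_of_mem (hΦΘ ⟨q₀, hq₀W⟩).symm hq₀A)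
  · rintro _ ⟨q, hq, rfl⟩
    exact ⟨(hΘconj q).composable, mem_of_eq_of_mem (hΦΘ q) hq⟩

end Transports

end GermConj

section LeafTopology

variable {X Y : Type*} [TopologicalSpace X] [TopologicalSpace Y]

theorem IsOpenIn.image {A P : Set X} (h : IsOpenIn A P) (F : X ≃ₜ Y) :
    IsOpenIn (F '' A) (F '' P) := by
  obtain ⟨O, hO, rfl⟩ := h
  exact ⟨F '' O, F.isOpenMap O hO, image_inter F.injective⟩

theorem isOpenIn_of_forall {A P : Set X} (hAP : A ⊆ P)
    (h : ∀ x ∈ A, ∃ O, IsOpen O ∧ x ∈ O ∧ P ∩ O ⊆ A) : IsOpenIn A P := by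
  choose! O hO hxO hOA using h
  refine ⟨⋃ x ∈ A, O x, isOpen_biUnion hO, Subset.antisymm
    (fun x hx => ⟨hAP hx, mem_biUnion hx (hxO x hx)⟩) ?_⟩
  rintro y ⟨hyP, hy⟩
  obtain ⟨x, hx, hyx⟩ := mem_iUnion₂.1 hy
  exact hOA x hx ⟨hyP, hyx⟩

variable {Ps : Set (Set X)} {Qs : Set (Set Y)} {F : X ≃ₜ Y}

theorem continuous_leafTopology (hPs : ∀ x, ∃ P ∈ Ps, x ∈ P)
    (hPQ : ∀ P ∈ Ps, ∀ Q ∈ Qs, IsOpenIn (F '' P ∩ Q) (F '' P)) :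
    @Continuous X Y (leafTopology Ps) (leafTopology Qs) F := by
  refine (@continuous_generateFrom_iff X Y F (leafTopology Ps) _).2 ?_
  rintro _ ⟨Q, hQ, O, hO, rfl⟩
  refine (@isOpen_iff_forall_mem_open X (leafTopology Ps) _).2 ?_
  rintro x ⟨hxQ, hxO⟩
  obtain ⟨P, hP, hxP⟩ := hPs x
  obtain ⟨O', hO', hFP⟩ := hPQ P hP Q hQ
  have hxO' : F x ∈ F '' P ∩ O' := hFP ▸ ⟨⟨x, hxP, rfl⟩, hxQ⟩
  refine ⟨P ∩ F ⁻¹' (O' ∩ O), ?_, TopologicalSpace.isOpen_generateFrom_of_mem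
    ⟨P, hP, _, (hO'.inter hO).preimage F.continuous, rfl⟩, hxP, hxO'.2, hxO⟩
  rintro y ⟨hyP, hyO', hyO⟩
  have hyQ : F y ∈ F '' P ∩ Q := hFP ▸ ⟨⟨y, hyP, rfl⟩, hyO'⟩
  exact ⟨hyQ.2, hyO⟩

theorem image_leaf_subset (hF : @Continuous X Y (leafTopology Ps) (leafTopology Qs) F) (x : X) :
    F '' leaf Ps x ⊆ leaf Qs (F x) :=
  @Continuous.image_connectedComponent_subset X Y (leafTopology Ps) (leafTopology Qs) F hF x

theorem isFoliatedHomeomorph_of_coherent (hPs : ∀ x, ∃ P ∈ Ps, x ∈ P)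
    (hQs : ∀ y, ∃ Q ∈ Qs, y ∈ Q)
    (hPQ : ∀ P ∈ Ps, ∀ Q ∈ Qs, IsOpenIn (F '' P ∩ Q) (F '' P) ∧ IsOpenIn (F '' P ∩ Q) Q) :
    IsFoliatedHomeomorph Ps Qs F := by
  have hF := continuous_leafTopology hPs fun P hP Q hQ => (hPQ P hP Q hQ).1
  have hFsymm := continuous_leafTopology (F := F.symm) (Qs := Ps) hQs fun Q hQ P hP => by
    have hQP := (hPQ P hP Q hQ).2.image F.symm
    rwa [image_inter F.symm.injective, ← image_comp, F.symm_comp_self, image_id,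
      inter_comm] at hQP
  refine ⟨fun x => (image_leaf_subset hF x).antisymm fun y hy => ?_, hPQ⟩
  have hyx := image_leaf_subset hFsymm (F x) (mem_image_of_mem _ hy)
  rw [F.symm_apply_apply] at hyx
  exact ⟨F.symm y, hyx, F.apply_symm_apply y⟩

end LeafTopology

/-- The germ of `l ∘ ψ` for a germ of `ψ`. -/
def mapGerm {X T T' : Type*} [TopologicalSpace X] (l : T → T') (γ : Σ x : X, Germ (𝓝 x) T) :
    Σ x : X, Germ (𝓝 x) T' :=
  ⟨γ.1, γ.2.map l⟩

namespace RegularAtlas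

variable {n : ℕ} {X : Type u} {Z : Type v} [TopologicalSpace X] [TopologicalSpace Z]
  {ℱ : FoliatedStructure n X Z} {ι : Type w} {𝒰 : RegularAtlas ℱ ι}
  {S : Set (OpenPartialHomeomorph 𝒰.Transversal 𝒰.Transversal)} {t₀ : 𝒰.Transversal}

namespace XTilde

theorem continuous_point : Continuous fun q : 𝒰.XTilde S t₀ => (q.1.2.1 : X) := by
  have h : Continuous fun q : Σ i, 𝒰.U i × That₀ S t₀ => (q.2.1 : X) :=
    continuous_sigma fun i => continuous_subtype_val.comp continuous_fst
  exact h.comp continuous_subtype_val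

theorem continuous_germ : Continuous fun q : 𝒰.XTilde S t₀ => q.1.2.2.1 := by
  have h : Continuous fun q : Σ i, 𝒰.U i × That₀ S t₀ => q.2.2.1 :=
    continuous_sigma fun i => continuous_subtype_val.comp continuous_snd
  exact h.comp continuous_subtype_val

end XTilde

theorem continuous_piHat : Continuous (𝒰.piHat S t₀) :=
  continuous_quot_lift _ XTilde.continuous_point

variable [Nonempty 𝒰.Transversal]

namespace XTilde

theorem pr_eq_source (q : 𝒰.XTilde S t₀) : 𝒰.pr q.1.1 q.1.2.1 = q.1.2.2.source :=
  (pr_coe _ _).trans q.2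

theorem tendsto_pr (q : 𝒰.XTilde S t₀) :
    Tendsto (𝒰.pr q.1.1) (𝓝 (q.1.2.1 : X)) (𝓝 q.1.2.2.source) :=
  q.pr_eq_source ▸ (continuousAt_pr q.1.2.1.2).tendsto

theorem exists_germ_eq (q : 𝒰.XTilde S t₀) : ∃ g ∈ closurePseudogroup S,
    q.1.2.2.1.1 = germ g (𝒰.pr q.1.1 q.1.2.1) ∧ 𝒰.pr q.1.1 q.1.2.1 ∈ g.source ∧
      g (𝒰.pr q.1.1 q.1.2.1) = t₀ := by
  obtain ⟨g, hg, t, ht, hq⟩ := q.1.2.2.1.2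
  obtain rfl : 𝒰.pr q.1.1 q.1.2.1 = t := q.pr_eq_source.trans (congrArg Sigma.fst hq)
  have hval := q.1.2.2.2
  rw [hq] at hval
  exact ⟨g, hg, hq, ht, hval⟩

/-- The germ at `x` of `g ∘ p_i`, for a triple `(x, γ, i)` with `γ` the germ of `g`. It determines
the class `[x, γ, i]` without reference to the index `i`. -/
noncomputable def toGerm (q : 𝒰.XTilde S t₀) : Σ x : X, Germ (𝓝 x) 𝒰.Transversal :=
  ⟨q.1.2.1, q.1.2.2.1.1.2.compTendsto (𝒰.pr q.1.1) q.tendsto_pr⟩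

theorem toGerm_eq (q : 𝒰.XTilde S t₀) {g : 𝒰.Transversal → 𝒰.Transversal}
    {t : 𝒰.Transversal} (hq : q.1.2.2.1.1 = ⟨t, (g : Germ (𝓝 t) 𝒰.Transversal)⟩) :
    q.toGerm = ⟨q.1.2.1, ((g ∘ 𝒰.pr q.1.1 : X → 𝒰.Transversal) : Germ _ _)⟩ := by
  have hcomp : ∀ (γ : Σ x : 𝒰.Transversal, Germ (𝓝 x) 𝒰.Transversal)
      (ht : Tendsto (𝒰.pr q.1.1) (𝓝 (q.1.2.1 : X)) (𝓝 γ.1)),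
      γ = ⟨t, (g : Germ (𝓝 t) 𝒰.Transversal)⟩ →
      γ.2.compTendsto (𝒰.pr q.1.1) ht = ((g ∘ 𝒰.pr q.1.1 : X → 𝒰.Transversal) : Germ _ _) := by
    rintro γ ht rfl
    rfl
  exact congrArg (Sigma.mk _) (hcomp _ q.tendsto_pr hq)

end XTilde

theorem toGerm_eq_of_glue {q r : 𝒰.XTilde S t₀} (h : 𝒰.glue S t₀ q r) :
    q.toGerm = r.toGerm := by
  obtain ⟨hqr, g, -, t, -, -, hr, hq⟩ := h
  rw [q.toGerm_eq hq, r.toGerm_eq hr]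
  refine sigma_germ_eq_iff.2 ⟨hqr, ?_⟩
  filter_upwards [(isOpen_U _).mem_nhds q.1.2.1.2,
    (isOpen_U r.1.1).mem_nhds (hqr ▸ r.1.2.1.2)] with x hxq hxr
  exact congrArg g (hol_pr hxq hxr)

theorem glue_of_toGerm_eq {q r : 𝒰.XTilde S t₀} (h : q.toGerm = r.toGerm) :
    𝒰.glue S t₀ q r := by
  obtain ⟨g, hg, hr, hrs, -⟩ := r.exists_germ_eq
  obtain ⟨g', -, hq, -, -⟩ := q.exists_germ_eq
  rw [q.toGerm_eq hq, r.toGerm_eq hr] at h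
  obtain ⟨hqr, hgg'⟩ := sigma_germ_eq_iff.1 h
  have hxr : (q.1.2.1 : X) ∈ 𝒰.U r.1.1 := hqr ▸ r.1.2.1.2
  have hxq := q.1.2.1.2
  rw [← hqr] at hr hrs
  refine ⟨hqr, g, hg, _, hrs, pr_mem_hol_source hxr hxq, hr, ?_⟩
  rw [hq, hol_pr hxr hxq]
  refine sigma_germ_eq_iff.2 ⟨rfl, (eventually_nhds_pr hxq).2 ?_⟩
  filter_upwards [hgg', (isOpen_U _).mem_nhds hxq, (isOpen_U _).mem_nhds hxr] with x hx hxq hxr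
  exact hx.trans (congrArg g (hol_pr hxq hxr).symm)

namespace XHat

/-- The germ at `x` of `g ∘ p_i`, for the class `[x, γ, i]` with `γ` the germ of `g`. -/
noncomputable def toGerm : 𝒰.XHat S t₀ → Σ x : X, Germ (𝓝 x) 𝒰.Transversal :=
  Quot.lift XTilde.toGerm fun _ _ => toGerm_eq_of_glue

theorem toGerm_injective : Function.Injective (toGerm : 𝒰.XHat S t₀ → _) := by
  rintro ⟨q⟩ ⟨r⟩ h
  exact Quot.sound (glue_of_toGerm_eq h)

theorem toGerm_fst (z : 𝒰.XHat S t₀) : z.toGerm.1 = 𝒰.piHat S t₀ z := by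
  induction z using Quot.ind
  rfl

theorem exists_toGerm_eq (z : 𝒰.XHat S t₀) : ∃ ψ : X → 𝒰.Transversal,
    z.toGerm = ⟨𝒰.piHat S t₀ z, (ψ : Germ _ _)⟩ ∧
      Tendsto ψ (𝓝 (𝒰.piHat S t₀ z)) (𝓝 t₀) := by
  induction z using Quot.ind with
  | mk q =>
    obtain ⟨g, -, hq, hs, hg⟩ := q.exists_germ_eq
    exact ⟨_, q.toGerm_eq hq, (hg ▸ (g.continuousAt hs).tendsto).comp (continuousAt_pr q.1.2.1.2)⟩

theorem mapGerm_symm_mapGerm_toGerm {T' : Type*} [TopologicalSpace T']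
    {l : OpenPartialHomeomorph 𝒰.Transversal T'} (hl : t₀ ∈ l.source) (z : 𝒰.XHat S t₀) :
    mapGerm l.symm (mapGerm l z.toGerm) = z.toGerm := by
  obtain ⟨ψ, hz, hψ⟩ := z.exists_toGerm_eq
  rw [hz]
  refine sigma_germ_eq_iff.2 ⟨rfl, ?_⟩
  filter_upwards [hψ.eventually (l.open_source.mem_nhds hl)] with x hx
  exact l.left_inv hx

end XHat

variable {ι' : Type*} {𝒰' : RegularAtlas ℱ ι'} [Nonempty 𝒰'.Transversal]
  {S' : Set (OpenPartialHomeomorph 𝒰'.Transversal 𝒰'.Transversal)} {t₁ : 𝒰'.Transversal}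

theorem piHat_eq_of_toGerm_eq {l : 𝒰.Transversal → 𝒰'.Transversal} {z : 𝒰.XHat S t₀}
    {w : 𝒰'.XHat S' t₁} (h : w.toGerm = mapGerm l z.toGerm) :
    𝒰'.piHat S' t₁ w = 𝒰.piHat S t₀ z := by
  rw [← XHat.toGerm_fst, ← XHat.toGerm_fst, h]
  rfl

variable {l : OpenPartialHomeomorph 𝒰.Transversal 𝒰'.Transversal}

theorem toGerm_eq_mapGerm_of_germConj {q : 𝒰.XTilde S t₀} {r : 𝒰'.XTilde S' t₁}
    {c : OpenPartialHomeomorph 𝒰.Transversal 𝒰'.Transversal} {B : Set X}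
    (hB : IsBox 𝒰 𝒰' q.1.1 r.1.1 c B) (hqB : (q.1.2.1 : X) ∈ B)
    (hqr : (r.1.2.1 : X) = q.1.2.1) (h : GermConj c.symm l q.1.2.2.1.1 r.1.2.2.1.1) :
    r.toGerm = mapGerm l q.toGerm := by
  obtain ⟨g, s, -, -, hq, hr⟩ := h
  rw [r.toGerm_eq hr, q.toGerm_eq hq]
  refine sigma_germ_eq_iff.2 ⟨hqr, ?_⟩
  filter_upwards [hB.isOpen.mem_nhds (hqr ▸ hqB)] with x hx
  exact congrArg (fun t => l (g t)) (hB.symm.map_pr x hx)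

theorem exists_local_lift (hl : t₀ ∈ l.source) (hlt : l t₀ = t₁)
    (hT : ∀ i j c B, IsBox 𝒰 𝒰' i j c B → Transports S S' c.symm l) (q₀ : 𝒰.XTilde S t₀) :
    ∃ O : Set (𝒰.XTilde S t₀), IsOpen O ∧ q₀ ∈ O ∧ ∃ Θ : O → 𝒰'.XTilde S' t₁, Continuous Θ ∧
      ∀ q, (Θ q).toGerm = mapGerm l q.1.toGerm := by
  obtain ⟨j, hj⟩ := 𝒰'.cover (q₀.1.2.1 : X)
  obtain ⟨c, B, hB, hxB, -⟩ := exists_isBox 𝒰 𝒰' q₀.1.2.1.2 hj univ_mem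
  obtain ⟨Φ, hΦ, hΦconj⟩ := (hT _ _ c B hB).exists_continuous_germConj
  let O : Set (𝒰.XTilde S t₀) := {q | q.1.1 = q₀.1.1 ∧ (q.1.2.1 : X) ∈ B}
  have hO : IsOpen O :=
    ((isOpen_sigma_fst_preimage {q₀.1.1}).preimage continuous_subtype_val).inter
      (hB.isOpen.preimage XTilde.continuous_point)
  have hpr (q : O) : 𝒰.pr q₀.1.1 (q.1.1.2.1 : X) = q.1.1.2.2.source :=
    (congrArg (fun i => 𝒰.pr i (q.1.1.2.1 : X)) q.2.1).symm.trans q.1.pr_eq_source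
  have hcomposable (q : O) :
      q.1.1.2.2.1.1.1 ∈ c.symm.target ∧ q.1.1.2.2.1.1.2.value ∈ l.source :=
    ⟨mem_of_eq_of_mem (hpr q).symm (hB.pr_mem_source q.2.2),
      mem_of_eq_of_mem q.1.1.2.2.2 hl⟩
  let γ' (q : O) : That S' := Φ ⟨q.1.1.2.2.1, hcomposable q⟩
  have hconj (q : O) : GermConj c.symm l q.1.1.2.2.1.1 (γ' q).1 := hΦconj ⟨_, hcomposable q⟩
  have hvalue (q : O) : (γ' q).1.2.value = t₁ :=
    (hconj q).value_eq.trans ((congrArg l q.1.1.2.2.2).trans hlt)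
  have hsource (q : O) : 𝒰'.p j ⟨q.1.1.2.1, hB.right q.2.2⟩ = (γ' q).1.1 := by
    rw [← pr_of_mem (hB.right q.2.2), ← hB.map_pr _ q.2.2, hpr q]
    exact (hconj q).fst_eq.symm
  let Θ : O → 𝒰'.XTilde S' t₁ := fun q =>
    ⟨⟨j, ⟨q.1.1.2.1, hB.right q.2.2⟩, ⟨γ' q, hvalue q⟩⟩, hsource q⟩
  refine ⟨O, hO, ⟨rfl, hxB⟩, Θ, ?_, fun q => ?_⟩
  · refine Continuous.subtype_mk (continuous_sigmaMk.comp (Continuous.prodMk ?_ ?_)) _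
    · exact (XTilde.continuous_point.comp continuous_subtype_val).subtype_mk _
    · exact (hΦ.comp ((XTilde.continuous_germ.comp
        continuous_subtype_val).subtype_mk _)).subtype_mk _
  · exact toGerm_eq_mapGerm_of_germConj (r := Θ q) (q.2.1.symm ▸ hB) q.2.2 rfl (hconj q)

theorem exists_continuous_toGerm_eq (hl : t₀ ∈ l.source) (hlt : l t₀ = t₁)
    (hT : ∀ i j c B, IsBox 𝒰 𝒰' i j c B → Transports S S' c.symm l) :
    ∃ F : 𝒰.XHat S t₀ → 𝒰'.XHat S' t₁, Continuous F ∧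
      ∀ z, (F z).toGerm = mapGerm l z.toGerm := by
  have hlift := exists_local_lift (S := S) (S' := S') hl hlt hT
  have hex : ∀ q : 𝒰.XTilde S t₀, ∃ z : 𝒰'.XHat S' t₁, z.toGerm = mapGerm l q.toGerm := by
    intro q
    obtain ⟨O, -, hq, Θ, -, hΘ⟩ := hlift q
    exact ⟨Quot.mk _ (Θ ⟨q, hq⟩), hΘ ⟨q, hq⟩⟩
  choose G hG using hex
  have hGc : Continuous G := by
    refine continuous_iff_continuousAt.2 fun q => ?_
    obtain ⟨O, hO, hq, Θ, hΘc, hΘ⟩ := hlift q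
    refine ContinuousOn.continuousAt ?_ (hO.mem_nhds hq)
    rw [continuousOn_iff_continuous_domRestrict]
    have hGΘ : O.domRestrict G = fun r => Quot.mk _ (Θ r) := by
      funext r
      exact XHat.toGerm_injective ((hG r).trans (hΘ r).symm)
    rw [hGΘ]
    exact continuous_quot_mk.comp hΘc
  refine ⟨Quot.lift G fun q r h => XHat.toGerm_injective ?_, continuous_quot_lift _ hGc, ?_⟩
  · rw [hG, hG, toGerm_eq_of_glue h]
  · rintro ⟨q⟩
    exact hG q

theorem exists_homeomorph_toGerm_eq (hl : t₀ ∈ l.source) (hlt : l t₀ = t₁)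
    (hT : ∀ i j c B, IsBox 𝒰 𝒰' i j c B → Transports S S' c.symm l)
    (hT' : ∀ i j c B, IsBox 𝒰' 𝒰 i j c B → Transports S' S c.symm l.symm) :
    ∃ F : 𝒰.XHat S t₀ ≃ₜ 𝒰'.XHat S' t₁, ∀ z, (F z).toGerm = mapGerm l z.toGerm := by
  have hl' : t₁ ∈ l.symm.source := hlt ▸ l.map_source hl
  have hlt' : l.symm t₁ = t₀ := by rw [← hlt, l.left_inv hl]
  obtain ⟨F, hFc, hF⟩ := exists_continuous_toGerm_eq (S := S) (S' := S') hl hlt hT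
  obtain ⟨G, hGc, hG⟩ := exists_continuous_toGerm_eq (S := S') (S' := S) hl' hlt' hT'
  have hGF : Function.LeftInverse G F := fun z => XHat.toGerm_injective (by
    rw [hG, hF, XHat.mapGerm_symm_mapGerm_toGerm hl])
  have hFG : Function.RightInverse G F := fun w => XHat.toGerm_injective (by
    rw [hF, hG]
    exact w.mapGerm_symm_mapGerm_toGerm hl')
  exact ⟨⟨⟨F, G, hGF, hFG⟩, hFc, hGc⟩, hF⟩

end RegularAtlas

namespace RegularAtlas

variable {n : ℕ} {X : Type u} {Z : Type v} [TopologicalSpace X] [TopologicalSpace Z]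
  {ℱ : FoliatedStructure n X Z} {ι : Type w} {𝒰 : RegularAtlas ℱ ι}
  {S : Set (OpenPartialHomeomorph 𝒰.Transversal 𝒰.Transversal)} {t₀ : 𝒰.Transversal}

/-- The plaque `{[x, γ, i] | x ∈ U_i, p_i(x) = π̂₀(γ)}` of `X̂₀`; it is empty when `π̂₀(γ)` is not
in `T_i`. -/
def hatPlaque (i : ι) (γ : That₀ S t₀) : Set (𝒰.XHat S t₀) :=
  {z | ∃ q : 𝒰.XTilde S t₀, q.1.1 = i ∧ q.1.2.2 = γ ∧ z = Quot.mk _ q}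

theorem exists_mem_hatPlaques (z : 𝒰.XHat S t₀) : ∃ P ∈ 𝒰.hatPlaques S t₀, z ∈ P := by
  obtain ⟨q⟩ := z
  exact ⟨hatPlaque q.1.1 q.1.2.2, ⟨_, _, (congrArg Sigma.fst q.2).symm, rfl⟩, q, rfl, rfl, rfl⟩

variable [Nonempty 𝒰.Transversal] {i : ι} {γ : That₀ S t₀} {t : 𝒰.Transversal}
  {g : 𝒰.Transversal → 𝒰.Transversal}

theorem exists_mem_hatPlaque_toGerm_eq
    (hγ : γ.1.1 = ⟨t, (g : Germ (𝓝 t) 𝒰.Transversal)⟩) {x : X} (hx : x ∈ 𝒰.U i)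
    (hxt : 𝒰.pr i x = t) :
    ∃ z ∈ hatPlaque i γ, z.toGerm = ⟨x, ((g ∘ 𝒰.pr i : X → 𝒰.Transversal) : Germ _ _)⟩ := by
  let q : 𝒰.XTilde S t₀ := ⟨⟨i, ⟨x, hx⟩, γ⟩,
    (pr_of_mem hx).symm.trans (hxt.trans (congrArg Sigma.fst hγ).symm)⟩
  exact ⟨Quot.mk _ q, ⟨q, rfl, rfl, rfl⟩, q.toGerm_eq hγ⟩

theorem mem_hatPlaque_iff (hγ : γ.1.1 = ⟨t, (g : Germ (𝓝 t) 𝒰.Transversal)⟩)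
    {z : 𝒰.XHat S t₀} :
    z ∈ hatPlaque i γ ↔ 𝒰.piHat S t₀ z ∈ 𝒰.U i ∧ 𝒰.pr i (𝒰.piHat S t₀ z) = t ∧
      z.toGerm = ⟨𝒰.piHat S t₀ z, ((g ∘ 𝒰.pr i : X → 𝒰.Transversal) : Germ _ _)⟩ := by
  constructor
  · rintro ⟨q, rfl, rfl, rfl⟩
    exact ⟨q.1.2.1.2, q.pr_eq_source.trans (congrArg Sigma.fst hγ), q.toGerm_eq hγ⟩
  · rintro ⟨hU, ht, hz⟩
    obtain ⟨w, hw, hwz⟩ := exists_mem_hatPlaque_toGerm_eq hγ hU ht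
    rwa [XHat.toGerm_injective (hz.trans hwz.symm)]

variable {ι' : Type*} {𝒰' : RegularAtlas ℱ ι'} [Nonempty 𝒰'.Transversal]
  {S' : Set (OpenPartialHomeomorph 𝒰'.Transversal 𝒰'.Transversal)} {t₁ : 𝒰'.Transversal}
  {l : 𝒰.Transversal → 𝒰'.Transversal} {F : 𝒰.XHat S t₀ ≃ₜ 𝒰'.XHat S' t₁}

theorem mem_image_hatPlaque_iff (hF : ∀ z, (F z).toGerm = mapGerm l z.toGerm)
    (hγ : γ.1.1 = ⟨t, (g : Germ (𝓝 t) 𝒰.Transversal)⟩) {w : 𝒰'.XHat S' t₁} :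
    w ∈ F '' hatPlaque i γ ↔
      𝒰'.piHat S' t₁ w ∈ 𝒰.U i ∧ 𝒰.pr i (𝒰'.piHat S' t₁ w) = t ∧ w.toGerm =
        ⟨𝒰'.piHat S' t₁ w, ((l ∘ g ∘ 𝒰.pr i : X → 𝒰'.Transversal) : Germ _ _)⟩ := by
  constructor
  · rintro ⟨z, hz, rfl⟩
    obtain ⟨hU, ht, hzg⟩ := (mem_hatPlaque_iff hγ).1 hz
    rw [hF, piHat_eq_of_toGerm_eq (hF z), hzg]
    exact ⟨hU, ht, rfl⟩
  · rintro ⟨hU, ht, hw⟩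
    obtain ⟨z, hz, hzg⟩ := exists_mem_hatPlaque_toGerm_eq hγ hU ht
    refine ⟨z, hz, XHat.toGerm_injective ?_⟩
    rw [hF, hzg, hw]
    rfl

theorem exists_isOpen_forall_mem_image_hatPlaque_iff
    (hF : ∀ z, (F z).toGerm = mapGerm l z.toGerm) {j : ι'} {γ' : That₀ S' t₁}
    {w : 𝒰'.XHat S' t₁} (hw : w ∈ F '' hatPlaque i γ) (hw' : w ∈ hatPlaque j γ') :
    ∃ O, IsOpen O ∧ w ∈ O ∧ ∀ v ∈ O, v ∈ F '' hatPlaque i γ ↔ v ∈ hatPlaque j γ' := by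
  obtain ⟨g, -, t, -, hγ⟩ := γ.1.2
  obtain ⟨g', -, t', -, hγ'⟩ := γ'.1.2
  obtain ⟨hwi, hwt, hwg⟩ := (mem_image_hatPlaque_iff hF hγ).1 hw
  obtain ⟨hwj, hwt', hwg'⟩ := (mem_hatPlaque_iff hγ').1 hw'
  have hgg' := (sigma_germ_eq_iff.1 (hwg.symm.trans hwg')).2
  obtain ⟨c, B, hB, hwB, -⟩ := exists_isBox 𝒰 𝒰' hwi hwj univ_mem
  have hct : c t = t' := by rw [← hwt, hB.map_pr _ hwB, hwt']
  have hlg : ∀ᶠ s in 𝓝 t, l (g s) = g' (c s) := by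
    rw [← hwt, eventually_nhds_pr hwi]
    filter_upwards [hgg', hB.isOpen.mem_nhds hwB] with x hx hxB
    exact hx.trans (congrArg g' (hB.map_pr x hxB).symm)
  refine ⟨𝒰'.piHat S' t₁ ⁻¹' B, hB.isOpen.preimage continuous_piHat, hwB, fun v hv => ?_⟩
  have hpr : 𝒰.pr i (𝒰'.piHat S' t₁ v) = t ↔ 𝒰'.pr j (𝒰'.piHat S' t₁ v) = t' := by
    rw [← hB.map_pr _ hv, ← hct]
    exact (c.injOn.eq_iff (hB.pr_mem_source hv) (hwt ▸ hB.pr_mem_source hwB)).symm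
  rw [mem_image_hatPlaque_iff hF hγ, mem_hatPlaque_iff hγ', ← hpr]
  refine and_congr (iff_of_true (hB.left hv) (hB.right hv)) (and_congr_right fun hvt => ?_)
  have hgerm : (l ∘ g ∘ 𝒰.pr i) =ᶠ[𝓝 (𝒰'.piHat S' t₁ v)] (g' ∘ 𝒰'.pr j) := by
    rw [← hvt, eventually_nhds_pr (hB.left hv)] at hlg
    filter_upwards [hlg, hB.isOpen.mem_nhds hv] with x hx hxB
    exact hx.trans (congrArg g' (hB.map_pr x hxB))
  rw [sigma_germ_eq_iff.2 ⟨rfl, hgerm⟩]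

theorem coherent_hatPlaques (hF : ∀ z, (F z).toGerm = mapGerm l z.toGerm)
    {P : Set (𝒰.XHat S t₀)} (hP : P ∈ 𝒰.hatPlaques S t₀) {Q : Set (𝒰'.XHat S' t₁)}
    (hQ : Q ∈ 𝒰'.hatPlaques S' t₁) :
    IsOpenIn (F '' P ∩ Q) (F '' P) ∧ IsOpenIn (F '' P ∩ Q) Q := by
  obtain ⟨i, γ, -, rfl⟩ := hP
  obtain ⟨j, γ', -, rfl⟩ := hQ
  refine ⟨isOpenIn_of_forall inter_subset_left fun w hw => ?_,
    isOpenIn_of_forall inter_subset_right fun w hw => ?_⟩ <;>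
  obtain ⟨O, hO, hwO, hiff⟩ := exists_isOpen_forall_mem_image_hatPlaque_iff hF hw.1 hw.2
  · exact ⟨O, hO, hwO, fun v hv => ⟨hv.1, (hiff v hv.2).1 hv.1⟩⟩
  · exact ⟨O, hO, hwO, fun v hv => ⟨(hiff v hv.2).2 hv.1, hv.1⟩⟩

end RegularAtlas

namespace RegularAtlas

variable {n : ℕ} {X : Type u} {Z : Type v} [TopologicalSpace X] [CompactSpace X] [T2Space X]
  [TopologicalSpace Z] {ℱ : FoliatedStructure n X Z} {ι ι' : Type*} {𝒰 : RegularAtlas ℱ ι}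
  [Nonempty 𝒰.Transversal] {𝒰' : RegularAtlas ℱ ι'} [Nonempty 𝒰'.Transversal]
  {S : Set (OpenPartialHomeomorph 𝒰.Transversal 𝒰.Transversal)}
  {S' : Set (OpenPartialHomeomorph 𝒰'.Transversal 𝒰'.Transversal)}

theorem exists_transports_apply_eq (hmin : ℱ.IsMinimal)
    (hS : IsAdmissible 𝒰.holonomyPseudogroup S) (hS' : IsAdmissible 𝒰'.holonomyPseudogroup S')
    (t₀ : 𝒰.Transversal) (t₁ : 𝒰'.Transversal) :
    ∃ l : OpenPartialHomeomorph 𝒰.Transversal 𝒰'.Transversal, t₀ ∈ l.source ∧ l t₀ = t₁ ∧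
      (∀ i j c B, IsBox 𝒰 𝒰' i j c B → Transports S S' c.symm l) ∧
      (∀ i j c B, IsBox 𝒰' 𝒰 i j c B → Transports S' S c.symm l.symm) := by
  obtain ⟨x, hx, hxt⟩ := exists_pr_eq t₀
  obtain ⟨j, hj⟩ := 𝒰'.cover x
  obtain ⟨c, B, hB, hxB, -⟩ := exists_isBox 𝒰 𝒰' hx hj univ_mem
  obtain ⟨a, ha, ha', hca, hat⟩ := exists_mem_starClosure_apply_eq hmin hS' (c t₀) t₁
  have hc : t₀ ∈ c.source := mem_of_eq_of_mem hxt.symm (hB.pr_mem_source hxB)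
  exact ⟨c.trans a, ⟨hc, hca⟩, hat,
    fun _ _ _ _ hd => (transports_of_isBox hS hS' hd hB).trans_right hS'.isLocal ha,
    fun _ _ _ _ hd => (transports_of_isBox hS' hS hd hB.symm).trans_left hS'.isLocal ha'⟩

end RegularAtlas

end Molino

theorem mainTheorem7_general {n : ℕ} {X Z : Type*} [TopologicalSpace X] [CompactSpace X]
    [T2Space X] [TopologicalSpace Z] (ℱ : Molino.FoliatedStructure n X Z) (hmin : ℱ.IsMinimal)
    {ι ι' : Type*} (𝒰 : Molino.RegularAtlas ℱ ι)
    (S : Set (OpenPartialHomeomorph 𝒰.Transversal 𝒰.Transversal))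
    (hS : Molino.IsAdmissible 𝒰.holonomyPseudogroup S) (t₀ : 𝒰.Transversal)
    (𝒰' : Molino.RegularAtlas ℱ ι')
    (S' : Set (OpenPartialHomeomorph 𝒰'.Transversal 𝒰'.Transversal))
    (hS' : Molino.IsAdmissible 𝒰'.holonomyPseudogroup S') (t₁ : 𝒰'.Transversal) :
    ∃ F : 𝒰.XHat S t₀ ≃ₜ 𝒰'.XHat S' t₁,
      Molino.IsFoliatedHomeomorph (𝒰.hatPlaques S t₀) (𝒰'.hatPlaques S' t₁) F ∧
      ∀ z, 𝒰'.piHat S' t₁ (F z) = 𝒰.piHat S t₀ z := by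
  have : Nonempty 𝒰.Transversal := ⟨t₀⟩
  have : Nonempty 𝒰'.Transversal := ⟨t₁⟩
  obtain ⟨l, hl, hlt, hT, hT'⟩ :=
    Molino.RegularAtlas.exists_transports_apply_eq hmin hS hS' t₀ t₁
  obtain ⟨F, hF⟩ := Molino.RegularAtlas.exists_homeomorph_toGerm_eq hl hlt hT hT'
  exact ⟨F, Molino.isFoliatedHomeomorph_of_coherent Molino.RegularAtlas.exists_mem_hatPlaques
    Molino.RegularAtlas.exists_mem_hatPlaques
    fun P hP Q hQ => Molino.RegularAtlas.coherent_hatPlaques hF hP hQ,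
    fun z => Molino.RegularAtlas.piHat_eq_of_toGerm_eq (hF z)⟩

theorem mainTheorem7 {n : ℕ} {X Z : Type*}
    [TopologicalSpace X] [PolishSpace X] [CompactSpace X]
    [TopologicalSpace Z] [PolishSpace Z] [LocallyCompactSpace Z]
    (ℱ : Molino.FoliatedStructure n X Z) (hmin : ℱ.IsMinimal)
    {ι ι' : Type*}
    (𝒰 : Molino.RegularAtlas ℱ ι)
    (S : Set (OpenPartialHomeomorph 𝒰.Transversal 𝒰.Transversal))
    (hS : Molino.IsAdmissible 𝒰.holonomyPseudogroup S)
    (i₀ : ι) (x₀ : 𝒰.U i₀)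
    (𝒰' : Molino.RegularAtlas ℱ ι')
    (S' : Set (OpenPartialHomeomorph 𝒰'.Transversal 𝒰'.Transversal))
    (hS' : Molino.IsAdmissible 𝒰'.holonomyPseudogroup S')
    (i₁ : ι') (x₁ : 𝒰'.U i₁) :
    ∃ F : 𝒰.XHat S (𝒰.p i₀ x₀) ≃ₜ 𝒰'.XHat S' (𝒰'.p i₁ x₁),
      Molino.IsFoliatedHomeomorph
        (𝒰.hatPlaques S (𝒰.p i₀ x₀)) (𝒰'.hatPlaques S' (𝒰'.p i₁ x₁)) F ∧
      ∀ z, 𝒰'.piHat S' (𝒰'.p i₁ x₁) (F z) = 𝒰.piHat S (𝒰.p i₀ x₀) z := by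
  exact mainTheorem7_general ℱ hmin 𝒰 S hS (𝒰.p i₀ x₀) 𝒰' S' hS' (𝒰'.p i₁ x₁)
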